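/- Let $M$ be a compact, connected smooth manifold of dimension $n$ without boundary (oriented or not), let $g_0$ be a smooth Riemannian metric on $M$, and let $(g_j)_{j\in\mathbb N}$ be a sequence of continuous Riemannian metrics on $M$. For a continuous Riemannian metric $g$ let $dV_g$ be its Riemannian volume measure and $|\nabla^g f|_g=(g^{ab}\partial_af\,\partial_bf)^{1/2}$; let $|\cdot|_{g_0}$ be the norm that $g_0$ induces on tensors, so that $|g|_{g_0}=(\sum_{i}\lambda_i^4)^{1/2}$ if $\lambda_1^2,\dots,\lambda_n^2$ are the eigenvalues of $g$ with respect to $g_0$; and let $d_{g_0}$ be the Riemannian distance of $g_0$. For real numbers $p>n$ and $D>0$ put $$\mathcal H_{p,g_0}(f)=\sup_{x\ne y}\frac{|f(x)-f(y)|}{d_{g_0}(x,y)^{(p-n)/p}},$$ $$d^{D}_{p,g,g_0}(x_1,x_2)=\sup\Big\{|f(x_1)-f(x_2)| \;:\; \mathcal H_{p,g_0}(f)\le D,\ \int_M|\nabla^g f|_g^p\,dV_g\le 1\Big\},$$ where the supremum is over the functions $f:M\to\mathbb R$ that have a locally integrable weak differential and $\nabla^g f$ is the corresponding weak gradient. Let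 $p>n$ and $D>0$, and suppose that $$\int_M|g_j^{-1}-g_0^{-1}|_{g_0}^{\frac{n(p-1)}2}\,dV_{g_0}\longrightarrow 0\quad (j\to\infty)$$ and that there is a constant $C$ with $$\int_M|g_j|_{g_0}^{\frac n2}\,dV_{g_0}\le C\quad\text{for all } j.$$ Then for all $x_1,x_2\in M$ $$\liminf_{j\to\infty} d^{D}_{p,g_j,g_0}(x_1,x_2)\ \ge\ d^{D}_{p,g_0,g_0}(x_1,x_2).$$ -/

import Mathlib

open Filter Topology MeasureTheory Bundle
open scoped Manifold ContDiff NNReal ENNReal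

noncomputable section

namespace ModifiedDp

/-- The model space `ℝⁿ` with its Euclidean norm and Lebesgue measure. -/
abbrev Eu (n : ℕ) : Type := EuclideanSpace ℝ (Fin n)

/-- Continuous Riemannian metrics on an `n`-dimensional manifold `M`. -/
abbrev ContMetric (n : ℕ) (M : Type*) [TopologicalSpace M] [ChartedSpace (Eu n) M]
    [IsManifold (𝓡 n) ∞ M] :=
  ContinuousRiemannianMetric (Eu n) (fun x : M => TangentSpace (𝓡 n) x)

/-- Smooth Riemannian metrics on an `n`-dimensional manifold `M`. -/
abbrev SmoothMetric (n : ℕ) (M : Type*) [TopologicalSpace M] [ChartedSpace (Eu n) M]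
    [IsManifold (𝓡 n) ∞ M] :=
  ContMDiffRiemannianMetric (𝓡 n) ∞ (Eu n) (fun x : M => TangentSpace (𝓡 n) x)

section Pointwise

variable {n : ℕ} {M : Type*} [TopologicalSpace M] [ChartedSpace (Eu n) M] [IsManifold (𝓡 n) ∞ M]

/-- A basis of `T_x M`: the standard basis of `ℝⁿ`, through Mathlib's identification of `T_x M`
with `ℝⁿ` given by the preferred chart at `x`. It only serves to write down pointwise scalars
(`|g|_{g₀}`, `|∇f|_g`, ...) in index notation; these do not depend on the basis. -/
def frame (x : M) (a : Fin n) : TangentSpace (𝓡 n) x :=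
  (EuclideanSpace.single a (1 : ℝ) : Eu n)

/-- The matrix `g(v_a, v_b)`. -/
def gram (g : ContMetric n M) (x : M) (v : Fin n → TangentSpace (𝓡 n) x) :
    Matrix (Fin n) (Fin n) ℝ :=
  Matrix.of fun a b => g.inner x (v a) (v b)

/-- The components `g_{ab}` of the metric at `x`. Its matrix inverse consists of the components
`g^{ab}` of the inverse metric `g⁻¹`. -/
def comps (g : ContMetric n M) (x : M) : Matrix (Fin n) (Fin n) ℝ :=
  gram g x (frame x)

/-- For an inner product `S` and a bilinear form `W` in index notation,
`(∑ S^{ac} S^{bd} W_{ab} W_{cd})^{1/2}`, the norm of `W` with respect to `S`. In an orthonormal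
basis this is `(∑ (W_{ab})²)^{1/2}`. -/
def tensorNorm (S W : Matrix (Fin n) (Fin n) ℝ) : ℝ :=
  Real.sqrt (∑ a, ∑ b, ∑ c, ∑ d, S a c * S b d * W a b * W c d)

/-- `|g|_{g₀}` at `x`; equal to `(λ₁⁴ + ⋯ + λₙ⁴)^{1/2}` if `λᵢ²` are the eigenvalues of `g` with
respect to `g₀`. -/
def metricNorm (g₀ g : ContMetric n M) (x : M) : ℝ :=
  tensorNorm (comps g₀ x)⁻¹ (comps g x)

/-- `|g⁻¹ - g₀⁻¹|_{g₀}` at `x`. The inner product induced by `g₀` on tensors with upper indices is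
computed with the components of `g₀` with lower indices. -/
def invMetricDiffNorm (g₀ g : ContMetric n M) (x : M) : ℝ :=
  tensorNorm (comps g₀ x) ((comps g x)⁻¹ - (comps g₀ x)⁻¹)

/-- For a covector `α = df` at `x`, the norm of the gradient: `|∇^g f|_g = (g^{ab} α_a α_b)^{1/2}`. -/
def gradNorm (g : ContMetric n M) (x : M) (α : TangentSpace (𝓡 n) x →L[ℝ] ℝ) : ℝ :=
  Real.sqrt (∑ a, ∑ b, (comps g x)⁻¹ a b * α (frame x a) * α (frame x b))

/-- The pushforward of a vector `v` of `ℝⁿ` to `M` through the inverse of the chart `e`, at the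
point with coordinates `y`. For `v` the `a`-th standard basis vector it is the coordinate vector
field `∂_a` of the chart. -/
def chartVec (e : OpenPartialHomeomorph M (Eu n)) (y v : Eu n) :
    TangentSpace (𝓡 n) (e.symm y) :=
  mfderiv 𝓘(ℝ, Eu n) (𝓡 n) e.symm y v

end Pointwise

section Global

variable {n : ℕ} {M : Type*} [TopologicalSpace M] [ChartedSpace (Eu n) M] [IsManifold (𝓡 n) ∞ M]

/-- The Riemannian distance `d_g(x, y)`: the infimum of the `g`-lengths of `C¹` paths. -/
def metricEDist (g : ContMetric n M) (x y : M) : ℝ≥0∞ :=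
  letI : RiemannianBundle (fun x : M => TangentSpace (𝓡 n) x) := ⟨g.toRiemannianMetric⟩
  Manifold.riemannianEDist (𝓡 n) x y

/-- `(det (g(∂_a, ∂_b)))^{1/2}` in the chart `e`, at the point with coordinates `y`. -/
def volDensity (g : ContMetric n M) (e : OpenPartialHomeomorph M (Eu n)) (y : Eu n) : ℝ :=
  Real.sqrt (gram g (e.symm y)
    (fun a => chartVec e y (EuclideanSpace.single a (1 : ℝ)))).det

/-- The Riemannian volume on the domain of the chart `e`, extended by zero to `M`: the image under
`e⁻¹` of `(det (g(∂_a, ∂_b)))^{1/2} dy¹ ⋯ dyⁿ` on the target of the chart. -/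
def chartVolume [MeasurableSpace M] (g : ContMetric n M)
    (e : OpenPartialHomeomorph M (Eu n)) : Measure M :=
  ((volume.restrict e.target).withDensity
    (fun y => ENNReal.ofReal (volDensity g e y))).map e.symm

/-- The Riemannian volume measure `dV_g`. The measures `chartVolume g e` agree on overlaps of
charts, so that their least upper bound in the lattice of measures is the measure which restricts
to `chartVolume g e` on the domain of each chart `e`. -/
def vol [MeasurableSpace M] (g : ContMetric n M) : Measure M :=
  ⨆ e : atlas (Eu n) M, chartVolume g e.1

/-- `α` is the weak differential of `f`: in every chart the function `f` and the components of
`α` are locally integrable and integration by parts holds against all smooth functions with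
compact support in the image of the chart. -/
def IsWeakDifferential (f : M → ℝ) (α : ∀ x : M, TangentSpace (𝓡 n) x →L[ℝ] ℝ) : Prop :=
  ∀ e ∈ atlas (Eu n) M,
    LocallyIntegrableOn (fun y => f (e.symm y)) e.target ∧
    ∀ v : Eu n,
      LocallyIntegrableOn (fun y => α (e.symm y) (chartVec e y v)) e.target ∧
      ∀ η : Eu n → ℝ, ContDiff ℝ ∞ η → HasCompactSupport η → tsupport η ⊆ e.target →
        ∫ y, f (e.symm y) * fderiv ℝ η y v = - ∫ y, α (e.symm y) (chartVec e y v) * η y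

/-- The Hölder seminorm `H_{p,g₀}(f) = sup_{x,y} |f(x) - f(y)| / d_{g₀}(x,y)^{(p-n)/p}`, with values
in `[0, ∞]` (pairs `x = y` contribute `0 / 0 = 0`). -/
def holderSeminorm (g₀ : ContMetric n M) (p : ℝ) (f : M → ℝ) : ℝ≥0∞ :=
  ⨆ (x : M) (y : M), ENNReal.ofReal |f x - f y| / metricEDist g₀ x y ^ ((p - n) / p)

/-- The functions admissible for the modified `d_p` distance: `H_{p,g₀}(f) ≤ D`, and `f` has a weak
differential with `∫_M |∇^g f|_g^p dV_g ≤ 1`. (The Hölder bound makes `f` continuous, hence, on a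
compact manifold, `f` belongs to `W^{1,p}`.) -/
def Admissible [MeasurableSpace M] (g g₀ : ContMetric n M) (p D : ℝ) (f : M → ℝ) : Prop :=
  holderSeminorm g₀ p f ≤ ENNReal.ofReal D ∧
    ∃ α : ∀ x : M, TangentSpace (𝓡 n) x →L[ℝ] ℝ, IsWeakDifferential f α ∧
      ∫⁻ x, ENNReal.ofReal (gradNorm g x (α x)) ^ p ∂(vol g) ≤ 1

/-- The modified `d_p` distance `d^D_{p,g,g₀}(x, y)`, with values in `[0, ∞]`. -/
def modDist [MeasurableSpace M] (g g₀ : ContMetric n M) (p D : ℝ) (x y : M) : ℝ≥0∞ :=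
  ⨆ (f : M → ℝ) (_ : Admissible g g₀ p D f), ENNReal.ofReal |f x - f y|

end Global

end ModifiedDp

end

/-!
Let `f` be admissible for `g₀`. If `f` were smooth, its energies for the metrics `g_j` would have
an upper limit of at most its energy for `g₀`, which is at most one. Indeed, in terms of the
eigenvalues `μ` of `g_j` with respect to `g₀`, the factor by which the energy density changes is at
most `(min μ)^{-p/2} (∏ μ)^{1/2}`. It is close to one where `g_j⁻¹` is close to `g₀⁻¹`. Elsewhere
the smallest eigenvalue enters only with the exponent `-(p - 1)/2`, and the factor is bounded by a
multiple of `|g_j⁻¹ - g₀⁻¹|^{(p-1)/2} |g_j|^{(n-1)/2}` (`exists_eigenvalue_bound`). By the Hölder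
inequality with exponents `n` and `n / (n - 1)` and the two integral hypotheses, the integral of
this bound tends to zero (`eventually_energy_le`). So a multiple of `f` by a factor close to one is
admissible for `g_j` when `j` is large. This argument needs a gradient that is bounded for `g₀`.

A general admissible `f` is therefore first replaced by a smooth function `h` which is uniformly
close to `f`, and whose Hölder constant and energy for `g₀` exceed those of `f` by small factors
only (`exists_smooth_approximation`). It is obtained by mollifying `f` in charts and gluing with a
partition of unity.

* The energy. The differential of a mollification is the mollification of the weak differential,
  so Jensen's inequality and Tonelli's theorem bound its energy in a chart, up to the oscillation of
  the metric at the scale of the mollification (`eventually_energy_chartMollify_le`). The terms with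
  differentials of the partition of unity contain the uniformly small differences of `f` and its
  mollifications (`gradNorm_differential_glueMollify_le`).
* The Hölder constant. A mollification in a chart is an average of `f` over translations in the
  chart, and small translations are almost isometries of `d_{g₀}` at small distances
  (`exists_metricEDist_chartTranslate_le`), so the Hölder constant for nearby points hardly
  increases. For points farther apart the bound follows from uniform closeness.

In dimension zero the manifold is a point, and both sides vanish.
-/

set_option linter.unusedSectionVars false

namespace ModifiedDp

open Matrix

/-! ### Linear algebra of two inner products -/

section LinearAlgebra

variable {n : ℕ}

lemma tensorNorm_eq_sqrt_trace (S W : Matrix (Fin n) (Fin n) ℝ) :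
    tensorNorm S W = Real.sqrt (S * W * Sᵀ * Wᵀ).trace := by
  unfold tensorNorm
  congr 1
  simp only [Matrix.trace, Matrix.diag_apply, Matrix.mul_apply, Matrix.transpose_apply,
    Finset.sum_mul]
  refine Finset.sum_congr rfl fun a _ => Finset.sum_congr rfl fun b _ => ?_
  rw [Finset.sum_comm]
  refine Finset.sum_congr rfl fun d _ => Finset.sum_congr rfl fun c _ => ?_
  ring

lemma tensorNorm_conj (Q S W : Matrix (Fin n) (Fin n) ℝ) :
    tensorNorm (Q * S * Qᵀ) W = tensorNorm S (Qᵀ * W * Q) := by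
  rw [tensorNorm_eq_sqrt_trace, tensorNorm_eq_sqrt_trace]
  congr 1
  simp only [Matrix.transpose_mul, Matrix.transpose_transpose]
  simp only [Matrix.mul_assoc]
  rw [Matrix.trace_mul_comm Q]
  simp only [Matrix.mul_assoc]

lemma tensorNorm_one_diagonal (w : Fin n → ℝ) :
    tensorNorm 1 (diagonal w) = Real.sqrt (∑ i, w i ^ 2) := by
  rw [tensorNorm_eq_sqrt_trace]
  simp [Matrix.trace, sq]

lemma exists_orthogonal_diagonalization {S : Matrix (Fin n) (Fin n) ℝ} (hS : S.PosDef) :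
    ∃ (U : Matrix (Fin n) (Fin n) ℝ) (l : Fin n → ℝ), U * Uᵀ = 1 ∧ Uᵀ * U = 1 ∧
      (∀ i, 0 < l i) ∧ S = U * diagonal l * Uᵀ := by
  refine ⟨hS.1.eigenvectorUnitary, hS.1.eigenvalues, ?_, ?_, hS.eigenvalues_pos, ?_⟩
  · have := Unitary.mul_star_self_of_mem hS.1.eigenvectorUnitary.2
    rwa [Matrix.star_eq_conjTranspose, Matrix.conjTranspose_eq_transpose_of_trivial] at this
  · have := Unitary.star_mul_self_of_mem hS.1.eigenvectorUnitary.2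
    rwa [Matrix.star_eq_conjTranspose, Matrix.conjTranspose_eq_transpose_of_trivial] at this
  · have := hS.1.spectral_theorem
    rw [Unitary.conjStarAlgAut_apply, Matrix.star_eq_conjTranspose,
      Matrix.conjTranspose_eq_transpose_of_trivial] at this
    exact this

lemma posDef_conj {T Q : Matrix (Fin n) (Fin n) ℝ} (hT : T.PosDef) (hQ : IsUnit Q) :
    (Q * T * Qᵀ).PosDef := by
  have := hT.mul_mul_conjTranspose_same (B := Q) (Matrix.vecMul_injective_of_isUnit hQ)
  rwa [Matrix.conjTranspose_eq_transpose_of_trivial] at this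

/-- Two positive definite matrices are simultaneously diagonal in a suitable basis, which is
orthonormal for the first. -/
lemma exists_simultaneous_diagonalization {S T : Matrix (Fin n) (Fin n) ℝ}
    (hS : S.PosDef) (hT : T.PosDef) :
    ∃ (P A : Matrix (Fin n) (Fin n) ℝ) (μ : Fin n → ℝ), P * A = 1 ∧ A * P = 1 ∧
      (∀ i, 0 < μ i) ∧ S = P * Pᵀ ∧ T = P * diagonal μ * Pᵀ := by
  obtain ⟨U, l, hU, hU', hl, rfl⟩ := exists_orthogonal_diagonalization hS
  set B : Matrix (Fin n) (Fin n) ℝ := U * diagonal fun i => √(l i)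
  set C : Matrix (Fin n) (Fin n) ℝ := (diagonal fun i => (√(l i))⁻¹) * Uᵀ
  have hs : ∀ i, √(l i) ≠ 0 := fun i => (Real.sqrt_pos.2 (hl i)).ne'
  have hBC : B * C = 1 := by
    simp only [B, C]
    rw [Matrix.mul_assoc, ← Matrix.mul_assoc (diagonal _) (diagonal _), diagonal_mul_diagonal]
    simp [hs, hU]
  have hCB : C * B = 1 := mul_eq_one_comm.1 hBC
  have hCu : IsUnit C := ⟨⟨C, B, hCB, hBC⟩, rfl⟩
  obtain ⟨V, μ, hV, hV', hμ, hT'⟩ := exists_orthogonal_diagonalization (posDef_conj hT hCu)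
  have hBCt : Cᵀ * Bᵀ = 1 := by rw [← Matrix.transpose_mul, hBC, Matrix.transpose_one]
  refine ⟨B * V, Vᵀ * C, μ, ?_, ?_, hμ, ?_, ?_⟩
  · rw [Matrix.mul_assoc, ← Matrix.mul_assoc V, hV, Matrix.one_mul, hBC]
  · rw [Matrix.mul_assoc, ← Matrix.mul_assoc C, hCB, Matrix.one_mul, hV']
  · rw [Matrix.transpose_mul B, Matrix.mul_assoc B, ← Matrix.mul_assoc V, hV, Matrix.one_mul]
    have hl' : diagonal l = (diagonal fun i => √(l i)) * diagonal fun i => √(l i) := by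
      simp [diagonal_mul_diagonal, fun i => Real.mul_self_sqrt (hl i).le]
    simp only [B]
    rw [Matrix.transpose_mul, Matrix.diagonal_transpose, hl']
    simp only [Matrix.mul_assoc]
  · calc T = B * C * T * (Cᵀ * Bᵀ) := by rw [hBC, hBCt, Matrix.one_mul, Matrix.mul_one]
      _ = B * (C * T * Cᵀ) * Bᵀ := by simp only [Matrix.mul_assoc]
      _ = _ := by rw [hT', Matrix.transpose_mul B V]; simp only [Matrix.mul_assoc]

/-- The pair of tensor norms, the determinant ratio and the dual norms of two positive definite
matrices `S`, `T`, expressed through the eigenvalues `μ` of `T` with respect to `S`. -/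
lemma exists_relative_eigenvalues {S T : Matrix (Fin n) (Fin n) ℝ}
    (hS : S.PosDef) (hT : T.PosDef) :
    ∃ (A : Matrix (Fin n) (Fin n) ℝ) (μ : Fin n → ℝ), (∀ i, 0 < μ i) ∧
      tensorNorm S⁻¹ T = √(∑ i, μ i ^ 2) ∧
      tensorNorm S (T⁻¹ - S⁻¹) = √(∑ i, ((μ i)⁻¹ - 1) ^ 2) ∧
      T.det / S.det = ∏ i, μ i ∧
      (∀ a : Fin n → ℝ, a ⬝ᵥ S⁻¹ *ᵥ a = ∑ i, (A *ᵥ a) i ^ 2) ∧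
      (∀ a : Fin n → ℝ, a ⬝ᵥ T⁻¹ *ᵥ a = ∑ i, (μ i)⁻¹ * (A *ᵥ a) i ^ 2) := by
  obtain ⟨P, A, μ, hPA, hAP, hμ, rfl, rfl⟩ := exists_simultaneous_diagonalization hS hT
  have hPAt : Aᵀ * Pᵀ = 1 := by rw [← Matrix.transpose_mul, hPA, Matrix.transpose_one]
  have hAPt : Pᵀ * Aᵀ = 1 := by rw [← Matrix.transpose_mul, hAP, Matrix.transpose_one]
  have hD : diagonal μ * diagonal (fun i => (μ i)⁻¹) = 1 := by
    rw [diagonal_mul_diagonal]; simp [fun i => (hμ i).ne']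
  have hSi : (P * Pᵀ)⁻¹ = Aᵀ * A := by
    apply Matrix.inv_eq_right_inv
    rw [Matrix.mul_assoc, ← Matrix.mul_assoc Pᵀ, hAPt, Matrix.one_mul, hPA]
  have hTi : (P * diagonal μ * Pᵀ)⁻¹ = Aᵀ * diagonal (fun i => (μ i)⁻¹) * A := by
    apply Matrix.inv_eq_right_inv
    calc P * diagonal μ * Pᵀ * (Aᵀ * diagonal (fun i => (μ i)⁻¹) * A)
        = P * (diagonal μ * (Pᵀ * Aᵀ) * diagonal (fun i => (μ i)⁻¹)) * A := by
          simp only [Matrix.mul_assoc]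
      _ = 1 := by rw [hAPt, Matrix.mul_one, hD, Matrix.mul_one, hPA]
  refine ⟨A, μ, hμ, ?_, ?_, ?_, fun a => ?_, fun a => ?_⟩
  · rw [hSi]
    have := tensorNorm_conj Aᵀ 1 (P * diagonal μ * Pᵀ)
    rw [Matrix.mul_one, Matrix.transpose_transpose] at this
    rw [this, ← tensorNorm_one_diagonal]
    congr 1
    calc A * (P * diagonal μ * Pᵀ) * Aᵀ = A * P * diagonal μ * (Pᵀ * Aᵀ) := by
          simp only [Matrix.mul_assoc]
      _ = _ := by rw [hAP, hAPt, Matrix.one_mul, Matrix.mul_one]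
  · have := tensorNorm_conj P 1 ((P * diagonal μ * Pᵀ)⁻¹ - (P * Pᵀ)⁻¹)
    rw [Matrix.mul_one] at this
    rw [this, ← tensorNorm_one_diagonal, hSi, hTi]
    congr 1
    calc Pᵀ * (Aᵀ * diagonal (fun i => (μ i)⁻¹) * A - Aᵀ * A) * P
        = Pᵀ * Aᵀ * diagonal (fun i => (μ i)⁻¹) * (A * P) - Pᵀ * Aᵀ * (A * P) := by
          rw [Matrix.mul_sub, Matrix.sub_mul]; simp only [Matrix.mul_assoc]
      _ = _ := by
        rw [hAP, hAPt, Matrix.one_mul, Matrix.mul_one, Matrix.mul_one, ← diagonal_one,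
          diagonal_sub]
  · have hP : P.det ≠ 0 := by
      intro h
      have := congrArg Matrix.det hPA
      rw [Matrix.det_mul, h, zero_mul, Matrix.det_one] at this
      exact zero_ne_one this
    simp only [Matrix.det_mul, Matrix.det_transpose, Matrix.det_diagonal]
    field_simp
  · rw [hSi, ← Matrix.mulVec_mulVec, Matrix.dotProduct_mulVec, Matrix.vecMul_transpose]
    simp [dotProduct, sq]
  · rw [hTi, ← Matrix.mulVec_mulVec, ← Matrix.mulVec_mulVec, Matrix.dotProduct_mulVec,
      Matrix.vecMul_transpose]
    simp only [dotProduct, Matrix.mulVec_diagonal]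
    exact Finset.sum_congr rfl fun i _ => by ring

/-- The scalars formed from two Gram matrices do not depend on the basis. -/
lemma tensorNorm_inv_conj {Q S T : Matrix (Fin n) (Fin n) ℝ} (hQ : IsUnit Q) :
    tensorNorm (Q * S * Qᵀ)⁻¹ (Q * T * Qᵀ) = tensorNorm S⁻¹ T := by
  have h1 : Q⁻¹ * Q = 1 := Matrix.nonsing_inv_mul _ ((Matrix.isUnit_iff_isUnit_det _).1 hQ)
  have h2 : Qᵀ * Q⁻¹ᵀ = 1 := by rw [← Matrix.transpose_mul, h1, Matrix.transpose_one]
  have : (Q * S * Qᵀ)⁻¹ = Q⁻¹ᵀ * S⁻¹ * Q⁻¹ᵀᵀ := by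
    rw [Matrix.mul_inv_rev, Matrix.mul_inv_rev, Matrix.transpose_transpose,
      Matrix.transpose_nonsing_inv, Matrix.mul_assoc]
  rw [this, tensorNorm_conj, Matrix.transpose_transpose]
  congr 1
  calc Q⁻¹ * (Q * T * Qᵀ) * Q⁻¹ᵀ = Q⁻¹ * Q * T * (Qᵀ * Q⁻¹ᵀ) := by simp only [Matrix.mul_assoc]
    _ = T := by rw [h1, h2, Matrix.one_mul, Matrix.mul_one]

lemma tensorNorm_inv_sub_inv_conj {Q S T : Matrix (Fin n) (Fin n) ℝ} (hQ : IsUnit Q) :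
    tensorNorm (Q * S * Qᵀ) ((Q * T * Qᵀ)⁻¹ - (Q * S * Qᵀ)⁻¹) = tensorNorm S (T⁻¹ - S⁻¹) := by
  have h1 : Q⁻¹ * Q = 1 := Matrix.nonsing_inv_mul _ ((Matrix.isUnit_iff_isUnit_det _).1 hQ)
  have h2 : Qᵀ * Q⁻¹ᵀ = 1 := by rw [← Matrix.transpose_mul, h1, Matrix.transpose_one]
  have h3 : ∀ X : Matrix (Fin n) (Fin n) ℝ, (Q * X * Qᵀ)⁻¹ = Q⁻¹ᵀ * X⁻¹ * Q⁻¹ := fun X => by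
    rw [Matrix.mul_inv_rev, Matrix.mul_inv_rev, Matrix.transpose_nonsing_inv, Matrix.mul_assoc]
  rw [h3, h3, tensorNorm_conj]
  congr 1
  calc Qᵀ * (Q⁻¹ᵀ * T⁻¹ * Q⁻¹ - Q⁻¹ᵀ * S⁻¹ * Q⁻¹) * Q
      = Qᵀ * Q⁻¹ᵀ * (T⁻¹ - S⁻¹) * (Q⁻¹ * Q) := by
        simp only [Matrix.mul_sub, Matrix.sub_mul, Matrix.mul_assoc]
    _ = _ := by rw [h1, h2, Matrix.one_mul, Matrix.mul_one]

lemma dotProduct_inv_conj {Q S : Matrix (Fin n) (Fin n) ℝ} (hQ : IsUnit Q) (a : Fin n → ℝ) :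
    (Q *ᵥ a) ⬝ᵥ (Q * S * Qᵀ)⁻¹ *ᵥ (Q *ᵥ a) = a ⬝ᵥ S⁻¹ *ᵥ a := by
  have h1 : Q⁻¹ * Q = 1 := Matrix.nonsing_inv_mul _ ((Matrix.isUnit_iff_isUnit_det _).1 hQ)
  have h2 : Qᵀ * Q⁻¹ᵀ = 1 := by rw [← Matrix.transpose_mul, h1, Matrix.transpose_one]
  rw [Matrix.mul_inv_rev, Matrix.mul_inv_rev, ← Matrix.transpose_nonsing_inv,
    Matrix.mulVec_mulVec, Matrix.mul_assoc, Matrix.mul_assoc, h1, Matrix.mul_one,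
    ← Matrix.vecMul_transpose, ← Matrix.dotProduct_mulVec, Matrix.mulVec_mulVec,
    ← Matrix.mul_assoc, h2, Matrix.one_mul]

end LinearAlgebra

section Metric

variable {n : ℕ} {M : Type*} [TopologicalSpace M] [ChartedSpace (Eu n) M] [IsManifold (𝓡 n) ∞ M]

/-- The norm of a tangent vector for the metric `g`. -/
noncomputable def metricLen (g : ContMetric n M) (x : M) (v : TangentSpace (𝓡 n) x) : ℝ :=
  √(g.inner x v v)

lemma inner_self_nonneg (g : ContMetric n M) (x : M) (v : TangentSpace (𝓡 n) x) :
    0 ≤ g.inner x v v := by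
  by_cases h : v = 0
  · simp [h]
  · exact (g.pos x v h).le

lemma metricLen_nonneg (g : ContMetric n M) (x : M) (v : TangentSpace (𝓡 n) x) :
    0 ≤ metricLen g x v := Real.sqrt_nonneg _

lemma metricLen_sq (g : ContMetric n M) (x : M) (v : TangentSpace (𝓡 n) x) :
    metricLen g x v ^ 2 = g.inner x v v := Real.sq_sqrt (inner_self_nonneg g x v)

lemma abs_inner_le_metricLen_mul (g : ContMetric n M) (x : M) (v w : TangentSpace (𝓡 n) x) :
    |g.inner x v w| ≤ metricLen g x v * metricLen g x w := by
  let : RiemannianBundle (fun x : M => TangentSpace (𝓡 n) x) := ⟨g.toRiemannianMetric⟩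
  have h := abs_real_inner_le_norm v w
  rw [norm_eq_sqrt_real_inner v, norm_eq_sqrt_real_inner w] at h
  exact h

lemma inner_sum_smul (g : ContMetric n M) (x : M) (v : Fin n → TangentSpace (𝓡 n) x)
    (a b : Fin n → ℝ) :
    g.inner x (∑ i, a i • v i) (∑ i, b i • v i) = a ⬝ᵥ gram g x v *ᵥ b := by
  simp only [map_sum, map_smul, _root_.sum_apply, _root_.smul_apply,
    smul_eq_mul, dotProduct, Matrix.mulVec, gram, Matrix.of_apply, Finset.mul_sum]
  rw [Finset.sum_comm]
  exact Finset.sum_congr rfl fun i _ => Finset.sum_congr rfl fun j _ => by ring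

/-- The Gram matrix of linearly independent vectors is positive definite. -/
lemma gram_posDef (g : ContMetric n M) (x : M) {v : Fin n → TangentSpace (𝓡 n) x}
    (hv : LinearIndependent ℝ v) : (gram g x v).PosDef := by
  refine Matrix.PosDef.of_dotProduct_mulVec_pos ?_ fun a ha => ?_
  · ext i j
    simp [gram, g.symm x (v i)]
  · rw [star_trivial, ← inner_sum_smul]
    apply g.pos
    intro h
    exact ha (funext (Fintype.linearIndependent_iff.1 hv a h))

/-- Gram matrices in two bases are congruent. -/
lemma gram_sum_smul (g : ContMetric n M) (x : M) (v : Fin n → TangentSpace (𝓡 n) x)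
    (B : Matrix (Fin n) (Fin n) ℝ) :
    gram g x (fun a => ∑ b, B a b • v b) = B * gram g x v * Bᵀ := by
  ext i j
  have := inner_sum_smul g x v (B i) (B j)
  simp only [gram, Matrix.of_apply] at this ⊢
  rw [this]
  simp only [dotProduct, Matrix.mulVec, Matrix.mul_apply, Matrix.transpose_apply, Finset.mul_sum,
    Finset.sum_mul]
  rw [Finset.sum_comm]
  exact Finset.sum_congr rfl fun i _ => Finset.sum_congr rfl fun j _ => by simp; ring

lemma frame_eq_basisFun (x : M) :
    (frame x : Fin n → Eu n) = (EuclideanSpace.basisFun (Fin n) ℝ).toBasis := by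
  funext a
  rw [OrthonormalBasis.coe_toBasis, EuclideanSpace.basisFun_apply]
  rfl

lemma sum_smul_frame (x : M) (v : TangentSpace (𝓡 n) x) :
    ∑ a, (show Eu n from v) a • frame x a = v := by
  have := (EuclideanSpace.basisFun (Fin n) ℝ).toBasis.sum_repr (show Eu n from v)
  rw [← frame_eq_basisFun x] at this
  exact this

lemma linearIndependent_frame (x : M) : LinearIndependent ℝ (frame (n := n) x) := by
  have := (EuclideanSpace.basisFun (Fin n) ℝ).toBasis.linearIndependent
  rw [← frame_eq_basisFun x] at this
  exact this

lemma comps_posDef (g : ContMetric n M) (x : M) : (comps g x).PosDef :=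
  gram_posDef g x (linearIndependent_frame x)

lemma gradNorm_nonneg (g : ContMetric n M) (x : M) (α : TangentSpace (𝓡 n) x →L[ℝ] ℝ) :
    0 ≤ gradNorm g x α := Real.sqrt_nonneg _

lemma gradNorm_eq_sqrt_dotProduct (g : ContMetric n M) (x : M)
    (α : TangentSpace (𝓡 n) x →L[ℝ] ℝ) :
    gradNorm g x α = √((fun a => α (frame x a)) ⬝ᵥ (comps g x)⁻¹ *ᵥ fun a => α (frame x a)) := by
  unfold gradNorm
  congr 1
  simp only [dotProduct, Matrix.mulVec, Finset.mul_sum]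
  exact Finset.sum_congr rfl fun i _ => Finset.sum_congr rfl fun j _ => by ring

/-- The norm of a covector is the length of the vector which represents it. -/
lemma exists_gradient (g : ContMetric n M) (x : M) (α : TangentSpace (𝓡 n) x →L[ℝ] ℝ) :
    ∃ w : TangentSpace (𝓡 n) x, (∀ v, α v = g.inner x w v) ∧ gradNorm g x α = metricLen g x w := by
  set a : Fin n → ℝ := fun i => α (frame x i)
  set b : Fin n → ℝ := (comps g x)⁻¹ *ᵥ a
  have hu : IsUnit (comps g x).det :=
    (Matrix.isUnit_iff_isUnit_det _).1 (comps_posDef g x).isUnit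
  have hb : comps g x *ᵥ b = a := by
    simp only [b]
    rw [Matrix.mulVec_mulVec, Matrix.mul_nonsing_inv _ hu, Matrix.one_mulVec]
  have key : ∀ v, α v = g.inner x (∑ i, b i • frame x i) v := by
    intro v
    obtain ⟨c, rfl⟩ : ∃ c : Fin n → ℝ, v = ∑ i, c i • frame x i :=
      ⟨fun i => (show Eu n from v) i, (sum_smul_frame x v).symm⟩
    rw [g.symm, inner_sum_smul]
    change _ = c ⬝ᵥ comps g x *ᵥ b
    rw [hb]
    simp [dotProduct, a]
  refine ⟨_, key, ?_⟩
  rw [gradNorm_eq_sqrt_dotProduct, metricLen, inner_sum_smul]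
  change √(a ⬝ᵥ b) = √(b ⬝ᵥ comps g x *ᵥ b)
  rw [hb, dotProduct_comm]

lemma abs_apply_le_gradNorm_mul (g : ContMetric n M) (x : M) (α : TangentSpace (𝓡 n) x →L[ℝ] ℝ)
    (v : TangentSpace (𝓡 n) x) : |α v| ≤ gradNorm g x α * metricLen g x v := by
  obtain ⟨w, hw, hw'⟩ := exists_gradient g x α
  rw [hw, hw']
  exact abs_inner_le_metricLen_mul g x w v

/-- `gradNorm` is the dual norm of `metricLen`. -/
lemma ofReal_gradNorm_le (g : ContMetric n M) (x : M) (α : TangentSpace (𝓡 n) x →L[ℝ] ℝ)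
    {K : ℝ≥0∞} (h : ∀ v, ENNReal.ofReal |α v| ≤ K * ENNReal.ofReal (metricLen g x v)) :
    ENNReal.ofReal (gradNorm g x α) ≤ K := by
  obtain ⟨w, hw, hw'⟩ := exists_gradient g x α
  have h1 := h w
  rw [hw, ← metricLen_sq, ← hw', abs_of_nonneg (by positivity), sq,
    ENNReal.ofReal_mul (gradNorm_nonneg _ _ _)] at h1
  by_cases h0 : ENNReal.ofReal (gradNorm g x α) = 0
  · simp [h0]
  · exact (ENNReal.mul_le_mul_iff_left h0 ENNReal.ofReal_ne_top).1 h1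

lemma gradNorm_le (g : ContMetric n M) (x : M) (α : TangentSpace (𝓡 n) x →L[ℝ] ℝ)
    {K : ℝ} (hK : 0 ≤ K) (h : ∀ v, |α v| ≤ K * metricLen g x v) : gradNorm g x α ≤ K := by
  rw [← ENNReal.ofReal_le_ofReal_iff hK]
  refine ofReal_gradNorm_le g x α fun v => ?_
  rw [← ENNReal.ofReal_mul hK]
  exact ENNReal.ofReal_le_ofReal (h v)

lemma gradNorm_add_le (g : ContMetric n M) (x : M) (α β : TangentSpace (𝓡 n) x →L[ℝ] ℝ) :
    gradNorm g x (α + β) ≤ gradNorm g x α + gradNorm g x β := by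
  refine gradNorm_le g x _ (add_nonneg (gradNorm_nonneg _ _ _) (gradNorm_nonneg _ _ _)) fun v => ?_
  rw [add_mul]
  exact (abs_add_le _ _).trans
    (add_le_add (abs_apply_le_gradNorm_mul _ _ _ _) (abs_apply_le_gradNorm_mul _ _ _ _))

lemma gradNorm_smul (g : ContMetric n M) (x : M) (c : ℝ) (α : TangentSpace (𝓡 n) x →L[ℝ] ℝ) :
    gradNorm g x (c • α) = |c| * gradNorm g x α := by
  unfold gradNorm
  rw [← Real.sqrt_sq_eq_abs, ← Real.sqrt_mul (sq_nonneg c), Finset.mul_sum]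
  congr 1
  refine Finset.sum_congr rfl fun i _ => ?_
  rw [Finset.mul_sum]
  exact Finset.sum_congr rfl fun j _ => by simp; ring

lemma gradNorm_zero (g : ContMetric n M) (x : M) : gradNorm g x 0 = 0 := by simp [gradNorm]

lemma gradNorm_sum_le {ι : Type*} (s : Finset ι) (g : ContMetric n M) (x : M)
    (α : ι → TangentSpace (𝓡 n) x →L[ℝ] ℝ) :
    gradNorm g x (∑ i ∈ s, α i) ≤ ∑ i ∈ s, gradNorm g x (α i) := by
  classical
  induction s using Finset.induction_on with
  | empty => simp [gradNorm_zero]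
  | insert i s hi ih =>
    rw [Finset.sum_insert hi, Finset.sum_insert hi]
    exact (gradNorm_add_le g x _ _).trans (add_le_add le_rfl ih)

/-- The density `(det g / det g₀)^{1/2}` of `dV_g` with respect to `dV_{g₀}`. -/
noncomputable def densityRatio (g₀ g : ContMetric n M) (x : M) : ℝ :=
  √((comps g x).det / (comps g₀ x).det)

end Metric

/-! ### Coordinate frames and continuity of the pointwise scalars -/

section ChartFrame

variable {n : ℕ} {M : Type*} [TopologicalSpace M] [ChartedSpace (Eu n) M] [IsManifold (𝓡 n) ∞ M]

/-- The coordinate vector fields `∂_a` of the chart `e`, at the point with coordinates `y`. -/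
noncomputable def chartFrame (e : OpenPartialHomeomorph M (Eu n)) (y : Eu n) (a : Fin n) :
    TangentSpace (𝓡 n) (e.symm y) :=
  chartVec e y (EuclideanSpace.single a (1 : ℝ))

/-- The components `g(∂_a, ∂_b)` of the metric in the chart `e`. -/
noncomputable def chartGram (g : ContMetric n M) (e : OpenPartialHomeomorph M (Eu n)) (y : Eu n) :
    Matrix (Fin n) (Fin n) ℝ :=
  gram g (e.symm y) (chartFrame e y)

lemma chartVec_eq_sum (e : OpenPartialHomeomorph M (Eu n)) (y v : Eu n) :
    chartVec e y v = ∑ a, v a • chartFrame e y a := by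
  have h : v = ∑ a, v a • EuclideanSpace.single a (1 : ℝ) := by
    have := (EuclideanSpace.basisFun (Fin n) ℝ).sum_repr v
    simpa using this.symm
  unfold chartFrame chartVec
  conv_lhs => rw [h]
  erw [map_sum]
  refine Finset.sum_congr rfl fun a _ => ?_
  erw [map_smul]

lemma inner_chartVec (g : ContMetric n M) (e : OpenPartialHomeomorph M (Eu n)) (y v w : Eu n) :
    g.inner (e.symm y) (chartVec e y v) (chartVec e y w) = v ⬝ᵥ chartGram g e y *ᵥ w := by
  rw [chartVec_eq_sum, chartVec_eq_sum, inner_sum_smul]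
  rfl

variable {e : OpenPartialHomeomorph M (Eu n)}

lemma chartVec_injective (he : e ∈ atlas (Eu n) M) {y : Eu n} (hy : y ∈ e.target) :
    Function.Injective (chartVec e y) :=
  ((mdifferentiable_of_mem_atlas (I := 𝓡 n) he).symm.mfderiv hy).injective

lemma chartVec_surjective (he : e ∈ atlas (Eu n) M) {y : Eu n} (hy : y ∈ e.target) :
    Function.Surjective (chartVec e y) :=
  ((mdifferentiable_of_mem_atlas (I := 𝓡 n) he).symm.mfderiv hy).surjective

lemma linearIndependent_chartFrame (he : e ∈ atlas (Eu n) M) {y : Eu n} (hy : y ∈ e.target) :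
    LinearIndependent ℝ (chartFrame e y) := by
  rw [Fintype.linearIndependent_iff]
  intro c hc
  have h := chartVec_eq_sum e y (WithLp.toLp 2 c)
  simp only [hc] at h
  have h0 : chartVec e y (WithLp.toLp 2 c) = chartVec e y 0 := by
    rw [h]
    exact ((mfderiv 𝓘(ℝ, Eu n) (𝓡 n) e.symm y).map_zero).symm
  have := chartVec_injective he hy h0
  intro i
  exact congrFun (congrArg WithLp.ofLp this) i

lemma chartGram_posDef (g : ContMetric n M) (he : e ∈ atlas (Eu n) M) {y : Eu n}
    (hy : y ∈ e.target) : (chartGram g e y).PosDef :=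
  gram_posDef g _ (linearIndependent_chartFrame he hy)

/-- The coordinate vectors of a chart and the preferred basis differ by an invertible matrix. -/
lemma exists_chartFrame_eq_sum (he : e ∈ atlas (Eu n) M) {y : Eu n} (hy : y ∈ e.target) :
    ∃ B : Matrix (Fin n) (Fin n) ℝ, IsUnit B ∧
      chartFrame e y = fun a => ∑ b, B a b • frame (e.symm y) b := by
  set B : Matrix (Fin n) (Fin n) ℝ := fun a b => (show Eu n from chartFrame e y a) b
  have hB : chartFrame e y = fun a => ∑ b, B a b • frame (e.symm y) b :=
    funext fun a => (sum_smul_frame _ _).symm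
  refine ⟨B, ?_, hB⟩
  rw [← Matrix.linearIndependent_rows_iff_isUnit, Fintype.linearIndependent_iff]
  intro c hc
  have hli := linearIndependent_chartFrame he hy
  rw [Fintype.linearIndependent_iff] at hli
  refine hli c ?_
  rw [hB]
  simp only [Finset.smul_sum, smul_smul]
  rw [Finset.sum_comm]
  refine Finset.sum_eq_zero fun b _ => ?_
  rw [← Finset.sum_smul]
  have := congrFun hc b
  simp only [Finset.sum_apply, Pi.smul_apply, smul_eq_mul, Pi.zero_apply, Matrix.row] at this
  rw [this, zero_smul]

lemma metricNorm_symm (g₀ g : ContMetric n M) (he : e ∈ atlas (Eu n) M) {y : Eu n}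
    (hy : y ∈ e.target) :
    metricNorm g₀ g (e.symm y) = tensorNorm (chartGram g₀ e y)⁻¹ (chartGram g e y) := by
  obtain ⟨B, hB, h⟩ := exists_chartFrame_eq_sum he hy
  rw [chartGram, chartGram, h, gram_sum_smul, gram_sum_smul, tensorNorm_inv_conj hB]
  rfl

lemma invMetricDiffNorm_symm (g₀ g : ContMetric n M) (he : e ∈ atlas (Eu n) M) {y : Eu n}
    (hy : y ∈ e.target) :
    invMetricDiffNorm g₀ g (e.symm y) =
      tensorNorm (chartGram g₀ e y) ((chartGram g e y)⁻¹ - (chartGram g₀ e y)⁻¹) := by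
  obtain ⟨B, hB, h⟩ := exists_chartFrame_eq_sum he hy
  rw [chartGram, chartGram, h, gram_sum_smul, gram_sum_smul, tensorNorm_inv_sub_inv_conj hB]
  rfl

lemma densityRatio_symm (g₀ g : ContMetric n M) (he : e ∈ atlas (Eu n) M) {y : Eu n}
    (hy : y ∈ e.target) :
    densityRatio g₀ g (e.symm y) = √((chartGram g e y).det / (chartGram g₀ e y).det) := by
  obtain ⟨B, hB, h⟩ := exists_chartFrame_eq_sum he hy
  have hB' : B.det ≠ 0 := ((Matrix.isUnit_iff_isUnit_det _).1 hB).ne_zero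
  have h0 : (comps g₀ (e.symm y)).det ≠ 0 := (comps_posDef g₀ _).det_pos.ne'
  rw [chartGram, chartGram, h, gram_sum_smul, gram_sum_smul, densityRatio]
  change √((comps g (e.symm y)).det / _) =
    √((B * comps g (e.symm y) * Bᵀ).det / (B * comps g₀ (e.symm y) * Bᵀ).det)
  simp only [Matrix.det_mul, Matrix.det_transpose]
  congr 1
  field_simp

lemma gradNorm_symm (g : ContMetric n M) (he : e ∈ atlas (Eu n) M) {y : Eu n}
    (hy : y ∈ e.target) (α : TangentSpace (𝓡 n) (e.symm y) →L[ℝ] ℝ) :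
    gradNorm g (e.symm y) α = √((fun a => α (chartFrame e y a)) ⬝ᵥ
      (chartGram g e y)⁻¹ *ᵥ fun a => α (chartFrame e y a)) := by
  obtain ⟨B, hB, h⟩ := exists_chartFrame_eq_sum he hy
  have hα : (fun a => α (chartFrame e y a)) = B *ᵥ fun a => α (frame (e.symm y) a) := by
    rw [h]
    funext a
    simp [Matrix.mulVec, dotProduct]
  rw [hα, chartGram, h, gram_sum_smul, gradNorm_eq_sqrt_dotProduct]
  exact congrArg _ (dotProduct_inv_conj hB _).symm

lemma continuousOn_mk_chartVec (he : e ∈ atlas (Eu n) M) (v : Eu n) :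
    ContinuousOn (fun y => (⟨e.symm y, chartVec e y v⟩ : TangentBundle (𝓡 n) M)) e.target := by
  have h1 : ContMDiffOn (𝓡 n) (𝓡 n) ∞ e.symm e.target :=
    contMDiffOn_symm_of_mem_maximalAtlas (IsManifold.subset_maximalAtlas he)
  have h2 := h1.continuousOn_tangentMapWithin (by simp) e.open_target.uniqueMDiffOn
  have h3 : Continuous fun y : Eu n => (⟨y, v⟩ : TangentBundle (𝓡 n) (Eu n)) := by
    have := (tangentBundleModelSpaceHomeomorph (𝓡 n)).symm.continuous.comp
      (f := fun y : Eu n => ((y, v) : ModelProd (Eu n) (Eu n))) (by fun_prop)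
    exact this
  have h4 := h2.comp h3.continuousOn (s := e.target) (fun y hy => hy)
  refine h4.congr fun y hy => ?_
  simp only [Function.comp, tangentMapWithin]
  rw [mfderivWithin_of_isOpen e.open_target hy]
  rfl

lemma continuousOn_inner_chartVec (g : ContMetric n M) (he : e ∈ atlas (Eu n) M) (v w : Eu n) :
    ContinuousOn (fun y => g.inner (e.symm y) (chartVec e y v) (chartVec e y w)) e.target := by
  let : RiemannianBundle (fun x : M => TangentSpace (𝓡 n) x) := ⟨g.toRiemannianMetric⟩
  exact ContinuousOn.inner_bundle (continuousOn_mk_chartVec he v) (continuousOn_mk_chartVec he w)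

lemma continuous_chartGram (g : ContMetric n M) (he : e ∈ atlas (Eu n) M) :
    Continuous fun y : e.target => chartGram g e y := by
  refine continuous_matrix fun a b => ?_
  exact continuousOn_iff_continuous_domRestrict.1 (continuousOn_inner_chartVec g he _ _)

lemma continuous_chartGram_inv (g : ContMetric n M) (he : e ∈ atlas (Eu n) M) :
    Continuous fun y : e.target => (chartGram g e y)⁻¹ := by
  have h := continuous_chartGram g he
  simp only [Matrix.inv_def, Ring.inverse_eq_inv']
  exact (h.matrix_det.inv₀ fun y => (chartGram_posDef g he y.2).det_pos.ne').smul
    h.matrix_adjugate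

lemma continuous_tensorNorm {X : Type*} [TopologicalSpace X] {S W : X → Matrix (Fin n) (Fin n) ℝ}
    (hS : Continuous S) (hW : Continuous W) : Continuous fun x => tensorNorm (S x) (W x) := by
  simp only [tensorNorm_eq_sqrt_trace]
  exact (((hS.matrix_mul hW).matrix_mul hS.matrix_transpose).matrix_mul
    hW.matrix_transpose).matrix_trace.sqrt

/-- A function on `M` is continuous if it is so in all charts. -/
lemma continuous_of_comp_chart_symm {f : M → ℝ}
    (h : ∀ e ∈ atlas (Eu n) M, ContinuousOn (fun y => f (e.symm y)) e.target) :
    Continuous f := by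
  rw [continuous_iff_continuousAt]
  intro x
  set e := chartAt (Eu n) x
  have hx : x ∈ e.source := mem_chart_source _ x
  have h1 := (h e (chart_mem_atlas _ x)).comp e.continuousOn (fun z hz => e.map_source hz)
  have h2 : ContinuousOn f e.source := h1.congr fun z hz => by simp [e.left_inv hz]
  exact h2.continuousAt (e.open_source.mem_nhds hx)

lemma continuous_metricNorm (g₀ g : ContMetric n M) : Continuous (metricNorm g₀ g) := by
  refine continuous_of_comp_chart_symm (n := n) fun e he => ?_
  refine ContinuousOn.congr ?_ fun y hy => metricNorm_symm g₀ g he hy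
  rw [continuousOn_iff_continuous_domRestrict]
  exact continuous_tensorNorm (continuous_chartGram_inv g₀ he) (continuous_chartGram g he)

lemma continuous_invMetricDiffNorm (g₀ g : ContMetric n M) :
    Continuous (invMetricDiffNorm g₀ g) := by
  refine continuous_of_comp_chart_symm (n := n) fun e he => ?_
  refine ContinuousOn.congr ?_ fun y hy => invMetricDiffNorm_symm g₀ g he hy
  rw [continuousOn_iff_continuous_domRestrict]
  exact continuous_tensorNorm (continuous_chartGram g₀ he)
    ((continuous_chartGram_inv g he).sub (continuous_chartGram_inv g₀ he))

lemma continuous_densityRatio (g₀ g : ContMetric n M) : Continuous (densityRatio g₀ g) := by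
  refine continuous_of_comp_chart_symm (n := n) fun e he => ?_
  refine ContinuousOn.congr ?_ fun y hy => densityRatio_symm g₀ g he hy
  rw [continuousOn_iff_continuous_domRestrict]
  exact ((continuous_chartGram g he).matrix_det.div (continuous_chartGram g₀ he).matrix_det
    fun y => (chartGram_posDef g₀ he y.2).det_pos.ne').sqrt

lemma volDensity_eq (g : ContMetric n M) (e : OpenPartialHomeomorph M (Eu n)) (y : Eu n) :
    volDensity g e y = √(chartGram g e y).det := rfl

lemma continuousOn_volDensity (g : ContMetric n M) (he : e ∈ atlas (Eu n) M) :
    ContinuousOn (volDensity g e) e.target := by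
  rw [continuousOn_iff_continuous_domRestrict]
  exact (continuous_chartGram g he).matrix_det.sqrt

lemma volDensity_pos (g : ContMetric n M) (he : e ∈ atlas (Eu n) M) {y : Eu n}
    (hy : y ∈ e.target) : 0 < volDensity g e y :=
  Real.sqrt_pos.2 (chartGram_posDef g he hy).det_pos

lemma volDensity_eq_mul (g₀ g : ContMetric n M) (he : e ∈ atlas (Eu n) M) {y : Eu n}
    (hy : y ∈ e.target) :
    volDensity g e y = volDensity g₀ e y * densityRatio g₀ g (e.symm y) := by
  rw [densityRatio_symm g₀ g he hy, volDensity_eq, volDensity_eq, ← Real.sqrt_mul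
    (chartGram_posDef g₀ he hy).det_pos.le, mul_div_cancel₀ _ (chartGram_posDef g₀ he hy).det_pos.ne']

end ChartFrame

/-! ### The Riemannian volume measure -/

section Volume

variable {n : ℕ} {M : Type*} [TopologicalSpace M] [ChartedSpace (Eu n) M] [IsManifold (𝓡 n) ∞ M]
  [MeasurableSpace M] [BorelSpace M] {e e' : OpenPartialHomeomorph M (Eu n)}

lemma aemeasurable_symm (e : OpenPartialHomeomorph M (Eu n)) :
    AEMeasurable e.symm (volume.restrict e.target) :=
  e.continuousOn_symm.aemeasurable e.open_target.measurableSet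

lemma measurableSet_target_inter_preimage (e : OpenPartialHomeomorph M (Eu n)) {A : Set M}
    (hA : MeasurableSet A) : MeasurableSet (e.target ∩ e.symm ⁻¹' A) := by
  have h1 : Measurable fun y : e.target => e.symm y :=
    (continuousOn_iff_continuous_domRestrict.1 e.continuousOn_symm).measurable
  have h2 := (MeasurableEmbedding.subtype_coe e.open_target.measurableSet).measurableSet_image.2
    (h1 hA)
  convert h2 using 1
  ext y
  simp [and_comm]

lemma aemeasurable_symm_withDensity (e : OpenPartialHomeomorph M (Eu n)) (w : Eu n → ℝ≥0∞) :
    AEMeasurable e.symm ((volume.restrict e.target).withDensity w) :=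
  (aemeasurable_symm e).mono_ac (withDensity_absolutelyContinuous _ _)

/-- A function on `M` which is measurable in the coordinates of a chart is measurable for the
volume of the chart. -/
lemma aemeasurable_chartVolume (g : ContMetric n M) {f : M → ℝ≥0∞}
    (hf : AEMeasurable (fun y => f (e.symm y)) (volume.restrict e.target)) :
    AEMeasurable f (chartVolume g e) := by
  set μ := (volume.restrict e.target).withDensity (fun y => ENNReal.ofReal (volDensity g e y))
  have hμ : ∀ᵐ y ∂μ, y ∈ e.target :=
    (withDensity_absolutelyContinuous _ _).ae_le (ae_restrict_mem e.open_target.measurableSet)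
  have hs := aemeasurable_symm_withDensity e (fun y => ENNReal.ofReal (volDensity g e y))
  have hsrc : ∀ᵐ x ∂(chartVolume g e), x ∈ e.source := by
    refine (ae_map_iff hs e.open_source.measurableSet).2 ?_
    exact hμ.mono fun y hy => e.map_target hy
  have he : AEMeasurable e (chartVolume g e) := by
    have h1 : AEMeasurable e ((chartVolume g e).restrict e.source) :=
      e.continuousOn.aemeasurable e.open_source.measurableSet
    rwa [Measure.restrict_eq_self_of_ae_mem hsrc] at h1
  have hmap : Measure.map e (chartVolume g e) = μ := by
    rw [chartVolume, AEMeasurable.map_map_of_aemeasurable he hs]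
    conv_rhs => rw [← Measure.map_id (μ := μ)]
    exact Measure.map_congr (hμ.mono fun y hy => e.right_inv hy)
  have hf' : AEMeasurable (fun y => f (e.symm y)) (Measure.map e (chartVolume g e)) := by
    rw [hmap]
    exact hf.mono_ac (withDensity_absolutelyContinuous _ _)
  refine (hf'.comp_aemeasurable he).congr (hsrc.mono fun x hx => ?_)
  simp [e.left_inv hx]

lemma lintegral_chartVolume (g : ContMetric n M) (he : e ∈ atlas (Eu n) M) {f : M → ℝ≥0∞}
    (hf : AEMeasurable (fun y => f (e.symm y)) (volume.restrict e.target)) :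
    ∫⁻ x, f x ∂(chartVolume g e) =
      ∫⁻ y in e.target, ENNReal.ofReal (volDensity g e y) * f (e.symm y) := by
  have hw : AEMeasurable (fun y => ENNReal.ofReal (volDensity g e y))
      (volume.restrict e.target) :=
    ((continuousOn_volDensity g he).aemeasurable e.open_target.measurableSet).ennreal_ofReal
  rw [chartVolume, lintegral_map' (aemeasurable_chartVolume g hf)
    (aemeasurable_symm_withDensity e _), lintegral_withDensity_eq_lintegral_mul₀ hw hf]
  rfl

lemma chartVolume_apply (g : ContMetric n M) (he : e ∈ atlas (Eu n) M) {A : Set M}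
    (hA : MeasurableSet A) :
    chartVolume g e A = ∫⁻ y in e.target ∩ e.symm ⁻¹' A, ENNReal.ofReal (volDensity g e y) := by
  have hm : MeasurableSet (e.target ∩ e.symm ⁻¹' A) :=
    measurableSet_target_inter_preimage e hA
  have h1 : AEMeasurable (fun y => A.indicator (1 : M → ℝ≥0∞) (e.symm y))
      (volume.restrict e.target) :=
    (measurable_one.indicator hA).comp_aemeasurable (aemeasurable_symm e)
  rw [← lintegral_indicator_one hA, lintegral_chartVolume g he h1,
    ← lintegral_indicator e.open_target.measurableSet, ← lintegral_indicator hm]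
  congr 1
  ext y
  by_cases hy : y ∈ e.target <;> by_cases hy' : e.symm y ∈ A <;> simp [hy, hy']

lemma gram_congr (g : ContMetric n M) {x x' : M} (h : x = x') (v : Fin n → Eu n) :
    gram g x (fun a => (v a : Eu n)) = gram g x' (fun a => (v a : Eu n)) := by
  subst h; rfl

/-- The transformation law of the volume density under a change of charts. -/
lemma volDensity_change_chart (g : ContMetric n M) (he : e ∈ atlas (Eu n) M)
    (he' : e' ∈ atlas (Eu n) M) {y : Eu n} (hy : y ∈ e'.target) (hy' : e'.symm y ∈ e.source) :
    DifferentiableAt ℝ (fun z => e (e'.symm z)) y ∧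
    volDensity g e' y =
      |(fderiv ℝ (fun z => e (e'.symm z)) y).det| * volDensity g e (e (e'.symm y)) := by
  have hd := mdifferentiable_of_mem_atlas (I := 𝓡 n) he
  have hd' := mdifferentiable_of_mem_atlas (I := 𝓡 n) he'
  have hT : MDifferentiableAt (𝓡 n) (𝓡 n) (e ∘ e'.symm) y :=
    (hd.mdifferentiableAt hy').comp y (hd'.mdifferentiableAt_symm hy)
  have hTd : DifferentiableAt ℝ (fun z => e (e'.symm z)) y :=
    mdifferentiableAt_iff_differentiableAt.1 hT
  refine ⟨hTd, ?_⟩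
  set T : Eu n → Eu n := fun z => e (e'.symm z) with hTdef
  have hTy : T y ∈ e.target := e.map_source hy'
  have hxy : e.symm (T y) = e'.symm y := e.left_inv hy'
  have hev : (e'.symm : Eu n → M) =ᶠ[𝓝 y] e.symm ∘ T := by
    have : e'.symm ⁻¹' e.source ∈ 𝓝 y :=
      (e'.continuousAt_symm hy).preimage_mem_nhds (e.open_source.mem_nhds hy')
    filter_upwards [this] with z hz
    exact (e.left_inv hz).symm
  have hchain : ∀ v : Eu n, (show Eu n from chartVec e' y v) =
      (show Eu n from chartVec e (T y) (fderiv ℝ T y v)) := by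
    intro v
    have h1 := hev.mfderiv_eq (I := 𝓡 n) (I' := 𝓡 n)
    have h2 := mfderiv_comp (I := 𝓡 n) (I' := 𝓡 n) (I'' := 𝓡 n) y
      (hd.mdifferentiableAt_symm hTy) hT
    rw [chartVec, chartVec]
    erw [h1, h2]
    rw [← mfderiv_eq_fderiv]
    rfl
  set J : Matrix (Fin n) (Fin n) ℝ :=
    fun a b => (fderiv ℝ T y (EuclideanSpace.single a (1 : ℝ))) b with hJ
  have hgram : chartGram g e' y = J * chartGram g e (T y) * Jᵀ := by
    rw [chartGram, chartGram, ← gram_sum_smul]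
    have h3 : (fun a => ∑ b, J a b • chartFrame e (T y) b) =
        fun a => chartVec e (T y) (fderiv ℝ T y (EuclideanSpace.single a (1 : ℝ))) :=
      funext fun a => (chartVec_eq_sum _ _ _).symm
    rw [h3]
    have h4 := gram_congr g hxy.symm
      (fun a => show Eu n from chartVec e' y (EuclideanSpace.single a (1 : ℝ)))
    refine h4.trans ?_
    congr 1
    funext a
    exact hchain _
  have hdet : (fderiv ℝ T y).det = J.det := by
    rw [ContinuousLinearMap.det, ← LinearMap.det_toMatrix
      (EuclideanSpace.basisFun (Fin n) ℝ).toBasis, ← Matrix.det_transpose]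
    congr 1
  rw [volDensity_eq, volDensity_eq, hgram, hdet, Matrix.det_mul, Matrix.det_mul,
    Matrix.det_transpose, ← Real.sqrt_sq_eq_abs, ← Real.sqrt_mul (sq_nonneg _)]
  congr 1
  ring

lemma chartVolume_le_of_subset_source (g : ContMetric n M) (he : e ∈ atlas (Eu n) M)
    (he' : e' ∈ atlas (Eu n) M) {A : Set M} (hA : MeasurableSet A) (hAe : A ⊆ e.source) :
    chartVolume g e' A ≤ chartVolume g e A := by
  rw [chartVolume_apply g he hA, chartVolume_apply g he' hA]
  set S' := e'.target ∩ e'.symm ⁻¹' A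
  have hm : MeasurableSet S' :=
    measurableSet_target_inter_preimage e' hA
  have hinj : Set.InjOn (fun z => e (e'.symm z)) S' := fun y hy z hz h =>
    e'.symm.injOn hy.1 hz.1 (e.injOn (hAe hy.2) (hAe hz.2) h)
  have hsub : (fun z => e (e'.symm z)) '' S' ⊆ e.target ∩ e.symm ⁻¹' A := by
    rintro _ ⟨y, hy, rfl⟩
    refine ⟨e.map_source (hAe hy.2), ?_⟩
    simpa [e.left_inv (hAe hy.2)] using hy.2
  have key := lintegral_image_eq_lintegral_abs_det_fderiv_mul volume hm
    (fun y hy => ((volDensity_change_chart g he he' hy.1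
      (hAe hy.2)).1.hasFDerivAt.hasFDerivWithinAt)) hinj
    (fun y => ENNReal.ofReal (volDensity g e y))
  calc _ = _ := by
        rw [key]
        refine setLIntegral_congr_fun hm fun y hy => ?_
        rw [← ENNReal.ofReal_mul (abs_nonneg _)]
        exact congrArg _ (volDensity_change_chart g he he' hy.1 (hAe hy.2)).2
    _ ≤ _ := lintegral_mono_set hsub

lemma chartVolume_le_vol (g : ContMetric n M) (he : e ∈ atlas (Eu n) M) :
    chartVolume g e ≤ vol g :=
  le_iSup (fun e : atlas (Eu n) M => chartVolume g e.1) ⟨e, he⟩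

lemma vol_le_chartVolume (g : ContMetric n M) (he : e ∈ atlas (Eu n) M) {A : Set M}
    (hA : MeasurableSet A) (hAe : A ⊆ e.source) : vol g A ≤ chartVolume g e A := by
  set ν : Measure M := chartVolume g e + (((⊤ : ℝ≥0∞) • Measure.count).restrict e.sourceᶜ)
  -- `ν` dominates all the chart volumes, as it is infinite off the domain of `e`.
  have hν : vol g ≤ ν := by
    refine iSup_le fun e' => Measure.le_iff.2 fun B hB => ?_
    by_cases hBe : B ⊆ e.source
    · exact (chartVolume_le_of_subset_source g he e'.2 hB hBe).trans (by simp [ν])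
    · obtain ⟨x, hx, hxe⟩ := Set.not_subset.1 hBe
      have : ν B = ⊤ := by
        have h0 : Measure.count (B ∩ e.sourceᶜ) ≠ 0 := by
          rw [Ne, Measure.count_eq_zero_iff]
          exact Set.Nonempty.ne_empty ⟨x, hx, hxe⟩
        simp [ν, Measure.restrict_apply hB, ENNReal.top_mul h0]
      rw [this]
      exact le_top
  calc vol g A ≤ ν A := hν A
    _ = chartVolume g e A := by
      have : A ∩ e.sourceᶜ = ∅ := by
        rw [← Set.sdiff_eq, Set.sdiff_eq_empty]; exact hAe
      simp [ν, Measure.restrict_apply hA, this]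

/-- The Riemannian volume restricts to the chart volume on the domain of every chart. -/
lemma vol_restrict_source (g : ContMetric n M) (he : e ∈ atlas (Eu n) M) :
    (vol g).restrict e.source = chartVolume g e := by
  ext A hA
  have hAs := hA.inter e.open_source.measurableSet
  rw [Measure.restrict_apply hA]
  have h1 : chartVolume g e A = chartVolume g e (A ∩ e.source) := by
    rw [chartVolume_apply g he hA, chartVolume_apply g he hAs]
    congr 2
    ext y
    simp only [Set.mem_inter_iff, Set.mem_preimage]
    exact ⟨fun h => ⟨h.1, h.2, e.map_target h.1⟩, fun h => ⟨h.1, h.2.1⟩⟩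
  rw [h1]
  exact le_antisymm (vol_le_chartVolume g he hAs Set.inter_subset_right)
    (chartVolume_le_vol g he _)

/-- Integration in a chart of a function vanishing off the domain of the chart. -/
lemma lintegral_vol_eq_of_support_subset (g : ContMetric n M) (he : e ∈ atlas (Eu n) M)
    {f : M → ℝ≥0∞} (hf : AEMeasurable (fun y => f (e.symm y)) (volume.restrict e.target))
    (hs : ∀ x ∉ e.source, f x = 0) :
    ∫⁻ x, f x ∂(vol g) =
      ∫⁻ y in e.target, ENNReal.ofReal (volDensity g e y) * f (e.symm y) := by
  rw [← lintegral_chartVolume g he hf, ← vol_restrict_source g he,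
    ← lintegral_indicator e.open_source.measurableSet]
  congr 1
  ext x
  by_cases hx : x ∈ e.source <;> simp [hx, hs]

lemma isFiniteMeasure_vol [CompactSpace M] (g : ContMetric n M) : IsFiniteMeasure (vol g) := by
  refine ⟨isCompact_univ.measure_lt_top_of_nhdsWithin fun x _ => ?_⟩
  set e := chartAt (Eu n) x
  have he : e ∈ atlas (Eu n) M := chart_mem_atlas _ x
  have hx : x ∈ e.source := mem_chart_source _ x
  have hxt := e.map_source hx
  obtain ⟨U, hU, hxU, hUt, hUint⟩ : ∃ U : Set (Eu n), IsOpen U ∧ e x ∈ U ∧ U ⊆ e.target ∧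
      ∫⁻ y in U, ENNReal.ofReal (volDensity g e y) < ⊤ := by
    have hc := (continuousOn_volDensity g he).continuousAt (e.open_target.mem_nhds hxt)
    have h1 : ∀ᶠ y in 𝓝 (e x), volDensity g e y < volDensity g e (e x) + 1 :=
      hc.eventually_lt continuousAt_const (by linarith)
    have h2 := Filter.inter_mem (Filter.inter_mem h1 (e.open_target.mem_nhds hxt))
      (Metric.ball_mem_nhds (e x) one_pos)
    obtain ⟨U, hUs, hU, hxU⟩ := mem_nhds_iff.1 h2
    refine ⟨U, hU, hxU, fun y hy => (hUs hy).1.2, ?_⟩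
    refine (setLIntegral_mono' hU.measurableSet fun y hy =>
      ENNReal.ofReal_le_ofReal (le_of_lt (hUs hy).1.1)).trans_lt ?_
    rw [setLIntegral_const]
    refine ENNReal.mul_lt_top ENNReal.ofReal_lt_top ?_
    exact (measure_mono fun y hy => (hUs hy).2).trans_lt measure_ball_lt_top
  have hVo : IsOpen (e.source ∩ e ⁻¹' U) := e.isOpen_inter_preimage hU
  refine ⟨e.source ∩ e ⁻¹' U, mem_nhdsWithin_of_mem_nhds (hVo.mem_nhds ⟨hx, hxU⟩), ?_⟩
  refine (vol_le_chartVolume g he hVo.measurableSet Set.inter_subset_left).trans_lt ?_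
  rw [chartVolume_apply g he hVo.measurableSet]
  refine (lintegral_mono_set fun y hy => ?_).trans_lt hUint
  simpa [e.right_inv hy.1] using hy.2.2

/-- `dV_g` is at most the density ratio times `dV_{g₀}`. The two measures are equal, but this
inequality is what upper bounds of energies need. -/
lemma vol_le_withDensity (g₀ g : ContMetric n M) :
    vol g ≤ (vol g₀).withDensity fun x => ENNReal.ofReal (densityRatio g₀ g x) := by
  refine iSup_le fun e => Measure.le_iff.2 fun A hA => ?_
  have he := e.2
  set e := e.1
  have hAs := hA.inter e.open_source.measurableSet
  have hr : Measurable fun x => ENNReal.ofReal (densityRatio g₀ g x) :=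
    (continuous_densityRatio g₀ g).measurable.ennreal_ofReal
  have hm : MeasurableSet (e.target ∩ e.symm ⁻¹' A) :=
    measurableSet_target_inter_preimage e hA
  rw [withDensity_apply _ hA]
  calc chartVolume g e A
      = ∫⁻ x in A, ENNReal.ofReal (densityRatio g₀ g x) ∂(chartVolume g₀ e) := by
        rw [← lintegral_indicator hA, lintegral_chartVolume g₀ he
          ((hr.indicator hA).comp_aemeasurable (aemeasurable_symm e)), chartVolume_apply g he hA,
          ← lintegral_indicator e.open_target.measurableSet, ← lintegral_indicator hm]
        congr 1
        ext y
        by_cases hy : y ∈ e.target <;> by_cases hy' : e.symm y ∈ A <;> simp [hy, hy']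
        rw [← ENNReal.ofReal_mul (volDensity_pos g₀ he hy).le, volDensity_eq_mul g₀ g he hy]
    _ ≤ _ := lintegral_mono' (Measure.restrict_mono le_rfl (chartVolume_le_vol g₀ he)) le_rfl

end Volume

/-! ### Energies with respect to converging metrics -/

section Comparison

lemma exists_near_one_bound (n : ℕ) (p : ℝ) {δ : ℝ} (hδ : 0 < δ) :
    ∃ η : ℝ, 0 < η ∧ η < 1 ∧ (1 + η) ^ (p / 2) * √(((1 - η)⁻¹) ^ n) ≤ 1 + δ := by
  have hc : ContinuousAt (fun η : ℝ => (1 + η) ^ (p / 2) * √(((1 - η)⁻¹) ^ n)) 0 := by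
    refine ContinuousAt.mul (ContinuousAt.rpow_const (by fun_prop) (Or.inl (by norm_num))) ?_
    refine ContinuousAt.sqrt (ContinuousAt.pow (ContinuousAt.inv₀ (by fun_prop) (by norm_num)) _)
  have h1 : ∀ᶠ η in 𝓝 (0 : ℝ), (1 + η) ^ (p / 2) * √(((1 - η)⁻¹) ^ n) < 1 + δ :=
    hc.eventually_lt continuousAt_const (by simp [hδ])
  have h2 : ∀ᶠ η in 𝓝 (0 : ℝ), η < 1 := eventually_lt_nhds one_pos
  have h3 := (h1.and h2).filter_mono (nhdsWithin_le_nhds (s := Set.Ioi 0))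
  obtain ⟨η, ⟨h, h'⟩, h0⟩ := (h3.and self_mem_nhdsWithin).exists
  exact ⟨η, h0, h', h.le⟩

/-- The energy density and the volume density in terms of the eigenvalues `μ` of `g` with respect
to `g₀`. Where `g` is close to `g₀` the factor is close to `1`. Elsewhere the smallest eigenvalue
enters with the exponent `-p / 2` from the energy and `1 / 2` from the volume, which leaves
`(p - 1) / 2`, and the `n - 1` others are bounded by `|g|_{g₀}`. -/
lemma exists_eigenvalue_bound {n : ℕ} (hn : 0 < n) {p : ℝ} (hp : 1 < p) {δ : ℝ} (hδ : 0 < δ) :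
    ∃ K : ℝ, 0 ≤ K ∧ ∀ (μ a : Fin n → ℝ), (∀ i, 0 < μ i) →
      (√(∑ i, (μ i)⁻¹ * a i ^ 2)) ^ p * √(∏ i, μ i) ≤
        (√(∑ i, a i ^ 2)) ^ p * (1 + δ + K *
          ((√(∑ i, ((μ i)⁻¹ - 1) ^ 2)) ^ ((p - 1) / 2) *
            (√(∑ i, μ i ^ 2)) ^ (((n : ℝ) - 1) / 2))) := by
  obtain ⟨η, hη, hη1, hηδ⟩ := exists_near_one_bound n p hδ
  refine ⟨(1 + η⁻¹) ^ ((p - 1) / 2), by positivity, fun μ a hμ => ?_⟩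
  have : Nonempty (Fin n) := ⟨⟨0, hn⟩⟩
  obtain ⟨k, hk⟩ := Finite.exists_min μ
  set τ := √(∑ i, ((μ i)⁻¹ - 1) ^ 2)
  set N := √(∑ i, μ i ^ 2)
  have hτ0 : 0 ≤ τ := Real.sqrt_nonneg _
  have hN0 : 0 ≤ N := Real.sqrt_nonneg _
  have hτ : ∀ i, |(μ i)⁻¹ - 1| ≤ τ := fun i => by
    rw [← Real.sqrt_sq_eq_abs]
    exact Real.sqrt_le_sqrt (Finset.single_le_sum (f := fun i => ((μ i)⁻¹ - 1) ^ 2)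
      (fun i _ => sq_nonneg _) (Finset.mem_univ i))
  have hN : ∀ i, μ i ≤ N := fun i => by
    rw [← Real.sqrt_sq (hμ i).le]
    exact Real.sqrt_le_sqrt (Finset.single_le_sum (f := fun i => (μ i) ^ 2)
      (fun i _ => sq_nonneg _) (Finset.mem_univ i))
  have hm : 0 < (μ k)⁻¹ := inv_pos.2 (hμ k)
  have hmτ : (μ k)⁻¹ ≤ 1 + τ := by linarith [le_abs_self ((μ k)⁻¹ - 1), hτ k]
  have hG : √(∑ i, (μ i)⁻¹ * a i ^ 2) ≤ √(μ k)⁻¹ * √(∑ i, a i ^ 2) := by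
    rw [← Real.sqrt_mul hm.le, Finset.mul_sum]
    refine Real.sqrt_le_sqrt (Finset.sum_le_sum fun i _ => ?_)
    exact mul_le_mul_of_nonneg_right (inv_anti₀ (hμ k) (hk i)) (sq_nonneg _)
  have hsq : ∀ t : ℝ, 0 ≤ t → √t ^ p = t ^ (p / 2) := fun t ht => by
    rw [Real.sqrt_eq_rpow, ← Real.rpow_mul ht]; congr 1; ring
  have hB : (√(∑ i, (μ i)⁻¹ * a i ^ 2)) ^ p ≤ ((μ k)⁻¹) ^ (p / 2) * (√(∑ i, a i ^ 2)) ^ p := by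
    refine (Real.rpow_le_rpow (Real.sqrt_nonneg _) hG (by linarith)).trans ?_
    rw [Real.mul_rpow (Real.sqrt_nonneg _) (Real.sqrt_nonneg _), hsq _ hm.le]
  have key : ((μ k)⁻¹) ^ (p / 2) * √(∏ i, μ i) ≤ 1 + δ + (1 + η⁻¹) ^ ((p - 1) / 2) *
      (τ ^ ((p - 1) / 2) * N ^ (((n : ℝ) - 1) / 2)) := by
    rcases le_or_gt τ η with hτη | hτη
    -- near `g₀` all eigenvalues are close to one
    · have h1 : ((μ k)⁻¹) ^ (p / 2) ≤ (1 + η) ^ (p / 2) :=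
        Real.rpow_le_rpow hm.le (by linarith) (by linarith)
      have h2 : ∏ i, μ i ≤ ((1 - η)⁻¹) ^ n := by
        have h3 : ∀ i ∈ Finset.univ, μ i ≤ (1 - η)⁻¹ := fun i _ => by
          rw [le_inv_comm₀ (hμ i) (by linarith)]
          linarith [neg_abs_le ((μ i)⁻¹ - 1), hτ i]
        simpa using Finset.prod_le_prod (fun i _ => (hμ i).le) h3
      have h4 := mul_le_mul h1 (Real.sqrt_le_sqrt h2) (Real.sqrt_nonneg _) (by positivity)
      have h5 : 0 ≤ (1 + η⁻¹) ^ ((p - 1) / 2) * (τ ^ ((p - 1) / 2) * N ^ (((n : ℝ) - 1) / 2)) := by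
        positivity
      linarith
    -- away from `g₀` the smallest eigenvalue is kept apart, and `1 + τ ≤ (1 + η⁻¹) τ`
    · have h1 : ∏ i, μ i ≤ μ k * N ^ (n - 1) := by
        rw [← Finset.mul_prod_erase _ _ (Finset.mem_univ k)]
        refine mul_le_mul_of_nonneg_left ?_ (hμ k).le
        have := Finset.prod_le_prod (s := Finset.univ.erase k) (fun i _ => (hμ i).le)
          (fun i _ => hN i)
        simpa [Finset.card_erase_of_mem] using this
      have h2 : √(∏ i, μ i) ≤ (μ k) ^ (1 / 2 : ℝ) * N ^ (((n : ℝ) - 1) / 2) := by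
        refine (Real.sqrt_le_sqrt h1).trans_eq ?_
        rw [Real.sqrt_mul (hμ k).le, Real.sqrt_eq_rpow, Real.sqrt_eq_rpow, ← Real.rpow_natCast,
          ← Real.rpow_mul hN0, Nat.cast_sub hn]
        congr 2
        push_cast
        ring
      have h3 : ((μ k)⁻¹) ^ (p / 2) * (μ k) ^ (1 / 2 : ℝ) = ((μ k)⁻¹) ^ ((p - 1) / 2) := by
        rw [Real.inv_rpow (hμ k).le, Real.inv_rpow (hμ k).le, ← Real.rpow_neg (hμ k).le,
          ← Real.rpow_neg (hμ k).le, ← Real.rpow_add (hμ k)]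
        congr 1
        ring
      have h4 : ((μ k)⁻¹) ^ ((p - 1) / 2) ≤ (1 + η⁻¹) ^ ((p - 1) / 2) * τ ^ ((p - 1) / 2) := by
        rw [← Real.mul_rpow (by positivity) hτ0]
        refine Real.rpow_le_rpow hm.le (hmτ.trans ?_) (by linarith)
        have : 1 ≤ η⁻¹ * τ := by
          rw [inv_mul_eq_div, le_div_iff₀ hη]; linarith
        linarith
      calc ((μ k)⁻¹) ^ (p / 2) * √(∏ i, μ i)
          ≤ ((μ k)⁻¹) ^ (p / 2) * ((μ k) ^ (1 / 2 : ℝ) * N ^ (((n : ℝ) - 1) / 2)) := by gcongr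
        _ = ((μ k)⁻¹) ^ ((p - 1) / 2) * N ^ (((n : ℝ) - 1) / 2) := by rw [← mul_assoc, h3]
        _ ≤ (1 + η⁻¹) ^ ((p - 1) / 2) * τ ^ ((p - 1) / 2) * N ^ (((n : ℝ) - 1) / 2) := by gcongr
        _ ≤ _ := by rw [mul_assoc]; linarith
  calc _ ≤ ((μ k)⁻¹) ^ (p / 2) * (√(∑ i, a i ^ 2)) ^ p * √(∏ i, μ i) := by gcongr
    _ = (√(∑ i, a i ^ 2)) ^ p * (((μ k)⁻¹) ^ (p / 2) * √(∏ i, μ i)) := by ring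
    _ ≤ _ := by gcongr

variable {n : ℕ} {M : Type*} [TopologicalSpace M] [ChartedSpace (Eu n) M] [IsManifold (𝓡 n) ∞ M]

lemma metricNorm_nonneg (g₀ g : ContMetric n M) (x : M) : 0 ≤ metricNorm g₀ g x :=
  Real.sqrt_nonneg _

lemma invMetricDiffNorm_nonneg (g₀ g : ContMetric n M) (x : M) : 0 ≤ invMetricDiffNorm g₀ g x :=
  Real.sqrt_nonneg _

/-- Comparison of energy densities. The last term is written as a product to which the Hölder
inequality with exponents `n` and `n / (n - 1)` applies. -/
lemma exists_energy_density_le (hn : 0 < n) {p : ℝ} (hp : 1 < p) {δ : ℝ} (hδ : 0 < δ) :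
    ∃ K : ℝ, ∀ (g₀ g : ContMetric n M) (x : M) (α : TangentSpace (𝓡 n) x →L[ℝ] ℝ),
      ENNReal.ofReal (gradNorm g x α) ^ p * ENNReal.ofReal (densityRatio g₀ g x) ≤
        ENNReal.ofReal (gradNorm g₀ x α) ^ p * (ENNReal.ofReal (1 + δ) + ENNReal.ofReal K *
          ((ENNReal.ofReal (invMetricDiffNorm g₀ g x) ^ ((n : ℝ) * (p - 1) / 2)) ^ (1 / (n : ℝ)) *
            (ENNReal.ofReal (metricNorm g₀ g x) ^ ((n : ℝ) / 2)) ^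
              (((n : ℝ) - 1) / (n : ℝ)))) := by
  obtain ⟨K, hK, h⟩ := exists_eigenvalue_bound hn hp hδ
  refine ⟨K, fun g₀ g x α => ?_⟩
  obtain ⟨A, μ, hμ, hN, hτ, hdet, ha₀, ha⟩ :=
    exists_relative_eigenvalues (comps_posDef g₀ x) (comps_posDef g x)
  have hn' : (n : ℝ) ≠ 0 := by positivity
  have hn1 : (1 : ℝ) ≤ n := by exact_mod_cast hn
  have e1 : (n : ℝ) * (p - 1) / 2 * (1 / (n : ℝ)) = (p - 1) / 2 := by field_simp
  have e2 : (n : ℝ) / 2 * (((n : ℝ) - 1) / (n : ℝ)) = ((n : ℝ) - 1) / 2 := by field_simp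
  rw [← ENNReal.rpow_mul, ← ENNReal.rpow_mul, e1, e2,
    ENNReal.ofReal_rpow_of_nonneg (gradNorm_nonneg _ _ _) (by linarith),
    ENNReal.ofReal_rpow_of_nonneg (gradNorm_nonneg _ _ _) (by linarith),
    ENNReal.ofReal_rpow_of_nonneg (invMetricDiffNorm_nonneg _ _ _) (by linarith),
    ENNReal.ofReal_rpow_of_nonneg (metricNorm_nonneg _ _ _) (by linarith),
    ← ENNReal.ofReal_mul (Real.rpow_nonneg (gradNorm_nonneg _ _ _) _),
    ← ENNReal.ofReal_mul (Real.rpow_nonneg (invMetricDiffNorm_nonneg _ _ _) _),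
    ← ENNReal.ofReal_mul hK,
    ← ENNReal.ofReal_add (by linarith) (mul_nonneg hK (mul_nonneg
      (Real.rpow_nonneg (invMetricDiffNorm_nonneg _ _ _) _)
      (Real.rpow_nonneg (metricNorm_nonneg _ _ _) _))),
    ← ENNReal.ofReal_mul (Real.rpow_nonneg (gradNorm_nonneg _ _ _) _)]
  refine ENNReal.ofReal_le_ofReal ?_
  rw [gradNorm_eq_sqrt_dotProduct, gradNorm_eq_sqrt_dotProduct, ha, ha₀, densityRatio, hdet,
    invMetricDiffNorm, metricNorm, hN, hτ]
  exact h μ _ hμ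

variable [MeasurableSpace M] [BorelSpace M]

/-- For a covector field which is bounded with respect to `g₀` the upper limit of the energies
for `g_j` is at most the energy for `g₀`. -/
lemma eventually_energy_le (hn : 0 < n) {p : ℝ} (hp : 1 < p) (g₀ : ContMetric n M)
    (g : ℕ → ContMetric n M)
    (hinv : Tendsto (fun j => ∫⁻ x, ENNReal.ofReal (invMetricDiffNorm g₀ (g j) x) ^
      ((n : ℝ) * (p - 1) / 2) ∂(vol g₀)) atTop (𝓝 0))
    (hbd : ∃ C : ℝ≥0, ∀ j, ∫⁻ x, ENNReal.ofReal (metricNorm g₀ (g j) x) ^ ((n : ℝ) / 2)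
      ∂(vol g₀) ≤ (C : ℝ≥0∞))
    (α : ∀ x : M, TangentSpace (𝓡 n) x →L[ℝ] ℝ) (hα : Measurable fun x => gradNorm g₀ x (α x))
    {L : ℝ} (hL : ∀ x, gradNorm g₀ x (α x) ≤ L) {b : ℝ≥0∞}
    (hb : ∫⁻ x, ENNReal.ofReal (gradNorm g₀ x (α x)) ^ p ∂(vol g₀) < b) :
    ∀ᶠ j in atTop, ∫⁻ x, ENNReal.ofReal (gradNorm (g j) x (α x)) ^ p ∂(vol (g j)) ≤ b := by
  obtain ⟨C, hC⟩ := hbd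
  set E := ∫⁻ x, ENNReal.ofReal (gradNorm g₀ x (α x)) ^ p ∂(vol g₀)
  have hE : E ≠ ⊤ := hb.ne_top
  have hn' : (n : ℝ) ≠ 0 := by positivity
  have hn1 : (1 : ℝ) ≤ n := by exact_mod_cast hn
  have hn0 : (0 : ℝ) < n := by positivity
  obtain ⟨δ, hδ, hδb⟩ : ∃ δ : ℝ, 0 < δ ∧ ENNReal.ofReal (1 + δ) * E < b := by
    have h1 : Tendsto (fun δ : ℝ => ENNReal.ofReal (1 + δ) * E) (𝓝 0) (𝓝 (ENNReal.ofReal 1 * E)) := by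
      refine ENNReal.Tendsto.mul_const ?_ (Or.inr hE)
      refine ENNReal.tendsto_ofReal ?_
      have : Continuous fun δ : ℝ => 1 + δ := by fun_prop
      simpa using this.tendsto 0
    have h2 := h1.eventually_lt_const (by simpa using hb)
    obtain ⟨δ, h, h0⟩ := ((h2.filter_mono (nhdsWithin_le_nhds (s := Set.Ioi 0))).and
      self_mem_nhdsWithin).exists
    exact ⟨δ, h0, h⟩
  obtain ⟨K, hK⟩ := exists_energy_density_le (M := M) hn hp hδ
  have hbound : ∀ j, ∫⁻ x, ENNReal.ofReal (gradNorm (g j) x (α x)) ^ p ∂(vol (g j)) ≤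
      ENNReal.ofReal (1 + δ) * E + ENNReal.ofReal L ^ p * ENNReal.ofReal K *
        ((∫⁻ x, ENNReal.ofReal (invMetricDiffNorm g₀ (g j) x) ^
          ((n : ℝ) * (p - 1) / 2) ∂(vol g₀)) ^ (1 / (n : ℝ)) *
            (C : ℝ≥0∞) ^ (((n : ℝ) - 1) / (n : ℝ))) := by
    intro j
    have hm1 : Measurable fun x => ENNReal.ofReal (gradNorm g₀ x (α x)) ^ p :=
      hα.ennreal_ofReal.pow_const _
    have hm2 : Measurable fun x => ENNReal.ofReal (invMetricDiffNorm g₀ (g j) x) ^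
        ((n : ℝ) * (p - 1) / 2) :=
      (continuous_invMetricDiffNorm _ _).measurable.ennreal_ofReal.pow_const _
    have hm3 : Measurable fun x => ENNReal.ofReal (metricNorm g₀ (g j) x) ^ ((n : ℝ) / 2) :=
      (continuous_metricNorm _ _).measurable.ennreal_ofReal.pow_const _
    calc _ ≤ ∫⁻ x, ENNReal.ofReal (gradNorm (g j) x (α x)) ^ p
          ∂((vol g₀).withDensity fun x => ENNReal.ofReal (densityRatio g₀ (g j) x)) :=
          lintegral_mono' (vol_le_withDensity g₀ (g j)) le_rfl
      _ ≤ ∫⁻ x, ENNReal.ofReal (densityRatio g₀ (g j) x) *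
          ENNReal.ofReal (gradNorm (g j) x (α x)) ^ p ∂(vol g₀) :=
          lintegral_withDensity_le_lintegral_mul _
            (continuous_densityRatio g₀ (g j)).measurable.ennreal_ofReal _
      _ ≤ ∫⁻ x, (ENNReal.ofReal (1 + δ) * ENNReal.ofReal (gradNorm g₀ x (α x)) ^ p +
          ENNReal.ofReal L ^ p * ENNReal.ofReal K *
          ((ENNReal.ofReal (invMetricDiffNorm g₀ (g j) x) ^ ((n : ℝ) * (p - 1) / 2)) ^
              (1 / (n : ℝ)) *
            (ENNReal.ofReal (metricNorm g₀ (g j) x) ^ ((n : ℝ) / 2)) ^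
              (((n : ℝ) - 1) / (n : ℝ)))) ∂(vol g₀) := by
          refine lintegral_mono fun x => ?_
          rw [mul_comm]
          refine (hK g₀ (g j) x (α x)).trans ?_
          rw [mul_add, mul_comm _ (ENNReal.ofReal (1 + δ)), mul_assoc (_ ^ p) (ENNReal.ofReal K)]
          gcongr
          · exact hL x
      _ ≤ _ := by
          rw [lintegral_add_left (hm1.const_mul _), lintegral_const_mul _ hm1, lintegral_const_mul]
          · gcongr
            refine (ENNReal.lintegral_mul_norm_pow_le hm2.aemeasurable hm3.aemeasurable
              (by positivity) (div_nonneg (by linarith) hn0.le) (by field_simp; ring)).trans ?_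
            gcongr
            · exact hC j
          · exact (hm2.pow_const _).mul (hm3.pow_const _)
  have hlim : Tendsto (fun j => ENNReal.ofReal (1 + δ) * E +
      ENNReal.ofReal L ^ p * ENNReal.ofReal K *
        ((∫⁻ x, ENNReal.ofReal (invMetricDiffNorm g₀ (g j) x) ^
          ((n : ℝ) * (p - 1) / 2) ∂(vol g₀)) ^ (1 / (n : ℝ)) *
            (C : ℝ≥0∞) ^ (((n : ℝ) - 1) / (n : ℝ)))) atTop
      (𝓝 (ENNReal.ofReal (1 + δ) * E)) := by
    have h1 := (ENNReal.continuous_rpow_const (y := 1 / (n : ℝ))).tendsto 0 |>.comp hinv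
    rw [ENNReal.zero_rpow_of_pos (by positivity)] at h1
    have hC' : (C : ℝ≥0∞) ^ (((n : ℝ) - 1) / (n : ℝ)) ≠ ⊤ :=
      ENNReal.rpow_ne_top_of_nonneg (div_nonneg (by linarith) hn0.le) ENNReal.coe_ne_top
    have h2 := ENNReal.Tendsto.mul_const h1 (b := (C : ℝ≥0∞) ^ (((n : ℝ) - 1) / (n : ℝ)))
      (Or.inr hC')
    have hLK : ENNReal.ofReal L ^ p * ENNReal.ofReal K ≠ ⊤ :=
      ENNReal.mul_ne_top (ENNReal.rpow_ne_top_of_nonneg (by linarith) ENNReal.ofReal_ne_top)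
        ENNReal.ofReal_ne_top
    have h3 := ENNReal.Tendsto.const_mul h2 (Or.inr hLK)
    simpa using h3.const_add (ENNReal.ofReal (1 + δ) * E)
  filter_upwards [hlim.eventually_lt_const hδb] with j hj
  exact (hbound j).trans hj.le

end Comparison

/-! ### Differentials of smooth functions -/

section Differential

variable {n : ℕ} {M : Type*} [TopologicalSpace M] [ChartedSpace (Eu n) M] [IsManifold (𝓡 n) ∞ M]
  {e : OpenPartialHomeomorph M (Eu n)}

/-- The classical differential of a real function, as a field of covectors. -/
noncomputable def differential (h : M → ℝ) (x : M) : TangentSpace (𝓡 n) x →L[ℝ] ℝ :=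
  mfderiv (𝓡 n) 𝓘(ℝ, ℝ) h x

lemma differential_congr {h h' : M → ℝ} {x : M} (hh : h =ᶠ[𝓝 x] h') :
    differential (n := n) h x = differential h' x := hh.mfderiv_eq

lemma differential_chartVec {h : M → ℝ} (he : e ∈ atlas (Eu n) M) {y : Eu n} (hy : y ∈ e.target)
    (hh : MDifferentiableAt (𝓡 n) 𝓘(ℝ, ℝ) h (e.symm y)) (v : Eu n) :
    differential h (e.symm y) (chartVec e y v) = fderiv ℝ (fun z => h (e.symm z)) y v := by
  have hd := mdifferentiable_of_mem_atlas (I := 𝓡 n) he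
  have h2 := mfderiv_comp (I := 𝓡 n) (I' := 𝓡 n) (I'' := 𝓘(ℝ, ℝ)) y hh
    (hd.mdifferentiableAt_symm hy)
  have h3 : mfderiv (𝓡 n) 𝓘(ℝ, ℝ) (h ∘ e.symm) y = fderiv ℝ (fun z => h (e.symm z)) y :=
    mfderiv_eq_fderiv
  rw [← h3, h2]
  rfl

lemma contDiffOn_comp_symm {h : M → ℝ} (hh : ContMDiff (𝓡 n) 𝓘(ℝ, ℝ) ∞ h)
    (he : e ∈ atlas (Eu n) M) : ContDiffOn ℝ ∞ (fun z => h (e.symm z)) e.target := by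
  have h1 : ContMDiffOn (𝓡 n) (𝓡 n) ∞ e.symm e.target :=
    contMDiffOn_symm_of_mem_maximalAtlas (IsManifold.subset_maximalAtlas he)
  exact contMDiffOn_iff_contDiffOn.1 (hh.comp_contMDiffOn h1)

lemma mdifferentiableAt_of_contMDiff {h : M → ℝ} (hh : ContMDiff (𝓡 n) 𝓘(ℝ, ℝ) ∞ h) (x : M) :
    MDifferentiableAt (𝓡 n) 𝓘(ℝ, ℝ) h x :=
  hh.mdifferentiable (by simp) x

lemma continuousOn_differential_chartVec {h : M → ℝ} (hh : ContMDiff (𝓡 n) 𝓘(ℝ, ℝ) ∞ h)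
    (he : e ∈ atlas (Eu n) M) (v : Eu n) :
    ContinuousOn (fun y => differential h (e.symm y) (chartVec e y v)) e.target := by
  have h1 := (contDiffOn_comp_symm hh he).continuousOn_fderiv_of_isOpen e.open_target (by simp)
  refine (h1.clm_apply (continuousOn_const (c := v))).congr fun y hy => ?_
  exact differential_chartVec he hy (mdifferentiableAt_of_contMDiff hh _) v

/-- The differential of a smooth function is its weak differential. -/
lemma isWeakDifferential_differential {h : M → ℝ} (hh : ContMDiff (𝓡 n) 𝓘(ℝ, ℝ) ∞ h) :
    IsWeakDifferential (n := n) h (differential h) := by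
  intro e he
  have hc := contDiffOn_comp_symm hh he
  refine ⟨hc.continuousOn.locallyIntegrableOn e.open_target.measurableSet, fun v =>
    ⟨(continuousOn_differential_chartVec hh he v).locallyIntegrableOn e.open_target.measurableSet,
      fun η hη hηc hηt => ?_⟩⟩
  have hηd : Differentiable ℝ η := hη.differentiable (by simp)
  have hη' : Continuous (fderiv ℝ η) := hη.continuous_fderiv (by simp)
  set H : Eu n → ℝ := fun z => h (e.symm z)
  have hcont : ∀ u : Eu n → ℝ, ContinuousOn u e.target → ∀ ξ : Eu n → ℝ, Continuous ξ →
      tsupport ξ ⊆ tsupport η → Integrable (fun y => u y * ξ y) := by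
    intro u hu ξ hξ hξη
    have hξc : HasCompactSupport ξ := hηc.of_isClosed_subset (isClosed_tsupport _) hξη
    refine Continuous.integrable_of_hasCompactSupport ?_ hξc.mul_left
    refine continuous_of_tsupport fun y hy => ?_
    have hyξ : y ∈ tsupport ξ := closure_mono (Function.support_mul_subset_right _ _) hy
    exact (hu.continuousAt (e.open_target.mem_nhds (hηt (hξη hyξ)))).mul hξ.continuousAt
  have hdf : ContinuousOn (fun y => fderiv ℝ H y v) e.target :=
    (hc.continuousOn_fderiv_of_isOpen e.open_target (by simp)).clm_apply continuousOn_const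
  have hηv : Continuous fun y => fderiv ℝ η y v := hη'.clm_apply continuous_const
  have hηvs : tsupport (fun y => fderiv ℝ η y v) ⊆ tsupport η :=
    (closure_mono fun y hy => by
      contrapose! hy
      simp only [Function.mem_support, not_not] at hy ⊢
      rw [hy]; rfl).trans (tsupport_fderiv_subset ℝ)
  have key := integral_mul_fderiv_eq_neg_fderiv_mul_of_integrable (μ := volume) (f := H) (g := η)
    (v := v) (hcont _ hdf η hη.continuous subset_rfl) (hcont _ hc.continuousOn _ hηv hηvs)
    (hcont _ hc.continuousOn η hη.continuous subset_rfl)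
    (fun y hy => (hc.differentiableOn (by simp)).differentiableAt
      (e.open_target.mem_nhds (hηt hy)))
    (fun y _ => hηd y)
  rw [key]
  congr 1
  refine integral_congr_ae (Filter.Eventually.of_forall fun y => ?_)
  by_cases hy : y ∈ e.target
  · simp only
    rw [differential_chartVec he hy (mdifferentiableAt_of_contMDiff hh _)]
  · have : η y = 0 := by
      by_contra h0
      exact hy (hηt (subset_tsupport _ h0))
    simp [this]

lemma continuousOn_gradNorm_comp_symm (g : ContMetric n M) (he : e ∈ atlas (Eu n) M)
    {α : ∀ x : M, TangentSpace (𝓡 n) x →L[ℝ] ℝ}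
    (hα : ∀ v, ContinuousOn (fun y => α (e.symm y) (chartVec e y v)) e.target) :
    ContinuousOn (fun y => gradNorm g (e.symm y) (α (e.symm y))) e.target := by
  refine ContinuousOn.congr ?_ fun y hy => gradNorm_symm g he hy _
  rw [continuousOn_iff_continuous_domRestrict]
  have h1 : Continuous fun y : e.target => fun a => α (e.symm y) (chartFrame e (y : Eu n) a) :=
    continuous_pi fun a => continuousOn_iff_continuous_domRestrict.1 (hα _)
  exact (h1.dotProduct ((continuous_chartGram_inv g he).matrix_mulVec h1)).sqrt

lemma continuous_gradNorm_differential (g : ContMetric n M) {h : M → ℝ}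
    (hh : ContMDiff (𝓡 n) 𝓘(ℝ, ℝ) ∞ h) :
    Continuous fun x => gradNorm g x (differential h x) :=
  continuous_of_comp_chart_symm (n := n) fun _ he =>
    continuousOn_gradNorm_comp_symm g he (continuousOn_differential_chartVec hh he)

lemma differential_mul {a b : M → ℝ} {x : M} (ha : MDifferentiableAt (𝓡 n) 𝓘(ℝ, ℝ) a x)
    (hb : MDifferentiableAt (𝓡 n) 𝓘(ℝ, ℝ) b x) :
    differential (n := n) (fun x => a x * b x) x =
      a x • differential b x + b x • differential a x := by
  have := (ha.hasMFDerivAt.mul hb.hasMFDerivAt).mfderiv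
  exact this

lemma differential_add {a b : M → ℝ} {x : M} (ha : MDifferentiableAt (𝓡 n) 𝓘(ℝ, ℝ) a x)
    (hb : MDifferentiableAt (𝓡 n) 𝓘(ℝ, ℝ) b x) :
    differential (n := n) (fun x => a x + b x) x = differential a x + differential b x :=
  (ha.hasMFDerivAt.add hb.hasMFDerivAt).mfderiv

lemma differential_const (c : ℝ) (x : M) : differential (n := n) (fun _ : M => c) x = 0 :=
  mfderiv_const

lemma mdifferentiableAt_and_differential_sum {ι : Type*} (s : Finset ι) {a : ι → M → ℝ} {x : M}
    (ha : ∀ i ∈ s, MDifferentiableAt (𝓡 n) 𝓘(ℝ, ℝ) (a i) x) :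
    MDifferentiableAt (𝓡 n) 𝓘(ℝ, ℝ) (fun x => ∑ i ∈ s, a i x) x ∧
      differential (n := n) (fun x => ∑ i ∈ s, a i x) x = ∑ i ∈ s, differential (a i) x := by
  classical
  induction s using Finset.induction_on with
  | empty => simpa using ⟨mdifferentiableAt_const, differential_const (n := n) 0 x⟩
  | insert i s hi ih =>
    obtain ⟨h1, h2⟩ := ih fun j hj => ha j (Finset.mem_insert_of_mem hj)
    have h0 := ha i (Finset.mem_insert_self i s)
    simp only [Finset.sum_insert hi]
    rw [← h2, ← differential_add h0 h1]
    exact ⟨h0.add h1, rfl⟩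

lemma differential_const_mul {a : M → ℝ} {x : M} (c : ℝ)
    (ha : MDifferentiableAt (𝓡 n) 𝓘(ℝ, ℝ) a x) :
    differential (n := n) (fun x => c * a x) x = c • differential a x := by
  rw [differential_mul mdifferentiableAt_const ha, differential_const, smul_zero, add_zero]

end Differential

/-! ### Oscillation of a metric in a chart, and mollification in `ℝⁿ` -/

section MetricComparison

variable {n : ℕ} {M : Type*} [TopologicalSpace M] [ChartedSpace (Eu n) M] [IsManifold (𝓡 n) ∞ M]
  {e : OpenPartialHomeomorph M (Eu n)}

lemma chartVec_smul (e : OpenPartialHomeomorph M (Eu n)) (y : Eu n) (c : ℝ) (w : Eu n) :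
    chartVec e y (c • w) = c • chartVec e y w :=
  (mfderiv 𝓘(ℝ, Eu n) (𝓡 n) e.symm y).map_smul c w

lemma metricLen_smul (g : ContMetric n M) (x : M) (c : ℝ) (v : TangentSpace (𝓡 n) x) :
    metricLen g x (c • v) = |c| * metricLen g x v := by
  unfold metricLen
  rw [← Real.sqrt_sq_eq_abs, ← Real.sqrt_mul (sq_nonneg c)]
  congr 1
  simp only [map_smul, _root_.smul_apply, smul_eq_mul]
  ring

lemma metricLen_pos (g : ContMetric n M) (he : e ∈ atlas (Eu n) M) {y : Eu n} (hy : y ∈ e.target)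
    {w : Eu n} (hw : w ≠ 0) : 0 < metricLen g (e.symm y) (chartVec e y w) := by
  refine Real.sqrt_pos.2 (g.pos _ _ fun h => hw (chartVec_injective he hy ?_))
  rw [h]
  exact ((mfderiv 𝓘(ℝ, Eu n) (𝓡 n) e.symm y).map_zero).symm

lemma continuousOn_metricLen_chartVec (g : ContMetric n M) (he : e ∈ atlas (Eu n) M) :
    ContinuousOn (fun q : Eu n × Eu n => metricLen g (e.symm q.1) (chartVec e q.1 q.2))
      (e.target ×ˢ Set.univ) := by
  unfold metricLen
  simp only [inner_chartVec]
  refine ContinuousOn.sqrt ?_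
  simp only [dotProduct, Matrix.mulVec]
  refine continuousOn_finsetSum _ fun i _ => ContinuousOn.mul (by fun_prop)
    (continuousOn_finsetSum _ fun j _ => ContinuousOn.mul ?_ (by fun_prop))
  exact (continuousOn_inner_chartVec g he _ _).comp (by fun_prop) fun q hq => hq.1

/-- At nearby points of a chart the metric takes nearly the same values on vectors with the same
components. -/
lemma exists_metricLen_comparison (g : ContMetric n M) (he : e ∈ atlas (Eu n) M) {K : Set (Eu n)}
    (hK : IsCompact K) (hKt : K ⊆ e.target) {δ : ℝ} (hδ : 0 < δ) :
    ∃ ε > 0, ∀ y ∈ K, ∀ y', dist y' y ≤ ε → y' ∈ e.target ∧ ∀ w,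
      metricLen g (e.symm y') (chartVec e y' w) ≤
        (1 + δ) * metricLen g (e.symm y) (chartVec e y w) := by
  obtain ⟨r, hr, hrt⟩ := hK.exists_cthickening_subset_open e.open_target hKt
  have hK' : IsCompact (Metric.cthickening r K) := hK.cthickening
  -- by homogeneity it suffices to compare on the unit sphere, where the metric is bounded below
  obtain ⟨Φ, hΦdef⟩ : ∃ Φ : Eu n × Eu n → ℝ,
      ∀ q, Φ q = metricLen g (e.symm q.1) (chartVec e q.1 q.2) := ⟨_, fun _ => rfl⟩
  have hKS : IsCompact (Metric.cthickening r K ×ˢ Metric.sphere (0 : Eu n) 1) :=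
    hK'.prod (isCompact_sphere _ _)
  have hΦ : ContinuousOn Φ (Metric.cthickening r K ×ˢ Metric.sphere (0 : Eu n) 1) :=
    ((continuousOn_metricLen_chartVec g he).mono
      (Set.prod_mono hrt (Set.subset_univ _))).congr fun q _ => hΦdef q
  obtain ⟨c, hc, hcΦ⟩ := hKS.exists_forall_le' (a := 0) hΦ fun q hq => by
    rw [hΦdef]
    refine metricLen_pos g he (hrt hq.1) fun h0 => ?_
    have := hq.2
    rw [h0] at this
    simp at this
  obtain ⟨ε, hε, hεΦ⟩ := Metric.uniformContinuousOn_iff.1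
    (hKS.uniformContinuousOn_of_continuous hΦ) (δ * c) (by positivity)
  refine ⟨min (ε / 2) r, by positivity, fun y hy y' hyy' => ?_⟩
  have hyK : y ∈ Metric.cthickening r K := Metric.self_subset_cthickening _ hy
  have hyK' : y' ∈ Metric.cthickening r K :=
    Metric.mem_cthickening_of_dist_le y' y r K hy (hyy'.trans (min_le_right _ _))
  refine ⟨hrt hyK', fun w => ?_⟩
  rcases eq_or_ne w 0 with rfl | hw
  · have h0 : ∀ z : Eu n, chartVec e z 0 = 0 := fun z =>
      (mfderiv 𝓘(ℝ, Eu n) (𝓡 n) e.symm z).map_zero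
    simp [h0, metricLen]
  · have hw' : 0 < ‖w‖ := norm_pos_iff.2 hw
    set u : Eu n := ‖w‖⁻¹ • w
    have hu : u ∈ Metric.sphere (0 : Eu n) 1 := by
      simp [u, norm_smul, hw'.ne']
    have hwu : w = ‖w‖ • u := by simp [u, smul_smul, hw'.ne']
    have hd : dist (Φ (y', u)) (Φ (y, u)) < δ * c := by
      refine hεΦ (y', u) ⟨hyK', hu⟩ (y, u) ⟨hyK, hu⟩ ?_
      rw [Prod.dist_eq]
      simp only [dist_self]
      rw [max_eq_left dist_nonneg]
      exact (hyy'.trans (min_le_left _ _)).trans_lt (by linarith)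
    rw [Real.dist_eq, abs_lt] at hd
    have h1 : δ * c ≤ δ * Φ (y, u) := mul_le_mul_of_nonneg_left (hcΦ (y, u) ⟨hyK, hu⟩) hδ.le
    have h3 : ∀ z : Eu n, metricLen g (e.symm z) (chartVec e z w) = ‖w‖ * Φ (z, u) := fun z => by
      rw [hΦdef]
      conv_lhs => rw [hwu]
      rw [chartVec_smul, metricLen_smul, abs_of_pos hw']
    rw [h3, h3, mul_left_comm]
    exact mul_le_mul_of_nonneg_left (by linarith) hw'.le

end MetricComparison

section Mollifier

variable {n : ℕ}

open scoped Convolution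

/-- A smooth bump function on the ball of radius `ε` about the origin of `ℝⁿ`. For `ε ≤ 0` the
value is irrelevant. -/
noncomputable def mollBump (n : ℕ) (ε : ℝ) : ContDiffBump (0 : Eu n) :=
  if h : 0 < ε then ⟨ε / 2, ε, half_pos h, half_lt_self h⟩ else ⟨1, 2, one_pos, one_lt_two⟩

/-- The standard mollifier: a smooth probability density supported in the ball of radius `ε`. -/
noncomputable def mollKernel (n : ℕ) (ε : ℝ) : Eu n → ℝ := (mollBump n ε).normed volume

lemma mollBump_rOut {ε : ℝ} (hε : 0 < ε) : (mollBump n ε).rOut = ε := by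
  simp [mollBump, hε]

lemma contDiff_mollKernel (ε : ℝ) : ContDiff ℝ ∞ (mollKernel n ε) :=
  (mollBump n ε).contDiff_normed

lemma hasCompactSupport_mollKernel (ε : ℝ) : HasCompactSupport (mollKernel n ε) :=
  (mollBump n ε).hasCompactSupport_normed

lemma mollKernel_nonneg (ε : ℝ) (y : Eu n) : 0 ≤ mollKernel n ε y :=
  (mollBump n ε).nonneg_normed y

lemma integral_mollKernel (ε : ℝ) : ∫ y, mollKernel n ε y = 1 := (mollBump n ε).integral_normed

lemma integrable_mollKernel (ε : ℝ) : Integrable (mollKernel n ε) :=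
  (contDiff_mollKernel ε).continuous.integrable_of_hasCompactSupport
    (hasCompactSupport_mollKernel ε)

lemma support_mollKernel {ε : ℝ} (hε : 0 < ε) :
    Function.support (mollKernel n ε) = Metric.ball 0 ε := by
  rw [mollKernel, ContDiffBump.support_normed_eq, mollBump_rOut hε]

lemma dist_lt_of_mollKernel_sub_ne_zero {ε : ℝ} (hε : 0 < ε) {y z : Eu n}
    (h : mollKernel n ε (y - z) ≠ 0) : dist y z < ε := by
  have : y - z ∈ Metric.ball (0 : Eu n) ε := by rw [← support_mollKernel hε]; exact h
  rwa [mem_ball_zero_iff, ← dist_eq_norm] at this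

lemma lintegral_mollKernel (ε : ℝ) : ∫⁻ y, ENNReal.ofReal (mollKernel n ε y) = 1 := by
  rw [← ofReal_integral_eq_lintegral_ofReal (integrable_mollKernel ε)
    (Filter.Eventually.of_forall (mollKernel_nonneg ε)), integral_mollKernel, ENNReal.ofReal_one]

lemma lintegral_mollKernel_sub_left (ε : ℝ) (y : Eu n) :
    ∫⁻ z, ENNReal.ofReal (mollKernel n ε (y - z)) = 1 := by
  rw [lintegral_sub_left_eq_self (fun z => ENNReal.ofReal (mollKernel n ε z)) y,
    lintegral_mollKernel]

lemma lintegral_mollKernel_sub_right (ε : ℝ) (z : Eu n) :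
    ∫⁻ y, ENNReal.ofReal (mollKernel n ε (y - z)) = 1 := by
  rw [lintegral_sub_right_eq_self (fun z => ENNReal.ofReal (mollKernel n ε z)) z,
    lintegral_mollKernel]

/-- Mollification at scale `ε`: the convolution with `mollKernel n ε`. -/
noncomputable def mollify (ε : ℝ) (u : Eu n → ℝ) : Eu n → ℝ :=
  mollKernel n ε ⋆[ContinuousLinearMap.lsmul ℝ ℝ, volume] u

lemma contDiff_mollify (ε : ℝ) {u : Eu n → ℝ} (hu : LocallyIntegrable u) :
    ContDiff ℝ ∞ (mollify ε u) :=
  (hasCompactSupport_mollKernel ε).contDiff_convolution_left _ (contDiff_mollKernel ε) hu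

lemma abs_mollify_sub_le {ε : ℝ} (hε : 0 < ε) {u : Eu n → ℝ} (hu : LocallyIntegrable u)
    {y : Eu n} {c η : ℝ} (hη : 0 ≤ η) (h : ∀ z, dist z y < ε → |u z - c| ≤ η) :
    |mollify ε u y - c| ≤ η :=
  dist_convolution_le (R := ε) hη (support_mollKernel hε).subset (mollKernel_nonneg ε)
    (integral_mollKernel ε) hu.aestronglyMeasurable fun z hz => h z hz

lemma abs_mollify_sub_mollify_le {ε : ℝ} (hε : 0 < ε) {u : Eu n → ℝ} (hu : LocallyIntegrable u)
    {y y' : Eu n} {B : ℝ} (h : ∀ t : Eu n, ‖t‖ < ε → |u (y - t) - u (y' - t)| ≤ B) :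
    |mollify ε u y - mollify ε u y'| ≤ B := by
  have hex := (hasCompactSupport_mollKernel (n := n) ε).convolutionExists_left
    (ContinuousLinearMap.lsmul ℝ ℝ) (contDiff_mollKernel ε).continuous hu
  have h1 : mollify ε u y - mollify ε u y' =
      ∫ t, mollKernel n ε t * (u (y - t) - u (y' - t)) := by
    rw [mollify, convolution_def, convolution_def, ← integral_sub (hex y) (hex y')]
    refine integral_congr_ae (Filter.Eventually.of_forall fun t => ?_)
    simp
    ring
  rw [h1, ← Real.norm_eq_abs]
  have h2 := norm_integral_le_of_norm_le (f := fun t => mollKernel n ε t * (u (y - t) - u (y' - t)))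
    ((integrable_mollKernel (n := n) ε).mul_const B) (Filter.Eventually.of_forall fun t => ?_)
  · rwa [integral_mul_const, integral_mollKernel, one_mul] at h2
  · rw [norm_mul, Real.norm_of_nonneg (mollKernel_nonneg ε t), Real.norm_eq_abs]
    by_cases ht : mollKernel n ε t = 0
    · simp [ht]
    · refine mul_le_mul_of_nonneg_left (h t ?_) (mollKernel_nonneg ε t)
      have := dist_lt_of_mollKernel_sub_ne_zero (n := n) hε (y := t) (z := 0) (by simpa using ht)
      simpa using this

lemma fderiv_mollify_apply (ε : ℝ) {u : Eu n → ℝ} (hu : LocallyIntegrable u) (y w : Eu n) :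
    fderiv ℝ (mollify ε u) y w = ∫ z, fderiv ℝ (mollKernel n ε) (y - z) w * u z := by
  have hk := contDiff_mollKernel (n := n) ε
  have h1 := (hasCompactSupport_mollKernel (n := n) ε).hasFDerivAt_convolution_left
    (ContinuousLinearMap.lsmul ℝ ℝ) (hk.of_le (by simp)) hu y
  rw [mollify, h1.fderiv, convolution_eq_swap, ContinuousLinearMap.integral_apply]
  · simp [ContinuousLinearMap.precompL]
  · have hex := ((hasCompactSupport_mollKernel (n := n) ε).fderiv ℝ).convolutionExists_left
      ((ContinuousLinearMap.lsmul ℝ ℝ).precompL (Eu n)) (hk.continuous_fderiv (by simp)) hu y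
    exact hex.integrable_swap

/-- Jensen's inequality for mollification. -/
lemma lintegral_mollKernel_mul_rpow_le {p : ℝ} (hp : 1 < p) (ε : ℝ) (y : Eu n)
    {U : Eu n → ℝ≥0∞} (hU : AEMeasurable U) :
    (∫⁻ z, ENNReal.ofReal (mollKernel n ε (y - z)) * U z) ^ p ≤
      ∫⁻ z, ENNReal.ofReal (mollKernel n ε (y - z)) * U z ^ p := by
  have hp0 : 0 < p := by linarith
  have hk : Measurable fun z => ENNReal.ofReal (mollKernel n ε (y - z)) :=
    ((contDiff_mollKernel ε).continuous.measurable.comp (measurable_const.sub measurable_id)).ennreal_ofReal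
  have hq : 0 ≤ 1 - 1 / p := by
    rw [sub_nonneg, div_le_one hp0]; exact hp.le
  have h1 := ENNReal.lintegral_mul_norm_pow_le (μ := volume)
    (f := fun z => ENNReal.ofReal (mollKernel n ε (y - z)) * U z ^ p)
    (hk.aemeasurable.mul (hU.pow_const p)) hk.aemeasurable (p := 1 / p) (q := 1 - 1 / p)
    (by positivity) hq (by ring)
  rw [lintegral_mollKernel_sub_left, ENNReal.one_rpow, mul_one] at h1
  have h2 : ∀ z, (ENNReal.ofReal (mollKernel n ε (y - z)) * U z ^ p) ^ (1 / p) *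
      ENNReal.ofReal (mollKernel n ε (y - z)) ^ (1 - 1 / p) =
        ENNReal.ofReal (mollKernel n ε (y - z)) * U z := fun z => by
    rw [ENNReal.mul_rpow_of_nonneg _ _ (by positivity), ← ENNReal.rpow_mul, mul_one_div_cancel hp0.ne',
      ENNReal.rpow_one, mul_right_comm, ← ENNReal.rpow_add_of_nonneg _ _ (by positivity) hq]
    simp
  simp only [h2] at h1
  calc _ ≤ ((∫⁻ z, ENNReal.ofReal (mollKernel n ε (y - z)) * U z ^ p) ^ (1 / p)) ^ p :=
        ENNReal.rpow_le_rpow h1 hp0.le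
    _ = _ := by rw [← ENNReal.rpow_mul, one_div_mul_cancel hp0.ne', ENNReal.rpow_one]

end Mollifier

/-! ### Mollification in a chart -/

section ChartMollifier

variable {n : ℕ} {M : Type*} [TopologicalSpace M] [ChartedSpace (Eu n) M] [IsManifold (𝓡 n) ∞ M]
  {e : OpenPartialHomeomorph M (Eu n)}

/-- A function in the coordinates of a chart, extended by zero to `ℝⁿ`. -/
noncomputable def chartPull (e : OpenPartialHomeomorph M (Eu n)) (f : M → ℝ) : Eu n → ℝ :=
  e.target.indicator fun y => f (e.symm y)

/-- The mollification of `f` at scale `ε` in the coordinates of the chart `e`. It is meaningful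
only on compact subsets of the domain of `e`, for small `ε`. -/
noncomputable def chartMollify (ε : ℝ) (e : OpenPartialHomeomorph M (Eu n)) (f : M → ℝ) (x : M) :
    ℝ :=
  mollify ε (chartPull e f) (e x)

lemma chartPull_of_mem {f : M → ℝ} {y : Eu n} (hy : y ∈ e.target) :
    chartPull e f y = f (e.symm y) := Set.indicator_of_mem hy _

lemma locallyIntegrable_chartPull [CompactSpace M] {f : M → ℝ} (hf : Continuous f) :
    LocallyIntegrable (chartPull e f) := by
  obtain ⟨C, hC⟩ := isCompact_univ.exists_bound_of_continuousOn hf.continuousOn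
  have hm : AEStronglyMeasurable (chartPull e f) :=
    (aestronglyMeasurable_indicator_iff e.open_target.measurableSet).2
      ((hf.comp_continuousOn e.continuousOn_symm).aestronglyMeasurable e.open_target.measurableSet)
  refine (locallyIntegrable_const (C : ℝ)).mono hm (Filter.Eventually.of_forall fun y => ?_)
  by_cases hy : y ∈ e.target
  · rw [chartPull_of_mem hy]
    exact (hC _ trivial).trans (le_abs_self C)
  · simp [chartPull, hy]

lemma chartMollify_symm (ε : ℝ) (f : M → ℝ) {y : Eu n} (hy : y ∈ e.target) :
    chartMollify ε e f (e.symm y) = mollify ε (chartPull e f) y := by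
  rw [chartMollify, e.right_inv hy]

lemma contMDiffOn_chartMollify [CompactSpace M] (ε : ℝ) (he : e ∈ atlas (Eu n) M) {f : M → ℝ}
    (hf : Continuous f) :
    ContMDiffOn (𝓡 n) 𝓘(ℝ, ℝ) ∞ (chartMollify ε e f) e.source := by
  have h1 : ContMDiffOn (𝓡 n) (𝓡 n) ∞ e e.source :=
    contMDiffOn_of_mem_maximalAtlas (IsManifold.subset_maximalAtlas he)
  exact (contDiff_mollify ε (locallyIntegrable_chartPull hf)).contMDiff.comp_contMDiffOn h1

lemma contMDiffAt_chartMollify [CompactSpace M] (ε : ℝ) (he : e ∈ atlas (Eu n) M) {f : M → ℝ}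
    (hf : Continuous f) {x : M} (hx : x ∈ e.source) :
    ContMDiffAt (𝓡 n) 𝓘(ℝ, ℝ) ∞ (chartMollify ε e f) x :=
  (contMDiffOn_chartMollify ε he hf).contMDiffAt (e.open_source.mem_nhds hx)

lemma differential_chartMollify_chartVec [CompactSpace M] (ε : ℝ) (he : e ∈ atlas (Eu n) M)
    {f : M → ℝ} (hf : Continuous f) {y : Eu n} (hy : y ∈ e.target) (v : Eu n) :
    differential (chartMollify ε e f) (e.symm y) (chartVec e y v) =
      fderiv ℝ (mollify ε (chartPull e f)) y v := by
  rw [differential_chartVec he hy ((contMDiffAt_chartMollify ε he hf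
    (e.map_target hy)).mdifferentiableAt (by simp))]
  congr 1
  refine Filter.EventuallyEq.fderiv_eq ?_
  filter_upwards [e.open_target.mem_nhds hy] with z hz using chartMollify_symm ε f hz

/-- The derivative of the mollification is the mollification of the weak differential. -/
lemma fderiv_mollify_chartPull [CompactSpace M] {ε : ℝ} (hε : 0 < ε) (he : e ∈ atlas (Eu n) M)
    {f : M → ℝ} (hf : Continuous f) {α : ∀ x : M, TangentSpace (𝓡 n) x →L[ℝ] ℝ}
    (hα : IsWeakDifferential f α) {y : Eu n} (hy : Metric.closedBall y ε ⊆ e.target) (w : Eu n) :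
    fderiv ℝ (mollify ε (chartPull e f)) y w =
      ∫ z, α (e.symm z) (chartVec e z w) * mollKernel n ε (y - z) := by
  rw [fderiv_mollify_apply ε (locallyIntegrable_chartPull hf)]
  set η : Eu n → ℝ := fun z => mollKernel n ε (y - z)
  have hη : ContDiff ℝ ∞ η := (contDiff_mollKernel ε).comp (contDiff_const.sub contDiff_id)
  have hηs : tsupport η ⊆ Metric.closedBall y ε := by
    refine closure_minimal (fun z hz => ?_) Metric.isClosed_closedBall
    rw [Metric.mem_closedBall, dist_comm]
    exact (dist_lt_of_mollKernel_sub_ne_zero hε hz).le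
  have hηc : HasCompactSupport η :=
    (isCompact_closedBall y ε).of_isClosed_subset (isClosed_tsupport _) hηs
  have hd : ∀ z, fderiv ℝ η z w = - fderiv ℝ (mollKernel n ε) (y - z) w := by
    intro z
    have h1 : HasFDerivAt η ((fderiv ℝ (mollKernel n ε) (y - z)).comp
        (-(ContinuousLinearMap.id ℝ (Eu n)))) z :=
      (((contDiff_mollKernel (n := n) ε).differentiable (by simp)) (y - z)).hasFDerivAt.comp z
        ((hasFDerivAt_id z).const_sub y)
    rw [h1.fderiv]
    simp
  have key := ((hα e he).2 w).2 η hη hηc (hηs.trans hy)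
  have h2 : ∫ z, f (e.symm z) * fderiv ℝ η z w =
      - ∫ z, fderiv ℝ (mollKernel n ε) (y - z) w * chartPull e f z := by
    rw [← integral_neg]
    refine integral_congr_ae (Filter.Eventually.of_forall fun z => ?_)
    simp only
    by_cases hz : z ∈ e.target
    · rw [hd, chartPull_of_mem hz]
      ring
    · have h0 : fderiv ℝ η z w = 0 := by
        have : z ∉ tsupport η := fun h => hz (hy (hηs h))
        rw [fderiv_of_notMem_tsupport _ this]
        rfl
      have h0' : chartPull e f z = 0 := Set.indicator_of_notMem hz _
      rw [h0, h0']
      simp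
  rw [h2] at key
  exact neg_injective key

/-- The gradient of the mollification is bounded by the mollification of the gradient, up to the
factor `1 + δ` by which the metric varies at the scale `ε`. -/
lemma gradNorm_chartMollify_le [CompactSpace M] {ε δ : ℝ} (hε : 0 < ε) (hδ : 0 < δ)
    (g : ContMetric n M)
    (he : e ∈ atlas (Eu n) M) {f : M → ℝ} (hf : Continuous f)
    {α : ∀ x : M, TangentSpace (𝓡 n) x →L[ℝ] ℝ}
    (hα : IsWeakDifferential f α) {y : Eu n}
    (hy : ∀ z, dist z y ≤ ε → z ∈ e.target ∧ ∀ w, metricLen g (e.symm z) (chartVec e z w) ≤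
      (1 + δ) * metricLen g (e.symm y) (chartVec e y w)) :
    ENNReal.ofReal (gradNorm g (e.symm y) (differential (chartMollify ε e f) (e.symm y))) ≤
      ENNReal.ofReal (1 + δ) * ∫⁻ z, ENNReal.ofReal (mollKernel n ε (y - z)) *
        e.target.indicator (fun z => ENNReal.ofReal (gradNorm g (e.symm z) (α (e.symm z)))) z := by
  have hyt : y ∈ e.target := (hy y (by simpa using hε.le)).1
  refine ofReal_gradNorm_le g _ _ fun v => ?_
  obtain ⟨w, rfl⟩ := chartVec_surjective he hyt v
  rw [differential_chartMollify_chartVec ε he hf hyt,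
    fderiv_mollify_chartPull hε he hf hα (fun z hz => (hy z hz).1)]
  rw [← Real.enorm_eq_ofReal_abs]
  refine (enorm_integral_le_lintegral_enorm _).trans ?_
  have hL : ENNReal.ofReal ((1 + δ) * metricLen g (e.symm y) (chartVec e y w)) ≠ ⊤ :=
    ENNReal.ofReal_ne_top
  rw [mul_right_comm, ← ENNReal.ofReal_mul (by linarith), ← lintegral_const_mul' _ _ hL]
  refine lintegral_mono fun z => ?_
  by_cases hk : mollKernel n ε (y - z) = 0
  · simp [hk]
  · have hz := dist_lt_of_mollKernel_sub_ne_zero hε hk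
    rw [dist_comm] at hz
    obtain ⟨hzt, hzw⟩ := hy z hz.le
    rw [Set.indicator_of_mem hzt, enorm_mul, Real.enorm_eq_ofReal_abs, Real.enorm_eq_ofReal_abs,
      abs_of_nonneg (mollKernel_nonneg ε _), mul_left_comm, mul_comm]
    refine mul_le_mul' le_rfl ?_
    rw [← ENNReal.ofReal_mul (mul_nonneg (by linarith) (metricLen_nonneg _ _ _))]
    refine ENNReal.ofReal_le_ofReal ((abs_apply_le_gradNorm_mul g _ _ _).trans ?_)
    rw [mul_comm]
    exact mul_le_mul_of_nonneg_right (hzw w) (gradNorm_nonneg _ _ _)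

lemma aemeasurable_gradNorm_comp_symm (g : ContMetric n M) (he : e ∈ atlas (Eu n) M)
    {f : M → ℝ} {α : ∀ x : M, TangentSpace (𝓡 n) x →L[ℝ] ℝ} (hα : IsWeakDifferential f α) :
    AEMeasurable (fun y => ENNReal.ofReal (gradNorm g (e.symm y) (α (e.symm y))))
      (volume.restrict e.target) := by
  have hα' : ∀ a, AEMeasurable (fun y => α (e.symm y) (chartFrame e y a))
      (volume.restrict e.target) := fun a =>
    ((hα e he).2 _).1.aestronglyMeasurable.aemeasurable
  have hG : ∀ a b, AEMeasurable (fun y => (chartGram g e y)⁻¹ a b) (volume.restrict e.target) :=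
    fun a b => (continuousOn_iff_continuous_domRestrict.2
      ((continuous_chartGram_inv g he).matrix_elem a b)).aemeasurable e.open_target.measurableSet
  have h1 : AEMeasurable (fun y => √((fun a => α (e.symm y) (chartFrame e y a)) ⬝ᵥ
      (chartGram g e y)⁻¹ *ᵥ fun a => α (e.symm y) (chartFrame e y a)))
      (volume.restrict e.target) := by
    refine AEMeasurable.sqrt ?_
    simp only [dotProduct, Matrix.mulVec]
    exact Finset.aemeasurable_fun_sum _ fun a _ => (hα' a).mul
      (Finset.aemeasurable_fun_sum _ fun b _ => (hG a b).mul (hα' b))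
  refine AEMeasurable.ennreal_ofReal (h1.congr ?_)
  filter_upwards [ae_restrict_mem e.open_target.measurableSet] with y hy
  exact (gradNorm_symm g he hy _).symm

end ChartMollifier

/-! ### The energy of mollifications in a chart -/

section ChartEnergy

variable {n : ℕ} {M : Type*} [TopologicalSpace M] [ChartedSpace (Eu n) M] [IsManifold (𝓡 n) ∞ M]
  {e : OpenPartialHomeomorph M (Eu n)} [MeasurableSpace M] [BorelSpace M]

lemma isCompact_image_tsupport [CompactSpace M] {χ : M → ℝ} (hχe : tsupport χ ⊆ e.source) :
    IsCompact (e '' tsupport χ) ∧ e '' tsupport χ ⊆ e.target :=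
  ⟨(isClosed_tsupport χ).isCompact.image_of_continuousOn (e.continuousOn.mono hχe),
    by rintro _ ⟨x, hx, rfl⟩; exact e.map_source (hχe hx)⟩

lemma continuousOn_gradNorm_chartMollify [CompactSpace M] (g : ContMetric n M) (ε : ℝ)
    (he : e ∈ atlas (Eu n) M) {f : M → ℝ} (hf : Continuous f) :
    ContinuousOn (fun y => gradNorm g (e.symm y) (differential (chartMollify ε e f) (e.symm y)))
      e.target := by
  refine continuousOn_gradNorm_comp_symm g he fun v => ?_
  have h1 := (contDiff_mollify ε (locallyIntegrable_chartPull (e := e) hf)).continuous_fderiv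
    (by simp)
  exact (h1.clm_apply (continuous_const (y := v))).continuousOn.congr fun y hy =>
    differential_chartMollify_chartVec ε he hf hy v

lemma aemeasurable_energy_chartMollify [CompactSpace M] (g : ContMetric n M) (p ε : ℝ)
    (he : e ∈ atlas (Eu n) M) {f : M → ℝ} (hf : Continuous f) {χ : M → ℝ} (hχ : Continuous χ) :
    AEMeasurable (fun y => ENNReal.ofReal (χ (e.symm y)) * ENNReal.ofReal (gradNorm g (e.symm y)
      (differential (chartMollify ε e f) (e.symm y))) ^ p) (volume.restrict e.target) :=
  ((hχ.comp_continuousOn e.continuousOn_symm).aemeasurable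
    e.open_target.measurableSet).ennreal_ofReal.mul
    (((continuousOn_gradNorm_chartMollify g ε he hf).aemeasurable
      e.open_target.measurableSet).ennreal_ofReal.pow_const p)

lemma exists_one_add_rpow_le (p : ℝ) {δ : ℝ} (hδ : 0 < δ) : ∃ η : ℝ, 0 < η ∧ (1 + η) ^ p ≤ 1 + δ := by
  have hc : ContinuousAt (fun η : ℝ => (1 + η) ^ p) 0 :=
    ContinuousAt.rpow_const (by fun_prop) (Or.inl (by norm_num))
  have h1 : ∀ᶠ η in 𝓝 (0 : ℝ), (1 + η) ^ p < 1 + δ :=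
    hc.eventually_lt continuousAt_const (by simp [hδ])
  obtain ⟨η, h, h0⟩ := ((h1.filter_mono (nhdsWithin_le_nhds (s := Set.Ioi 0))).and
    self_mem_nhdsWithin).exists
  exact ⟨η, h0, h.le⟩

/-- Tonelli's theorem for mollification: the kernel may be moved to the weight. -/
lemma lintegral_mul_lintegral_mollKernel_le (ε : ℝ) {W U V : Eu n → ℝ≥0∞} (hW : Measurable W)
    (hU : AEMeasurable U) (hV : ∀ z, U z ≠ 0 →
      ∫⁻ y, W y * ENNReal.ofReal (mollKernel n ε (y - z)) ≤ V z) :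
    ∫⁻ y, W y * ∫⁻ z, ENNReal.ofReal (mollKernel n ε (y - z)) * U z ≤ ∫⁻ z, V z * U z := by
  have hk : Measurable (Function.uncurry fun y z : Eu n =>
      ENNReal.ofReal (mollKernel n ε (y - z))) :=
    ((contDiff_mollKernel ε).continuous.measurable.comp
      (measurable_fst.sub measurable_snd)).ennreal_ofReal
  have hU' : AEMeasurable (fun q : Eu n × Eu n => U q.2) ((volume : Measure (Eu n)).prod volume) :=
    hU.comp_quasiMeasurePreserving Measure.quasiMeasurePreserving_snd
  have hκ : Measurable (mollKernel n ε) := (contDiff_mollKernel ε).continuous.measurable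
  have hk1 : ∀ y, Measurable fun z : Eu n => ENNReal.ofReal (mollKernel n ε (y - z)) := fun y =>
    (hκ.comp (measurable_const.sub measurable_id)).ennreal_ofReal
  have hk2 : ∀ z, Measurable fun y : Eu n => ENNReal.ofReal (mollKernel n ε (y - z)) := fun z =>
    (hκ.comp (measurable_id.sub measurable_const)).ennreal_ofReal
  calc ∫⁻ y, W y * ∫⁻ z, ENNReal.ofReal (mollKernel n ε (y - z)) * U z
      = ∫⁻ y, ∫⁻ z, W y * (ENNReal.ofReal (mollKernel n ε (y - z)) * U z) := by
        refine lintegral_congr fun y => ?_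
        have hm : AEMeasurable fun z => ENNReal.ofReal (mollKernel n ε (y - z)) * U z :=
          (hk1 y).aemeasurable.mul hU
        rw [lintegral_const_mul'' _ hm]
    _ = ∫⁻ z, ∫⁻ y, W y * (ENNReal.ofReal (mollKernel n ε (y - z)) * U z) := by
        rw [lintegral_lintegral_swap]
        exact (hW.comp measurable_fst).aemeasurable.mul (hk.aemeasurable.mul hU')
    _ = ∫⁻ z, (∫⁻ y, W y * ENNReal.ofReal (mollKernel n ε (y - z))) * U z := by
        refine lintegral_congr fun z => ?_
        have hm : Measurable fun y => W y * ENNReal.ofReal (mollKernel n ε (y - z)) :=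
          hW.mul (hk2 z)
        rw [← lintegral_mul_const _ hm]
        exact lintegral_congr fun y => (mul_assoc _ _ _).symm
    _ ≤ _ := by
        refine lintegral_mono fun z => ?_
        by_cases hz : U z = 0
        · simp [hz]
        · exact mul_le_mul' (hV z hz) le_rfl

/-- The volume density weighted by a cutoff, in the coordinates of a chart, oscillates little at
small scales, relatively to the volume density itself. -/
lemma exists_lintegral_weight_mul_mollKernel_le [CompactSpace M] (g : ContMetric n M)
    (he : e ∈ atlas (Eu n) M) {χ : M → ℝ} (hχ : Continuous χ) (hχ0 : ∀ x, 0 ≤ χ x)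
    (hχe : tsupport χ ⊆ e.source) {δ : ℝ} (hδ : 0 < δ) :
    ∃ W : Eu n → ℝ, Measurable W ∧ (∀ y ∈ e.target, W y = χ (e.symm y) * volDensity g e y) ∧
      ∀ᶠ ε in 𝓝[>] (0 : ℝ), ∀ z ∈ e.target,
        ∫⁻ y, ENNReal.ofReal (W y) * ENNReal.ofReal (mollKernel n ε (y - z)) ≤
          ENNReal.ofReal (volDensity g e z) * ENNReal.ofReal (χ (e.symm z)) +
            ENNReal.ofReal δ * ENNReal.ofReal (volDensity g e z) := by
  obtain ⟨hK, hKt⟩ := isCompact_image_tsupport hχe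
  set K := e '' tsupport χ
  obtain ⟨r, hr, hrt⟩ := hK.exists_cthickening_subset_open e.open_target hKt
  have hK' : IsCompact (Metric.cthickening r K) := hK.cthickening
  obtain ⟨c, hc, hcw⟩ := hK'.exists_forall_le' (a := 0) ((continuousOn_volDensity g he).mono hrt)
    fun y hy => volDensity_pos g he (hrt hy)
  obtain ⟨W, hW⟩ : ∃ W : Eu n → ℝ,
      W = e.target.indicator fun y => χ (e.symm y) * volDensity g e y := ⟨_, rfl⟩
  have hWt : ∀ y ∈ e.target, W y = χ (e.symm y) * volDensity g e y := fun y hy => by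
    rw [hW, Set.indicator_of_mem hy]
  have hWK : ∀ y, W y ≠ 0 → y ∈ K := fun y hy => by
    by_cases hyt : y ∈ e.target
    · rw [hWt y hyt] at hy
      exact ⟨e.symm y, subset_tsupport _ (left_ne_zero_of_mul hy), e.right_inv hyt⟩
    · rw [hW, Set.indicator_of_notMem hyt] at hy
      exact absurd rfl hy
  have hWs : tsupport W ⊆ K := closure_minimal (fun y hy => hWK y hy) hK.isClosed
  have hWc : Continuous W := by
    refine continuous_of_tsupport fun y hy => ?_
    have hyt := e.open_target.mem_nhds (hKt (hWs hy))
    have h1 : ContinuousAt (fun y => χ (e.symm y) * volDensity g e y) y :=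
      ((hχ.comp_continuousOn e.continuousOn_symm).mul (continuousOn_volDensity g he)).continuousAt
        hyt
    refine h1.congr ?_
    filter_upwards [hyt] with z hz
    exact (hWt z hz).symm
  have hWcs : HasCompactSupport W := hK.of_isClosed_subset (isClosed_tsupport _) hWs
  obtain ⟨ε₁, hε₁, hWu⟩ := Metric.uniformContinuous_iff.1
    (hWcs.uniformContinuous_of_continuous hWc) (δ * c) (by positivity)
  refine ⟨W, hWc.measurable, hWt, ?_⟩
  have hev : ∀ᶠ ε in 𝓝[>] (0 : ℝ), ε < min ε₁ r ∧ 0 < ε :=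
    ((eventually_lt_nhds (show (0 : ℝ) < min ε₁ r by positivity)).filter_mono
      nhdsWithin_le_nhds).and self_mem_nhdsWithin
  filter_upwards [hev] with ε ⟨hε', hε⟩ z hz
  have hεr : ε < r := hε'.trans_le (min_le_right _ _)
  have hεε₁ : ε < ε₁ := hε'.trans_le (min_le_left _ _)
  have hw := (volDensity_pos g he hz).le
  calc ∫⁻ y, ENNReal.ofReal (W y) * ENNReal.ofReal (mollKernel n ε (y - z))
      ≤ ∫⁻ y, ENNReal.ofReal (W z + δ * volDensity g e z) *
          ENNReal.ofReal (mollKernel n ε (y - z)) := by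
        refine lintegral_mono fun y => ?_
        by_cases hkz : mollKernel n ε (y - z) = 0
        · simp [hkz]
        · refine mul_le_mul' (ENNReal.ofReal_le_ofReal ?_) le_rfl
          have hd := dist_lt_of_mollKernel_sub_ne_zero hε hkz
          by_cases hy : W y = 0
          · rw [hy, hWt z hz]
            exact add_nonneg (mul_nonneg (hχ0 _) hw) (mul_nonneg hδ.le hw)
          · have hzK : z ∈ Metric.cthickening r K :=
              Metric.mem_cthickening_of_dist_le z y r K (hWK y hy) (by rw [dist_comm]; linarith)
            have h1 := hWu (hd.trans hεε₁)
            rw [Real.dist_eq, abs_lt] at h1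
            have := mul_le_mul_of_nonneg_left (hcw z hzK) hδ.le
            linarith
    _ = _ := by
        rw [lintegral_const_mul' _ _ ENNReal.ofReal_ne_top, lintegral_mollKernel_sub_right, mul_one,
          hWt z hz, ENNReal.ofReal_add (mul_nonneg (hχ0 _) hw) (mul_nonneg hδ.le hw),
          ENNReal.ofReal_mul hδ.le, ENNReal.ofReal_mul (hχ0 _), mul_comm (ENNReal.ofReal (χ _))]

/-- The local energy estimate: by Jensen's inequality and Tonelli's theorem the energy of the
mollification, weighted by a cutoff `χ`, is at most the weighted energy of `f` up to a small
error, which comes from the oscillation of the metric and of the weight. -/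
lemma eventually_energy_chartMollify_le [CompactSpace M] (g : ContMetric n M)
    (he : e ∈ atlas (Eu n) M) {p : ℝ} (hp : 1 < p) {f : M → ℝ} (hf : Continuous f)
    {α : ∀ x : M, TangentSpace (𝓡 n) x →L[ℝ] ℝ} (hα : IsWeakDifferential f α)
    {χ : M → ℝ} (hχ : Continuous χ) (hχ0 : ∀ x, 0 ≤ χ x) (hχe : tsupport χ ⊆ e.source)
    {δ : ℝ} (hδ : 0 < δ) :
    ∀ᶠ ε in 𝓝[>] (0 : ℝ),
      ∫⁻ x, ENNReal.ofReal (χ x) *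
          ENNReal.ofReal (gradNorm g x (differential (chartMollify ε e f) x)) ^ p ∂(vol g) ≤
        ENNReal.ofReal (1 + δ) *
          (∫⁻ x, ENNReal.ofReal (χ x) * ENNReal.ofReal (gradNorm g x (α x)) ^ p ∂(vol g) +
            ENNReal.ofReal δ * ∫⁻ x, ENNReal.ofReal (gradNorm g x (α x)) ^ p ∂(vol g)) := by
  have hp0 : 0 < p := by linarith
  obtain ⟨δ', hδ', hδp⟩ := exists_one_add_rpow_le p hδ
  obtain ⟨hK, hKt⟩ := isCompact_image_tsupport hχe
  obtain ⟨W, hWm, hWt, hWev⟩ := exists_lintegral_weight_mul_mollKernel_le g he hχ hχ0 hχe hδ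
  obtain ⟨ε₂, hε₂, hcomp⟩ := exists_metricLen_comparison g he hK hKt hδ'
  have hev : ∀ᶠ ε in 𝓝[>] (0 : ℝ), ε < ε₂ ∧ 0 < ε :=
    ((eventually_lt_nhds hε₂).filter_mono nhdsWithin_le_nhds).and self_mem_nhdsWithin
  filter_upwards [hev, hWev] with ε ⟨hεε₂, hε⟩ hinner
  obtain ⟨u, hudef⟩ : ∃ u : Eu n → ℝ≥0∞,
      u = fun z => ENNReal.ofReal (gradNorm g (e.symm z) (α (e.symm z))) := ⟨_, rfl⟩
  have hu : AEMeasurable u (volume.restrict e.target) := by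
    rw [hudef]; exact aemeasurable_gradNorm_comp_symm g he hα
  have hU : AEMeasurable (e.target.indicator u) :=
    (aemeasurable_indicator_iff e.open_target.measurableSet).2 hu
  have hUp : ∀ z, e.target.indicator u z ^ p = e.target.indicator (fun z => u z ^ p) z :=
    fun z => by by_cases hz : z ∈ e.target <;> simp [hz, hp0]
  have hsupp : ∀ x ∉ e.source, χ x = 0 := fun x hx => by
    by_contra h
    exact hx (hχe (subset_tsupport _ h))
  have hm1 : AEMeasurable (fun y => ENNReal.ofReal (χ (e.symm y)) * u y ^ p)
      (volume.restrict e.target) :=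
    ((hχ.comp_continuousOn e.continuousOn_symm).aemeasurable
      e.open_target.measurableSet).ennreal_ofReal.mul (hu.pow_const p)
  have hv : AEMeasurable (fun y => ENNReal.ofReal (volDensity g e y))
      (volume.restrict e.target) :=
    ((continuousOn_volDensity g he).aemeasurable e.open_target.measurableSet).ennreal_ofReal
  -- the pointwise bound of the gradient, the oscillation of the metric, and Jensen's inequality
  have hleft : ∫⁻ x, ENNReal.ofReal (χ x) *
      ENNReal.ofReal (gradNorm g x (differential (chartMollify ε e f) x)) ^ p ∂(vol g) ≤
      ENNReal.ofReal (1 + δ) * ∫⁻ y, ENNReal.ofReal (W y) *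
        ∫⁻ z, ENNReal.ofReal (mollKernel n ε (y - z)) * e.target.indicator u z ^ p := by
    rw [lintegral_vol_eq_of_support_subset g he
      (f := fun x => ENNReal.ofReal (χ x) *
        ENNReal.ofReal (gradNorm g x (differential (chartMollify ε e f) x)) ^ p)
      (aemeasurable_energy_chartMollify g p ε he hf hχ) fun x hx => by simp [hsupp x hx],
      ← lintegral_const_mul' _ _ ENNReal.ofReal_ne_top]
    refine (setLIntegral_mono' e.open_target.measurableSet fun y hy => ?_).trans
      (setLIntegral_le_lintegral e.target _)
    rw [← mul_assoc, ← ENNReal.ofReal_mul (volDensity_pos g he hy).le, mul_comm (volDensity _ _ _),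
      ← hWt y hy, mul_left_comm]
    by_cases hχy : χ (e.symm y) = 0
    · rw [hWt y hy, hχy]
      simp
    · refine mul_le_mul' le_rfl ?_
      have hyK : y ∈ e '' tsupport χ := ⟨e.symm y, subset_tsupport _ hχy, e.right_inv hy⟩
      have h1 := gradNorm_chartMollify_le hε hδ' g he hf hα (y := y) fun z hz =>
        ⟨(hcomp y hyK z (hz.trans hεε₂.le)).1, fun w =>
          (hcomp y hyK z (hz.trans hεε₂.le)).2 w⟩
      rw [← hudef] at h1
      refine (ENNReal.rpow_le_rpow h1 hp0.le).trans ?_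
      rw [ENNReal.mul_rpow_of_nonneg _ _ hp0.le,
        ENNReal.ofReal_rpow_of_nonneg (by linarith) hp0.le]
      exact mul_le_mul' (ENNReal.ofReal_le_ofReal hδp)
        (lintegral_mollKernel_mul_rpow_le hp ε y hU)
  -- Tonelli's theorem, and the oscillation of the weight
  have hright : ∫⁻ y, ENNReal.ofReal (W y) *
        ∫⁻ z, ENNReal.ofReal (mollKernel n ε (y - z)) * e.target.indicator u z ^ p ≤
      ∫⁻ z in e.target, (ENNReal.ofReal (volDensity g e z) *
        (ENNReal.ofReal (χ (e.symm z)) * u z ^ p) +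
          ENNReal.ofReal δ * (ENNReal.ofReal (volDensity g e z) * u z ^ p)) := by
    refine (lintegral_mul_lintegral_mollKernel_le ε hWm.ennreal_ofReal (hU.pow_const p)
      (V := fun z => ENNReal.ofReal (volDensity g e z) * ENNReal.ofReal (χ (e.symm z)) +
            ENNReal.ofReal δ * ENNReal.ofReal (volDensity g e z)) fun z hz => ?_).trans_eq ?_
    · refine hinner z ?_
      by_contra hzt
      rw [hUp, Set.indicator_of_notMem hzt] at hz
      exact hz rfl
    · rw [← lintegral_indicator e.open_target.measurableSet]
      refine lintegral_congr fun z => ?_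
      rw [hUp]
      by_cases hz : z ∈ e.target
      · rw [Set.indicator_of_mem hz, Set.indicator_of_mem hz]
        ring
      · rw [Set.indicator_of_notMem hz, Set.indicator_of_notMem hz, mul_zero]
  have hsplit : ∫⁻ z in e.target, (ENNReal.ofReal (volDensity g e z) *
        (ENNReal.ofReal (χ (e.symm z)) * u z ^ p) +
          ENNReal.ofReal δ * (ENNReal.ofReal (volDensity g e z) * u z ^ p)) =
      ∫⁻ x, ENNReal.ofReal (χ x) * ENNReal.ofReal (gradNorm g x (α x)) ^ p ∂(vol g) +
        ENNReal.ofReal δ * ∫⁻ x, ENNReal.ofReal (gradNorm g x (α x)) ^ p ∂(chartVolume g e) := by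
    have hm2 : AEMeasurable (fun y => ENNReal.ofReal (volDensity g e y) *
        (ENNReal.ofReal (χ (e.symm y)) * u y ^ p)) (volume.restrict e.target) := hv.mul hm1
    subst hudef
    rw [lintegral_add_left' hm2, lintegral_const_mul' _ _ ENNReal.ofReal_ne_top,
      lintegral_vol_eq_of_support_subset g he (f := fun x => ENNReal.ofReal (χ x) *
        ENNReal.ofReal (gradNorm g x (α x)) ^ p) hm1 (fun x hx => by simp [hsupp x hx]),
      lintegral_chartVolume g he (hu.pow_const p)]
  refine hleft.trans (mul_le_mul' le_rfl (hright.trans ?_))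
  rw [hsplit]
  exact add_le_add le_rfl (mul_le_mul' le_rfl
    (lintegral_mono' (chartVolume_le_vol g he) le_rfl))

end ChartEnergy

/-! ### The Riemannian distance -/

section PathLength

open Manifold

/-- A differentiable map which expands tangent vectors at most by the factor `C` along a path
expands its length at most by the same factor. -/
lemma pathELength_comp_le {E H M E' H' N : Type*} [NormedAddCommGroup E] [NormedSpace ℝ E]
    [TopologicalSpace H] {I : ModelWithCorners ℝ E H} [TopologicalSpace M] [ChartedSpace H M]
    [∀ x : M, ENorm (TangentSpace I x)]
    [NormedAddCommGroup E'] [NormedSpace ℝ E'] [TopologicalSpace H'] {I' : ModelWithCorners ℝ E' H'}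
    [TopologicalSpace N] [ChartedSpace H' N] [∀ x : N, ENorm (TangentSpace I' x)]
    {Ψ : M → N} {γ : ℝ → M} {C : ℝ≥0∞} (hC : C ≠ ⊤)
    (hγ : MDifferentiableOn 𝓘(ℝ, ℝ) I γ (Set.Icc 0 1))
    (hΨ : ∀ s ∈ Set.Icc (0 : ℝ) 1, MDifferentiableAt I I' Ψ (γ s))
    (hb : ∀ s ∈ Set.Icc (0 : ℝ) 1, ∀ v : TangentSpace I (γ s),
      ‖mfderiv I I' Ψ (γ s) v‖ₑ ≤ C * ‖v‖ₑ) :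
    pathELength I' (Ψ ∘ γ) 0 1 ≤ C * pathELength I γ 0 1 := by
  rw [pathELength_eq_lintegral_mfderivWithin_Icc, pathELength_eq_lintegral_mfderivWithin_Icc,
    ← lintegral_const_mul' _ _ hC]
  refine setLIntegral_mono' measurableSet_Icc fun s hs => ?_
  have hu : UniqueMDiffWithinAt 𝓘(ℝ, ℝ) (Set.Icc (0 : ℝ) 1) s :=
    (uniqueMDiffOn_iff_uniqueDiffOn.2 (uniqueDiffOn_Icc one_pos)) s hs
  rw [mfderiv_comp_mfderivWithin (I' := I) s (hΨ s hs) (hγ s hs) hu]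
  exact hb s hs _

end PathLength

section Distance

variable {n : ℕ} {M : Type*} [TopologicalSpace M] [ChartedSpace (Eu n) M] [IsManifold (𝓡 n) ∞ M]
  {e : OpenPartialHomeomorph M (Eu n)}

lemma eventually_metricEDist_lt (g : ContMetric n M) (x : M) {c : ℝ≥0∞} (hc : 0 < c) :
    ∀ᶠ y in 𝓝 x, metricEDist g x y < c := by
  let : RiemannianBundle (fun x : M => TangentSpace (𝓡 n) x) := ⟨g.toRiemannianMetric⟩
  exact eventually_riemannianEDist_lt (𝓡 n) x hc

/-- A compact set has a uniform neighbourhood inside any open set containing it. -/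
lemma exists_metricEDist_lt_subset [T2Space M] [CompactSpace M] (g : ContMetric n M) {K U : Set M}
    (hK : IsCompact K) (hU : IsOpen U) (hKU : K ⊆ U) :
    ∃ r : ℝ, 0 < r ∧ ∀ x ∈ K, ∀ x', metricEDist g x x' < ENNReal.ofReal r → x' ∈ U := by
  let : RiemannianBundle (fun x : M => TangentSpace (𝓡 n) x) := ⟨g.toRiemannianMetric⟩
  let : PseudoEMetricSpace M := PseudoEMetricSpace.ofRiemannianMetric (𝓡 n) M
  obtain ⟨r, hr, hrU⟩ := hK.exists_thickening_subset_open hU hKU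
  refine ⟨r, hr, fun x hx x' h => hrU ?_⟩
  rw [Metric.mem_thickening_iff_exists_edist_lt]
  refine ⟨x, hx, ?_⟩
  rw [edist_comm]
  exact h

/-- A function with a Hölder bound is continuous. -/
lemma continuous_of_holder (g : ContMetric n M) {f : M → ℝ} {D a : ℝ} (ha : 0 < a)
    (hf : ∀ x y, ENNReal.ofReal |f x - f y| ≤ ENNReal.ofReal D * metricEDist g x y ^ a) :
    Continuous f := by
  rw [continuous_iff_continuousAt]
  intro x
  rw [ContinuousAt, Metric.tendsto_nhds]
  intro η hη
  have h1 : Tendsto (fun d : ℝ≥0∞ => ENNReal.ofReal D * d ^ a) (𝓝 0) (𝓝 0) := by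
    have h2 := (ENNReal.continuous_rpow_const (y := a)).tendsto 0
    rw [ENNReal.zero_rpow_of_pos ha] at h2
    simpa using ENNReal.Tendsto.const_mul h2 (Or.inr (ENNReal.ofReal_ne_top (r := D)))
  have h3 := h1.eventually_lt_const (ENNReal.ofReal_pos.2 hη)
  obtain ⟨c, hc, hcη⟩ := ENNReal.nhds_zero_basis.mem_iff.1 h3
  filter_upwards [eventually_metricEDist_lt g x hc] with y hy
  have h4 := (hf x y).trans_lt (hcη hy)
  rw [dist_comm, Real.dist_eq]
  exact (ENNReal.ofReal_lt_ofReal_iff hη).1 h4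

lemma metricLen_congr (g : ContMetric n M) {x x' : M} (h : x = x') (v : Eu n) :
    metricLen g x (show TangentSpace (𝓡 n) x from v) =
      metricLen g x' (show TangentSpace (𝓡 n) x' from v) := by
  subst h; rfl

/-- The translation by `-t` in the coordinates of the chart `e`. -/
noncomputable def chartTranslate (e : OpenPartialHomeomorph M (Eu n)) (t : Eu n) (x : M) : M :=
  e.symm (e x - t)

lemma contMDiffAt_chartTranslate (he : e ∈ atlas (Eu n) M) {t : Eu n} {x : M} (hx : x ∈ e.source)
    (hxt : e x - t ∈ e.target) : ContMDiffAt (𝓡 n) (𝓡 n) ∞ (chartTranslate e t) x := by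
  have h1 : ContMDiffAt (𝓡 n) (𝓡 n) ∞ e x :=
    (contMDiffOn_of_mem_maximalAtlas (IsManifold.subset_maximalAtlas he)).contMDiffAt
      (e.open_source.mem_nhds hx)
  have h2 : ContMDiffAt (𝓡 n) (𝓡 n) ∞ e.symm (e x - t) :=
    (contMDiffOn_symm_of_mem_maximalAtlas (IsManifold.subset_maximalAtlas he)).contMDiffAt
      (e.open_target.mem_nhds hxt)
  have h3 : ContMDiffAt (𝓡 n) (𝓡 n) ∞ (fun y : Eu n => y - t) (e x) :=
    (contDiff_id.sub contDiff_const).contMDiff.contMDiffAt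
  exact ContMDiffAt.comp x (f := fun x => e x - t) h2 (h3.comp x h1)

/-- Chart translations move coordinate vectors to coordinate vectors. -/
lemma metricLen_mfderiv_chartTranslate (g : ContMetric n M) (he : e ∈ atlas (Eu n) M) {t y : Eu n}
    (hy : y ∈ e.target) (hyt : y - t ∈ e.target) (w : Eu n) :
    metricLen g (chartTranslate e t (e.symm y))
        (mfderiv (𝓡 n) (𝓡 n) (chartTranslate e t) (e.symm y) (chartVec e y w)) =
      metricLen g (e.symm (y - t)) (chartVec e (y - t) w) := by
  have hd := mdifferentiable_of_mem_atlas (I := 𝓡 n) he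
  have h0 : chartTranslate e t (e.symm y) = e.symm (y - t) := by
    rw [chartTranslate, e.right_inv hy]
  have h1 : MDifferentiableAt (𝓡 n) (𝓡 n) (chartTranslate e t) (e.symm y) :=
    (contMDiffAt_chartTranslate he (e.map_target hy) (by rwa [e.right_inv hy])).mdifferentiableAt
      (by simp)
  have h2 := mfderiv_comp (I := 𝓡 n) (I' := 𝓡 n) (I'' := 𝓡 n) y h1 (hd.mdifferentiableAt_symm hy)
  have hsub : HasMFDerivAt (𝓡 n) (𝓡 n) (fun z : Eu n => z - t) y (ContinuousLinearMap.id ℝ (Eu n)) :=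
    ((hasFDerivAt_id y).sub_const t).hasMFDerivAt
  have h3 := mfderiv_comp (I := 𝓡 n) (I' := 𝓡 n) (I'' := 𝓡 n) y
    (g := e.symm) (f := fun z : Eu n => z - t) (hd.mdifferentiableAt_symm hyt)
    hsub.mdifferentiableAt
  have hev : (chartTranslate e t ∘ e.symm) =ᶠ[𝓝 y] (e.symm ∘ fun z : Eu n => z - t) := by
    filter_upwards [e.open_target.mem_nhds hy] with z hz
    simp [chartTranslate, e.right_inv hz]
  have h4 := hev.mfderiv_eq (I := 𝓡 n) (I' := 𝓡 n)
  have key : (show Eu n from mfderiv (𝓡 n) (𝓡 n) (chartTranslate e t) (e.symm y)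
      (chartVec e y w)) = (show Eu n from chartVec e (y - t) w) := by
    have h5 := congrArg (fun A : Eu n →L[ℝ] Eu n => A w) (h2.symm.trans (h4.trans h3))
    rw [hsub.mfderiv] at h5
    exact h5
  exact (congrArg (metricLen g (chartTranslate e t (e.symm y))) key).trans
    (metricLen_congr g h0 (chartVec e (y - t) w))

end Distance

/-! ### Paths, Lipschitz bounds and translations in a chart -/

section Paths

variable {n : ℕ} {M : Type*} [TopologicalSpace M] [ChartedSpace (Eu n) M] [IsManifold (𝓡 n) ∞ M]
  {e : OpenPartialHomeomorph M (Eu n)}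

/-- The fibre norm attached to a continuous metric is `metricLen`. -/
lemma enorm_eq_ofReal_metricLen (g : ContMetric n M) (x : M) (v : TangentSpace (𝓡 n) x) :
    letI : RiemannianBundle (fun x : M => TangentSpace (𝓡 n) x) := ⟨g.toRiemannianMetric⟩
    ‖v‖ₑ = ENNReal.ofReal (metricLen g x v) := by
  let : RiemannianBundle (fun x : M => TangentSpace (𝓡 n) x) := ⟨g.toRiemannianMetric⟩
  have h : ‖v‖ = metricLen g x v := by
    rw [norm_eq_sqrt_real_inner]; rfl
  rw [← ofReal_norm, h]

/-- Two points at distance less than `R` are joined by a path which stays at distance less than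
`R` from its starting point, and such that maps which are `C`-Lipschitz along the path increase
the distance of the endpoints at most to `C * R`. -/
lemma exists_path_of_metricEDist_lt (g : ContMetric n M) {x x' : M} {R : ℝ≥0∞}
    (h : metricEDist g x x' < R) :
    ∃ γ : ℝ → M, (∀ s ∈ Set.Icc (0 : ℝ) 1, metricEDist g x (γ s) < R) ∧
      (∀ (Ψ : M → M) (C : ℝ≥0∞), C ≠ ⊤ →
        (∀ s ∈ Set.Icc (0 : ℝ) 1, ContMDiffAt (𝓡 n) (𝓡 n) ∞ Ψ (γ s)) →
        (∀ s ∈ Set.Icc (0 : ℝ) 1, ∀ v : TangentSpace (𝓡 n) (γ s),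
          ENNReal.ofReal (metricLen g (Ψ (γ s)) (mfderiv (𝓡 n) (𝓡 n) Ψ (γ s) v)) ≤
            C * ENNReal.ofReal (metricLen g (γ s) v)) →
        metricEDist g (Ψ x) (Ψ x') ≤ C * R) ∧
      (∀ (χ : M → ℝ) (C : ℝ≥0∞), C ≠ ⊤ → ContMDiff (𝓡 n) 𝓘(ℝ, ℝ) ∞ χ →
        (∀ s ∈ Set.Icc (0 : ℝ) 1, ∀ v : TangentSpace (𝓡 n) (γ s),
          ENNReal.ofReal |differential χ (γ s) v| ≤
            C * ENNReal.ofReal (metricLen g (γ s) v)) →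
        ENNReal.ofReal |χ x - χ x'| ≤ C * R) := by
  let : RiemannianBundle (fun x : M => TangentSpace (𝓡 n) x) := ⟨g.toRiemannianMetric⟩
  obtain ⟨γ, h0, h1, hγ, hlen⟩ := Manifold.exists_lt_of_riemannianEDist_lt h
  have hγd : MDifferentiableOn 𝓘(ℝ, ℝ) (𝓡 n) γ (Set.Icc 0 1) := hγ.mdifferentiableOn one_ne_zero
  refine ⟨γ, fun s hs => ?_, fun Ψ C hC hΨ hb => ?_, fun χ C hC hχ hb => ?_⟩
  · refine lt_of_le_of_lt ?_ hlen
    exact (Manifold.riemannianEDist_le_pathELength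
      (hγ.mono (Set.Icc_subset_Icc_right hs.2)) h0 rfl hs.1).trans
      (Manifold.pathELength_mono le_rfl hs.2)
  · have h2 := pathELength_comp_le (I := 𝓡 n) (I' := 𝓡 n) hC hγd
      (fun s hs => (hΨ s hs).mdifferentiableAt (by simp)) (fun s hs v => by
        rw [enorm_eq_ofReal_metricLen, enorm_eq_ofReal_metricLen]
        exact hb s hs v)
    have h3 : ContMDiffOn 𝓘(ℝ, ℝ) (𝓡 n) 1 (Ψ ∘ γ) (Set.Icc 0 1) := fun s hs =>
      ((hΨ s hs).of_le (by norm_cast)).comp_contMDiffWithinAt s (hγ s hs)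
    have h4 := Manifold.riemannianEDist_le_pathELength h3 (x := Ψ x) (y := Ψ x')
      (by simp [h0]) (by simp [h1]) zero_le_one
    exact (h4.trans h2).trans (by gcongr)
  · have h2 := pathELength_comp_le (I := 𝓡 n) (I' := 𝓘(ℝ, ℝ)) hC hγd
      (fun s hs => (hχ (γ s)).mdifferentiableAt (by simp)) (fun s hs v => by
        rw [enorm_eq_ofReal_metricLen]
        refine le_trans (le_of_eq ?_) (hb s hs v)
        refine enorm_tangentSpace_vectorSpace.trans ?_
        exact Real.enorm_eq_ofReal_abs _)
    have h3 : ContMDiffOn 𝓘(ℝ, ℝ) 𝓘(ℝ, ℝ) 1 (χ ∘ γ) (Set.Icc 0 1) := fun s hs =>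
      ((hχ (γ s)).of_le (by norm_cast)).comp_contMDiffWithinAt s (hγ s hs)
    have h4 := Manifold.riemannianEDist_le_pathELength h3 (x := χ x) (y := χ x')
      (by simp [h0]) (by simp [h1]) zero_le_one
    rw [← IsRiemannianManifold.out (I := 𝓘(ℝ, ℝ)), edist_dist, Real.dist_eq] at h4
    exact (h4.trans h2).trans (by gcongr)

/-- A finite bound for every number above `d` passes to `d`. -/
lemma le_mul_of_forall_lt {a C d : ℝ≥0∞} (hC0 : C ≠ 0) (hC : C ≠ ⊤)
    (h : ∀ R, d < R → a ≤ C * R) : a ≤ C * d := by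
  rw [mul_comm, ← ENNReal.div_le_iff hC0 hC]
  refine le_of_forall_gt_imp_ge_of_dense fun R hR => ?_
  rw [ENNReal.div_le_iff hC0 hC, mul_comm]
  exact h R hR

/-- A smooth function on a compact manifold is Lipschitz. -/
lemma exists_lipschitz_of_contMDiff [CompactSpace M] (g : ContMetric n M) {χ : M → ℝ}
    (hχ : ContMDiff (𝓡 n) 𝓘(ℝ, ℝ) ∞ χ) :
    ∃ L : ℝ, 0 < L ∧ (∀ x, gradNorm g x (differential χ x) ≤ L) ∧
      ∀ x x', ENNReal.ofReal |χ x - χ x'| ≤ ENNReal.ofReal L * metricEDist g x x' := by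
  obtain ⟨L, hL⟩ := isCompact_univ.exists_bound_of_continuousOn
    (continuous_gradNorm_differential g hχ).continuousOn
  have hL' : ∀ x, gradNorm g x (differential χ x) ≤ max L 1 := fun x =>
    ((le_abs_self _).trans (hL x trivial)).trans (le_max_left _ _)
  have hpos : 0 < max L 1 := lt_max_of_lt_right one_pos
  refine ⟨max L 1, hpos, hL', fun x x' => ?_⟩
  refine le_mul_of_forall_lt (by simp) ENNReal.ofReal_ne_top fun R hR => ?_
  obtain ⟨γ, -, -, hγ⟩ := exists_path_of_metricEDist_lt g hR
  refine hγ χ _ ENNReal.ofReal_ne_top hχ fun s _ v => ?_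
  rw [← ENNReal.ofReal_mul hpos.le]
  exact ENNReal.ofReal_le_ofReal ((abs_apply_le_gradNorm_mul g _ _ v).trans
    (mul_le_mul_of_nonneg_right (hL' _) (metricLen_nonneg g _ v)))

/-- On a compact subset of the domain of a chart, small translations in the chart are almost
isometries at small distances. -/
lemma exists_metricEDist_chartTranslate_le [T2Space M] [CompactSpace M] (g : ContMetric n M)
    (he : e ∈ atlas (Eu n) M) {K L : Set M} (hK : IsCompact K) (hL : IsCompact L)
    (hKL : K ⊆ interior L) (hLe : L ⊆ e.source) {δ : ℝ} (hδ : 0 < δ) :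
    ∃ r : ℝ, 0 < r ∧ ∃ ε₀ : ℝ, 0 < ε₀ ∧ ∀ x ∈ K, ∀ x', metricEDist g x x' < ENNReal.ofReal r →
      x' ∈ L ∧ ∀ t : Eu n, ‖t‖ ≤ ε₀ → e x - t ∈ e.target ∧ e x' - t ∈ e.target ∧
        metricEDist g (chartTranslate e t x) (chartTranslate e t x') ≤
          ENNReal.ofReal (1 + δ) * metricEDist g x x' := by
  obtain ⟨r, hr, hrL⟩ := exists_metricEDist_lt_subset g hK isOpen_interior hKL
  obtain ⟨ε₀, hε₀, hcmp⟩ := exists_metricLen_comparison g he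
    (hL.image_of_continuousOn (e.continuousOn.mono hLe))
    (Set.image_subset_iff.2 fun x hx => e.map_source (hLe hx)) hδ
  have hnear : ∀ x ∈ L, ∀ t : Eu n, ‖t‖ ≤ ε₀ → e x - t ∈ e.target ∧ ∀ w,
      metricLen g (e.symm (e x - t)) (chartVec e (e x - t) w) ≤
        (1 + δ) * metricLen g (e.symm (e x)) (chartVec e (e x) w) := by
    intro x hx t ht
    have h := hcmp (e x) ⟨x, hx, rfl⟩ (e x - t) (by rw [dist_eq_norm]; simpa using ht)
    exact ⟨h.1, h.2⟩
  refine ⟨r, hr, ε₀, hε₀, fun x hx x' hxx' => ?_⟩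
  have hxL : x ∈ L := interior_subset (hKL hx)
  have hx'L : x' ∈ L := interior_subset (hrL x hx x' hxx')
  refine ⟨hx'L, fun t ht => ⟨(hnear x hxL t ht).1, (hnear x' hx'L t ht).1, ?_⟩⟩
  refine le_mul_of_forall_lt (by simpa using (by linarith : 0 < 1 + δ)) ENNReal.ofReal_ne_top
    fun R hR => ?_
  -- an almost shortest path stays in `L`, where the translation is almost isometric
  obtain ⟨γ, hγ, hΨ, -⟩ := exists_path_of_metricEDist_lt g (lt_min hR hxx')
  have hγL : ∀ s ∈ Set.Icc (0 : ℝ) 1, γ s ∈ L := fun s hs =>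
    interior_subset (hrL x hx _ ((hγ s hs).trans_le (min_le_right _ _)))
  refine (hΨ (chartTranslate e t) _ ENNReal.ofReal_ne_top (fun s hs =>
    contMDiffAt_chartTranslate he (hLe (hγL s hs)) (hnear _ (hγL s hs) t ht).1)
    fun s hs v => ?_).trans (by gcongr; exact min_le_left _ _)
  have hsL := hγL s hs
  obtain ⟨y, hy, hys⟩ : ∃ y ∈ e.target, e.symm y = γ s :=
    ⟨e (γ s), e.map_source (hLe hsL), e.left_inv (hLe hsL)⟩
  have hye : e (γ s) = y := by rw [← hys, e.right_inv hy]
  obtain ⟨h1, h2⟩ := hnear _ hsL t ht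
  rw [hye] at h1 h2
  rw [← ENNReal.ofReal_mul (by linarith)]
  refine ENNReal.ofReal_le_ofReal ?_
  revert v
  rw [← hys]
  intro v
  obtain ⟨w, rfl⟩ := chartVec_surjective he hy v
  rw [metricLen_mfderiv_chartTranslate g he hy h1 w]
  exact h2 w

end Paths

/-! ### The Hölder bound of mollifications in a chart -/

section LocalHolder

variable {n : ℕ} {M : Type*} [TopologicalSpace M] [ChartedSpace (Eu n) M] [IsManifold (𝓡 n) ∞ M]
  {e : OpenPartialHomeomorph M (Eu n)}

lemma metricEDist_self (g : ContMetric n M) (x : M) : metricEDist g x x = 0 := by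
  let : RiemannianBundle (fun x : M => TangentSpace (𝓡 n) x) := ⟨g.toRiemannianMetric⟩
  exact Manifold.riemannianEDist_self

/-- The Hölder bound of `f` for the exponent `a`, in product form, which is free of quotients by
zero. -/
def HolderBound (g : ContMetric n M) (a D : ℝ) (f : M → ℝ) : Prop :=
  ∀ x y, ENNReal.ofReal |f x - f y| ≤ ENNReal.ofReal D * metricEDist g x y ^ a

lemma holderSeminorm_le_iff (g : ContMetric n M) {p D : ℝ} (hp : 0 < p) (hn : (n : ℝ) < p)
    (hD : 0 < D) (f : M → ℝ) :
    holderSeminorm g p f ≤ ENNReal.ofReal D ↔ HolderBound g ((p - n) / p) D f := by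
  have ha : 0 < (p - n) / p := div_pos (by linarith) hp
  have hD' : ENNReal.ofReal D ≠ 0 := by simpa using hD
  simp only [holderSeminorm, iSup_le_iff, HolderBound]
  refine forall_congr' fun x => forall_congr' fun y => ?_
  by_cases htop : metricEDist g x y = ⊤
  · simp [htop, ENNReal.top_rpow_of_pos ha, ENNReal.mul_top hD']
  · exact ENNReal.div_le_iff_le_mul (Or.inr ENNReal.ofReal_ne_top)
      (Or.inl (ENNReal.rpow_ne_top_of_nonneg ha.le htop))

/-- On compact subsets of the domain of a chart, mollifications converge uniformly. -/
lemma eventually_abs_chartMollify_sub_le [CompactSpace M] {f : M → ℝ} (hf : Continuous f)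
    {L : Set M} (hL : IsCompact L) (hLe : L ⊆ e.source) {η : ℝ} (hη : 0 < η) :
    ∀ᶠ ε in 𝓝[>] (0 : ℝ), ∀ x ∈ L, |chartMollify ε e f x - f x| ≤ η := by
  have hc : ∀ y ∈ e '' L, ContinuousAt (chartPull e f) y := by
    rintro _ ⟨x, hx, rfl⟩
    have hy := e.map_source (hLe hx)
    refine (hf.continuousAt.comp (e.continuousAt_symm hy)).congr ?_
    filter_upwards [e.open_target.mem_nhds hy] with z hz
    exact (chartPull_of_mem hz).symm
  have hu := (hL.image_of_continuousOn (e.continuousOn.mono hLe)).uniformContinuousAt_of_continuousAt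
    (chartPull e f) hc (Metric.dist_mem_uniformity hη)
  obtain ⟨ε₀, hε₀, hε⟩ := Metric.mem_uniformity_dist.1 hu
  filter_upwards [Ioc_mem_nhdsGT hε₀] with ε hεm x hx
  refine abs_mollify_sub_le hεm.1 (locallyIntegrable_chartPull hf) hη.le fun z hz => ?_
  have h1 := hε (a := e x) (b := z) (by rw [dist_comm]; exact hz.trans_le hεm.2) ⟨x, hx, rfl⟩
  rw [Set.mem_ofPred_eq, dist_comm, Real.dist_eq, chartPull_of_mem (e.map_source (hLe hx)),
    e.left_inv (hLe hx)] at h1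
  exact h1.le

/-- Near a compact subset `K` of the domain of a chart the Hölder constant of the mollifications
exceeds that of `f` by an arbitrarily small factor at most, and they approximate `f`. -/
lemma exists_eventually_holder_chartMollify [T2Space M] [CompactSpace M] (g : ContMetric n M)
    (he : e ∈ atlas (Eu n) M) {a D : ℝ} (ha : 0 < a) (hD : 0 < D) {f : M → ℝ} (hf : Continuous f)
    (hfD : HolderBound g a D f) {K : Set M} (hK : IsCompact K) (hKe : K ⊆ e.source)
    {δ : ℝ} (hδ : 0 < δ) :
    ∃ r : ℝ, 0 < r ∧ ∀ η : ℝ, 0 < η → ∀ᶠ ε in 𝓝[>] (0 : ℝ),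
      ∀ x ∈ K, ∀ x', metricEDist g x x' < ENNReal.ofReal r →
        |chartMollify ε e f x' - f x'| ≤ η ∧
        |chartMollify ε e f x - chartMollify ε e f x'| ≤
          (1 + δ) * D * (metricEDist g x x' ^ a).toReal := by
  obtain ⟨L, hL, hKL, hLe⟩ := exists_compact_between hK e.open_source hKe
  obtain ⟨δ', hδ', hδa⟩ := exists_one_add_rpow_le a hδ
  obtain ⟨r, hr, ε₀, hε₀, htr⟩ := exists_metricEDist_chartTranslate_le g he hK hL hKL hLe hδ'
  refine ⟨r, hr, fun η hη => ?_⟩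
  filter_upwards [eventually_abs_chartMollify_sub_le hf hL hLe hη, Ioc_mem_nhdsGT hε₀]
    with ε hclose hε x hx x' hxx'
  obtain ⟨hx'L, ht⟩ := htr x hx x' hxx'
  refine ⟨hclose x' hx'L, ?_⟩
  refine abs_mollify_sub_mollify_le hε.1 (locallyIntegrable_chartPull hf) fun t htε => ?_
  obtain ⟨h1, h2, h3⟩ := ht t (htε.le.trans hε.2)
  rw [chartPull_of_mem h1, chartPull_of_mem h2]
  have hfin : metricEDist g x x' ^ a ≠ ⊤ := ENNReal.rpow_ne_top_of_nonneg ha.le hxx'.ne_top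
  have h4 : ENNReal.ofReal |f (e.symm (e x - t)) - f (e.symm (e x' - t))| ≤
      ENNReal.ofReal ((1 + δ) * D) * metricEDist g x x' ^ a :=
    calc _ ≤ ENNReal.ofReal D *
          metricEDist g (chartTranslate e t x) (chartTranslate e t x') ^ a := hfD _ _
      _ ≤ ENNReal.ofReal D * (ENNReal.ofReal (1 + δ') * metricEDist g x x') ^ a := by gcongr
      _ = ENNReal.ofReal ((1 + δ') ^ a * D) * metricEDist g x x' ^ a := by
          rw [ENNReal.mul_rpow_of_nonneg _ _ ha.le, ENNReal.ofReal_rpow_of_pos (by linarith),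
            ENNReal.ofReal_mul (by positivity), ← mul_assoc, mul_comm (ENNReal.ofReal D)]
      _ ≤ _ := by gcongr
  rw [← ENNReal.ofReal_toReal hfin, ← ENNReal.ofReal_mul (by positivity)] at h4
  exact (ENNReal.ofReal_le_ofReal_iff (by positivity)).1 h4

/-- A finite smooth partition of unity subordinate to charts, indexed by a finite set of centres
of charts. -/
lemma exists_finite_chart_partition (n : ℕ) (M : Type*) [TopologicalSpace M] [ChartedSpace (Eu n) M]
    [IsManifold (𝓡 n) ∞ M] [T2Space M] [CompactSpace M] :
    ∃ (s : Finset M) (χ : M → M → ℝ), (∀ c, ContMDiff (𝓡 n) 𝓘(ℝ, ℝ) ∞ (χ c)) ∧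
      (∀ c x, 0 ≤ χ c x) ∧ (∀ x, ∑ c ∈ s, χ c x = 1) ∧
      ∀ c, tsupport (χ c) ⊆ (chartAt (Eu n) c).source := by
  obtain ⟨P, hP⟩ := SmoothPartitionOfUnity.exists_isSubordinate_chartAt_source (𝓡 n) M
  have hfin := P.locallyFinite.finite_nonempty_of_compact
  refine ⟨hfin.toFinset, fun c => P c, fun c => (P c).contMDiff, P.nonneg, fun x => ?_, hP⟩
  have h1 := P.sum_eq_one (Set.mem_univ x)
  rwa [finsum_eq_sum_of_support_subset] at h1
  intro c hc
  simp only [Set.Finite.coe_toFinset, Set.mem_ofPred_eq]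
  exact ⟨x, hc⟩

end LocalHolder

/-! ### Gluing by a partition of unity -/

section Approximation

variable {n : ℕ} {M : Type*} [TopologicalSpace M] [ChartedSpace (Eu n) M] [IsManifold (𝓡 n) ∞ M]
  {e : OpenPartialHomeomorph M (Eu n)}

/-- `(a + b) ^ p` is at most `(1 + δ) a ^ p` plus a multiple of `b ^ p`. -/
lemma exists_add_rpow_le {p : ℝ} (hp : 0 < p) {δ : ℝ} (hδ : 0 < δ) :
    ∃ C : ℝ, 0 < C ∧ ∀ a b : ℝ, 0 ≤ a → 0 ≤ b → (a + b) ^ p ≤ (1 + δ) * a ^ p + C * b ^ p := by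
  obtain ⟨κ, hκ, hκp⟩ := exists_one_add_rpow_le p hδ
  refine ⟨(κ⁻¹ + 1) ^ p, by positivity, fun a b ha hb => ?_⟩
  rcases le_total b (κ * a) with h | h
  · calc (a + b) ^ p ≤ ((1 + κ) * a) ^ p := by gcongr; linarith
      _ = (1 + κ) ^ p * a ^ p := Real.mul_rpow (by positivity) ha
      _ ≤ (1 + δ) * a ^ p := by gcongr
      _ ≤ _ := le_add_of_nonneg_right (by positivity)
  · have h1 : a ≤ κ⁻¹ * b := by rwa [le_inv_mul_iff₀ hκ]
    calc (a + b) ^ p ≤ ((κ⁻¹ + 1) * b) ^ p := by gcongr; linarith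
      _ = (κ⁻¹ + 1) ^ p * b ^ p := Real.mul_rpow (by positivity) hb
      _ ≤ _ := le_add_of_nonneg_left (by positivity)

lemma sum_lintegral_le_lintegral_sum {ι X : Type*} [MeasurableSpace X] (μ : Measure X)
    (s : Finset ι) (F : ι → X → ℝ≥0∞) : ∑ i ∈ s, ∫⁻ x, F i x ∂μ ≤ ∫⁻ x, ∑ i ∈ s, F i x ∂μ := by
  classical
  induction s using Finset.induction_on with
  | empty => simp
  | insert i s hi ih =>
    simp only [Finset.sum_insert hi]
    exact (add_le_add_right ih _).trans (le_lintegral_add _ _)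

/-- The global mollification: mollifications in the preferred charts at the points of `s`, glued by
the partition of unity `χ c`, `c ∈ s`. The support of `χ c` should lie in the domain of the chart at
`c`, so that the values of the mollification off that domain play no role. -/
noncomputable def glueMollify (s : Finset M) (χ : M → M → ℝ) (ε : ℝ) (f : M → ℝ) (x : M) : ℝ :=
  ∑ c ∈ s, χ c x * chartMollify ε (chartAt (Eu n) c) f x

variable {s : Finset M} {χ : M → M → ℝ}

lemma contMDiff_glueMollify [CompactSpace M] (hχ : ∀ c, ContMDiff (𝓡 n) 𝓘(ℝ, ℝ) ∞ (χ c))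
    (hχe : ∀ c, tsupport (χ c) ⊆ (chartAt (Eu n) c).source) (ε : ℝ) {f : M → ℝ}
    (hf : Continuous f) : ContMDiff (𝓡 n) 𝓘(ℝ, ℝ) ∞ (glueMollify (n := n) s χ ε f) := by
  refine contMDiff_finsetSum fun c _ => contMDiff_of_tsupport fun x hx => ?_
  have hx' : x ∈ tsupport (χ c) := tsupport_mul_subset_left hx
  exact (hχ c x).mul (contMDiffAt_chartMollify ε (chart_mem_atlas _ c) hf (hχe c hx'))

lemma glueMollify_sub (h1 : ∀ x, ∑ c ∈ s, χ c x = 1) (ε : ℝ) (f : M → ℝ) (x : M) :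
    glueMollify (n := n) s χ ε f x - f x =
      ∑ c ∈ s, χ c x * (chartMollify ε (chartAt (Eu n) c) f x - f x) := by
  simp only [mul_sub, Finset.sum_sub_distrib, ← Finset.sum_mul, h1, one_mul, glueMollify]

lemma abs_glueMollify_sub_le (h0 : ∀ c x, 0 ≤ χ c x) (h1 : ∀ x, ∑ c ∈ s, χ c x = 1) {ε η : ℝ}
    {f : M → ℝ} {x : M}
    (hc : ∀ c ∈ s, x ∈ tsupport (χ c) → |chartMollify ε (chartAt (Eu n) c) f x - f x| ≤ η) :
    |glueMollify (n := n) s χ ε f x - f x| ≤ η := by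
  rw [glueMollify_sub h1]
  calc _ ≤ ∑ c ∈ s, |χ c x * (chartMollify ε (chartAt (Eu n) c) f x - f x)| :=
        Finset.abs_sum_le_sum_abs _ _
    _ ≤ ∑ c ∈ s, χ c x * η := by
        refine Finset.sum_le_sum fun c hcs => ?_
        rw [abs_mul, abs_of_nonneg (h0 c x)]
        by_cases hx : x ∈ tsupport (χ c)
        · exact mul_le_mul_of_nonneg_left (hc c hcs hx) (h0 c x)
        · simp [image_eq_zero_of_notMem_tsupport hx]
    _ = η := by rw [← Finset.sum_mul, h1, one_mul]

/-- The differential of the glued mollifications: since the differentials of the partition of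
unity add up to zero, `f` may be subtracted in the terms where they occur. -/
lemma gradNorm_differential_glueMollify_le [CompactSpace M] (g : ContMetric n M)
    (hχ : ∀ c, ContMDiff (𝓡 n) 𝓘(ℝ, ℝ) ∞ (χ c)) (h0 : ∀ c x, 0 ≤ χ c x)
    (h1 : ∀ x, ∑ c ∈ s, χ c x = 1)
    (hχe : ∀ c, tsupport (χ c) ⊆ (chartAt (Eu n) c).source) {ε η Λ : ℝ} (hη : 0 ≤ η)
    {f : M → ℝ} (hf : Continuous f) {x : M}
    (hΛ : ∀ c ∈ s, gradNorm g x (differential (χ c) x) ≤ Λ)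
    (hc : ∀ c ∈ s, x ∈ tsupport (χ c) → |chartMollify ε (chartAt (Eu n) c) f x - f x| ≤ η) :
    gradNorm g x (differential (glueMollify (n := n) s χ ε f) x) ≤
      (∑ c ∈ s, χ c x * gradNorm g x (differential (chartMollify ε (chartAt (Eu n) c) f) x)) +
        η * (s.card * Λ) := by
  have hoff : ∀ c, x ∉ tsupport (χ c) → χ c =ᶠ[𝓝 x] fun _ => 0 := fun c hx =>
    notMem_tsupport_iff_eventuallyEq.1 hx
  have hterm : ∀ c ∈ s,
      MDifferentiableAt (𝓡 n) 𝓘(ℝ, ℝ) (fun x => χ c x * chartMollify ε (chartAt (Eu n) c) f x) x ∧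
      differential (n := n) (fun x => χ c x * chartMollify ε (chartAt (Eu n) c) f x) x =
        χ c x • differential (chartMollify ε (chartAt (Eu n) c) f) x +
          chartMollify ε (chartAt (Eu n) c) f x • differential (χ c) x := by
    intro c _
    by_cases hx : x ∈ tsupport (χ c)
    · have hF := (contMDiffAt_chartMollify ε (chart_mem_atlas _ c) hf
        (hχe c hx)).mdifferentiableAt (by simp)
      have hX := mdifferentiableAt_of_contMDiff (hχ c) x
      exact ⟨(hX.hasMFDerivAt.mul hF.hasMFDerivAt).mdifferentiableAt, differential_mul hX hF⟩
    · have hz : (fun x => χ c x * chartMollify ε (chartAt (Eu n) c) f x) =ᶠ[𝓝 x] fun _ => 0 := by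
        filter_upwards [hoff c hx] with y hy
        simp [hy]
      refine ⟨hz.mdifferentiableAt_iff.2 mdifferentiableAt_const, ?_⟩
      rw [differential_congr (n := n) hz, differential_congr (n := n) (hoff c hx),
        differential_const, image_eq_zero_of_notMem_tsupport hx]
      simp
  have hsum0 : ∑ c ∈ s, differential (n := n) (χ c) x = 0 := by
    rw [← (mdifferentiableAt_and_differential_sum s
      fun c _ => mdifferentiableAt_of_contMDiff (hχ c) x).2, funext h1]
    exact differential_const 1 x
  have hd : differential (n := n) (glueMollify (n := n) s χ ε f) x =
      ∑ c ∈ s, (χ c x • differential (chartMollify ε (chartAt (Eu n) c) f) x +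
        (chartMollify ε (chartAt (Eu n) c) f x - f x) • differential (χ c) x) := by
    have h2 : ∑ c ∈ s, f x • differential (n := n) (χ c) x = 0 := by
      rw [← Finset.smul_sum, hsum0, smul_zero]
    unfold glueMollify
    rw [(mdifferentiableAt_and_differential_sum s fun c hc => (hterm c hc).1).2,
      Finset.sum_congr rfl fun c hc => (hterm c hc).2]
    rw [Finset.sum_add_distrib, Finset.sum_add_distrib]
    congr 1
    have h3 : ∀ c ∈ s, (chartMollify ε (chartAt (Eu n) c) f x - f x) • differential (n := n) (χ c) x =
        chartMollify ε (chartAt (Eu n) c) f x • differential (χ c) x -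
          f x • differential (χ c) x := fun c _ =>
      ContinuousLinearMap.ext fun v => sub_mul _ _ (differential (χ c) x v)
    rw [Finset.sum_congr rfl h3, Finset.sum_sub_distrib, h2, sub_zero]
  rw [hd]
  refine (gradNorm_sum_le _ _ _ _).trans ?_
  have hcard : η * (s.card * Λ) = ∑ c ∈ s, η * Λ := by
    rw [Finset.sum_const, nsmul_eq_mul]; ring
  rw [hcard, ← Finset.sum_add_distrib]
  refine Finset.sum_le_sum fun c hcs => (gradNorm_add_le _ _ _ _).trans ?_
  rw [gradNorm_smul, gradNorm_smul, abs_of_nonneg (h0 c x)]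
  refine add_le_add le_rfl ?_
  by_cases hx : x ∈ tsupport (χ c)
  · exact mul_le_mul (hc c hcs hx) (hΛ c hcs) (gradNorm_nonneg _ _ _) hη
  · rw [differential_congr (n := n) (hoff c hx), differential_const, gradNorm_zero, mul_zero]
    exact mul_nonneg hη ((gradNorm_nonneg _ _ _).trans (hΛ c hcs))

/-- The Hölder estimate for nearby points. As the differences `χ c x - χ c x'` add up to zero, they
may be multiplied by `F x' - f x'`, with `F` the mollification in the chart at `c`, instead of
`F x'`. -/
lemma abs_glueMollify_sub_glueMollify_le (h0 : ∀ c x, 0 ≤ χ c x) (h1 : ∀ x, ∑ c ∈ s, χ c x = 1)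
    {ε η A B : ℝ} {f : M → ℝ} {x x' : M}
    (hF : ∀ c ∈ s, x ∈ tsupport (χ c) →
      |chartMollify ε (chartAt (Eu n) c) f x - chartMollify ε (chartAt (Eu n) c) f x'| ≤ A)
    (hB : ∀ c ∈ s, |χ c x - χ c x'| ≤ B)
    (hc : ∀ c ∈ s, x ∈ tsupport (χ c) ∨ x' ∈ tsupport (χ c) →
      |chartMollify ε (chartAt (Eu n) c) f x' - f x'| ≤ η) (hη : 0 ≤ η) :
    |glueMollify (n := n) s χ ε f x - glueMollify (n := n) s χ ε f x'| ≤ A + s.card * B * η := by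
  have key : glueMollify (n := n) s χ ε f x - glueMollify (n := n) s χ ε f x' =
      ∑ c ∈ s, (χ c x * (chartMollify ε (chartAt (Eu n) c) f x -
          chartMollify ε (chartAt (Eu n) c) f x') +
        (χ c x - χ c x') * (chartMollify ε (chartAt (Eu n) c) f x' - f x')) := by
    have h2 : ∑ c ∈ s, (χ c x - χ c x') * f x' = 0 := by
      rw [← Finset.sum_mul, Finset.sum_sub_distrib, h1, h1, sub_self, zero_mul]
    rw [← add_zero (∑ c ∈ s, _), ← h2, glueMollify, glueMollify, ← Finset.sum_sub_distrib,
      ← Finset.sum_add_distrib]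
    exact Finset.sum_congr rfl fun c _ => by ring
  have hsum : A + s.card * B * η = ∑ c ∈ s, (χ c x * A + B * η) := by
    rw [Finset.sum_add_distrib, ← Finset.sum_mul, h1, Finset.sum_const, nsmul_eq_mul]; ring
  rw [key, hsum]
  refine (Finset.abs_sum_le_sum_abs _ _).trans (Finset.sum_le_sum fun c hcs => ?_)
  refine (abs_add_le _ _).trans (add_le_add ?_ ?_)
  · rw [abs_mul, abs_of_nonneg (h0 c x)]
    by_cases hx : x ∈ tsupport (χ c)
    · exact mul_le_mul_of_nonneg_left (hF c hcs hx) (h0 c x)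
    · simp [image_eq_zero_of_notMem_tsupport hx]
  · rw [abs_mul]
    by_cases hx : x ∈ tsupport (χ c) ∨ x' ∈ tsupport (χ c)
    · exact mul_le_mul (hB c hcs) (hc c hcs hx) (abs_nonneg _) ((abs_nonneg _).trans (hB c hcs))
    · push Not at hx
      rw [image_eq_zero_of_notMem_tsupport hx.1, image_eq_zero_of_notMem_tsupport hx.2, sub_self,
        abs_zero, zero_mul]
      exact mul_nonneg ((abs_nonneg _).trans (hB c hcs)) hη

end Approximation

/-! ### Smooth approximation of admissible functions -/

section Density

variable {n : ℕ} {M : Type*} [TopologicalSpace M] [ChartedSpace (Eu n) M] [IsManifold (𝓡 n) ∞ M]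
  {e : OpenPartialHomeomorph M (Eu n)} [MeasurableSpace M] [BorelSpace M]
  {s : Finset M} {χ : M → M → ℝ}

lemma aemeasurable_weighted_energy [CompactSpace M] (g : ContMetric n M) (p ε : ℝ)
    (he : e ∈ atlas (Eu n) M) {f χ : M → ℝ} (hf : Continuous f) (hχ : Continuous χ)
    (hχe : tsupport χ ⊆ e.source) :
    AEMeasurable (fun x => ENNReal.ofReal (χ x) *
      ENNReal.ofReal (gradNorm g x (differential (chartMollify ε e f) x)) ^ p) (vol g) := by
  have hc : ContinuousOn (fun x => gradNorm g x (differential (chartMollify ε e f) x)) e.source := by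
    refine ((continuousOn_gradNorm_chartMollify g ε he hf).comp e.continuousOn
      e.mapsTo).congr fun x hx => ?_
    exact (congrArg (fun z => gradNorm g z (differential (chartMollify ε e f) z))
      (e.left_inv hx)).symm
  have h1 := hχ.continuousOn.aemeasurable (μ := vol g) e.open_source.measurableSet
  have h2 := hc.aemeasurable (μ := vol g) e.open_source.measurableSet
  have h3 := h1.ennreal_ofReal.mul (h2.ennreal_ofReal.pow_const p)
  rw [← aemeasurable_indicator_iff e.open_source.measurableSet] at h3
  refine h3.congr (Filter.Eventually.of_forall fun x => ?_)
  by_cases hx : x ∈ e.source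
  · simp [hx]
  · simp [hx, image_eq_zero_of_notMem_tsupport fun h => hx (hχe h)]

/-- The energy of the glued mollifications, in terms of the energies in the charts. The main term
is estimated by the convexity of `z ↦ z ^ p`. -/
lemma lintegral_energy_glueMollify_le [CompactSpace M] (g : ContMetric n M) {p : ℝ} (hp : 1 ≤ p)
    (hχ : ∀ c, ContMDiff (𝓡 n) 𝓘(ℝ, ℝ) ∞ (χ c)) (h0 : ∀ c x, 0 ≤ χ c x)
    (h1 : ∀ x, ∑ c ∈ s, χ c x = 1)
    (hχe : ∀ c, tsupport (χ c) ⊆ (chartAt (Eu n) c).source) {ε b κ C : ℝ} (hb : 0 ≤ b)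
    (hκ : 0 ≤ κ) (hC : 0 ≤ C)
    (hCp : ∀ a b : ℝ, 0 ≤ a → 0 ≤ b → (a + b) ^ p ≤ (1 + κ) * a ^ p + C * b ^ p)
    {f : M → ℝ} (hf : Continuous f)
    (hpt : ∀ x, gradNorm g x (differential (glueMollify (n := n) s χ ε f) x) ≤
      (∑ c ∈ s, χ c x * gradNorm g x (differential (chartMollify ε (chartAt (Eu n) c) f) x)) + b)
    {A : M → ℝ≥0∞} (hA : ∫⁻ x, A x ∂(vol g) ≤ 1)
    (hen : ∀ c ∈ s, ∫⁻ x, ENNReal.ofReal (χ c x) * ENNReal.ofReal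
          (gradNorm g x (differential (chartMollify ε (chartAt (Eu n) c) f) x)) ^ p ∂(vol g) ≤
        ENNReal.ofReal (1 + κ) * (∫⁻ x, ENNReal.ofReal (χ c x) * A x ∂(vol g) +
            ENNReal.ofReal κ * ∫⁻ x, A x ∂(vol g))) :
    ∫⁻ x, ENNReal.ofReal
        (gradNorm g x (differential (glueMollify (n := n) s χ ε f) x)) ^ p ∂(vol g) ≤
      ENNReal.ofReal ((1 + κ) * ((1 + κ) * (1 + s.card * κ)) + C * b ^ p * (vol g).real Set.univ) := by
  have hp0 : 0 ≤ p := by linarith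
  have : IsFiniteMeasure (vol g) := isFiniteMeasure_vol g
  have hsum1 : ∀ x, ∑ c ∈ s, ENNReal.ofReal (χ c x) = 1 := fun x => by
    rw [← ENNReal.ofReal_sum_of_nonneg fun c _ => h0 c x, h1, ENNReal.ofReal_one]
  obtain ⟨u, hu⟩ : ∃ u : M → M → ℝ, ∀ c x,
      u c x = gradNorm g x (differential (chartMollify ε (chartAt (Eu n) c) f) x) :=
    ⟨_, fun _ _ => rfl⟩
  simp only [← hu] at hpt hen
  have hu0 : ∀ c x, 0 ≤ u c x := fun c x => by rw [hu]; exact gradNorm_nonneg _ _ _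
  have hm : ∀ c ∈ s, AEMeasurable (fun x => ENNReal.ofReal (χ c x) *
      ENNReal.ofReal (u c x) ^ p) (vol g) := fun c _ => by
    simp only [hu]
    exact aemeasurable_weighted_energy g p ε (chart_mem_atlas _ c) hf (hχ c).continuous (hχe c)
  have hpw : ∀ x, ENNReal.ofReal
      (gradNorm g x (differential (glueMollify (n := n) s χ ε f) x)) ^ p ≤
      ENNReal.ofReal (1 + κ) * ∑ c ∈ s, ENNReal.ofReal (χ c x) * ENNReal.ofReal (u c x) ^ p +
        ENNReal.ofReal (C * b ^ p) := by
    intro x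
    have hs0 : 0 ≤ ∑ c ∈ s, χ c x * u c x :=
      Finset.sum_nonneg fun c _ => mul_nonneg (h0 c x) (hu0 c x)
    calc _ ≤ ENNReal.ofReal ((∑ c ∈ s, χ c x * u c x) + b) ^ p := by gcongr; exact hpt x
      _ = ENNReal.ofReal (((∑ c ∈ s, χ c x * u c x) + b) ^ p) :=
          ENNReal.ofReal_rpow_of_nonneg (by positivity) hp0
      _ ≤ ENNReal.ofReal ((1 + κ) * (∑ c ∈ s, χ c x * u c x) ^ p + C * b ^ p) :=
          ENNReal.ofReal_le_ofReal (hCp _ _ hs0 hb)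
      _ = ENNReal.ofReal (1 + κ) * (∑ c ∈ s, ENNReal.ofReal (χ c x) * ENNReal.ofReal (u c x)) ^ p +
            ENNReal.ofReal (C * b ^ p) := by
          rw [ENNReal.ofReal_add (by positivity) (by positivity),
            ENNReal.ofReal_mul (by positivity), ← ENNReal.ofReal_rpow_of_nonneg hs0 hp0,
            ENNReal.ofReal_sum_of_nonneg fun c _ => mul_nonneg (h0 c x) (hu0 c x)]
          simp only [ENNReal.ofReal_mul (h0 _ x)]
      _ ≤ _ := by
          gcongr
          exact ENNReal.rpow_arith_mean_le_arith_mean_rpow s _ _ (hsum1 x) hp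
  calc _ ≤ ∫⁻ x, ENNReal.ofReal (1 + κ) *
          (∑ c ∈ s, ENNReal.ofReal (χ c x) * ENNReal.ofReal (u c x) ^ p) +
          ENNReal.ofReal (C * b ^ p) ∂(vol g) := lintegral_mono hpw
    _ = ENNReal.ofReal (1 + κ) *
          (∑ c ∈ s, ∫⁻ x, ENNReal.ofReal (χ c x) * ENNReal.ofReal (u c x) ^ p ∂(vol g)) +
          ENNReal.ofReal (C * b ^ p) * vol g Set.univ := by
        rw [lintegral_add_right' _ aemeasurable_const, lintegral_const,
          lintegral_const_mul' _ _ ENNReal.ofReal_ne_top, lintegral_finsetSum' _ hm]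
    _ ≤ ENNReal.ofReal (1 + κ) * (∑ c ∈ s, ENNReal.ofReal (1 + κ) *
          (∫⁻ x, ENNReal.ofReal (χ c x) * A x ∂(vol g) + ENNReal.ofReal κ * 1)) +
          ENNReal.ofReal (C * b ^ p) * vol g Set.univ := by
        gcongr with c hc
        exact (hen c hc).trans (by gcongr)
    _ = ENNReal.ofReal (1 + κ) * (ENNReal.ofReal (1 + κ) *
          (∑ c ∈ s, ∫⁻ x, ENNReal.ofReal (χ c x) * A x ∂(vol g) + s.card * ENNReal.ofReal κ)) +
          ENNReal.ofReal (C * b ^ p) * vol g Set.univ := by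
        rw [← Finset.mul_sum, Finset.sum_add_distrib, Finset.sum_const, nsmul_eq_mul, mul_one]
    _ ≤ ENNReal.ofReal (1 + κ) * (ENNReal.ofReal (1 + κ) * (1 + s.card * ENNReal.ofReal κ)) +
          ENNReal.ofReal (C * b ^ p) * vol g Set.univ := by
        gcongr
        refine (sum_lintegral_le_lintegral_sum _ _ _).trans ?_
        simpa only [← Finset.sum_mul, hsum1, one_mul] using hA
    _ = _ := by
        have e1 : ENNReal.ofReal (1 + s.card * κ) = 1 + s.card * ENNReal.ofReal κ := by
          rw [ENNReal.ofReal_add zero_le_one (by positivity), ENNReal.ofReal_one,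
            ENNReal.ofReal_mul (by positivity), ENNReal.ofReal_natCast]
        have e2 : ENNReal.ofReal (C * b ^ p * (vol g).real Set.univ) =
            ENNReal.ofReal (C * b ^ p) * vol g Set.univ := by
          rw [ENNReal.ofReal_mul (by positivity), ofReal_measureReal]
        have hκ1 : 0 ≤ 1 + κ := by positivity
        have e3 : 0 ≤ (1 + κ) * ((1 + κ) * (1 + s.card * κ)) := by positivity
        rw [ENNReal.ofReal_add e3 (by positivity), ENNReal.ofReal_mul hκ1,
          ENNReal.ofReal_mul hκ1, e1, e2]

/-- Smooth functions are dense: an admissible function for `g` is uniformly approximated by smooth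
functions whose Hölder constant and energy are larger at most by small factors. -/
theorem exists_smooth_approximation [T2Space M] [CompactSpace M] (g : ContMetric n M) {p a D : ℝ}
    (hp : 1 < p) (ha : 0 < a) (ha1 : a ≤ 1) (hD : 0 < D) {f : M → ℝ} (hfD : HolderBound g a D f)
    {α : ∀ x : M, TangentSpace (𝓡 n) x →L[ℝ] ℝ} (hα : IsWeakDifferential f α)
    (hE : ∫⁻ x, ENNReal.ofReal (gradNorm g x (α x)) ^ p ∂(vol g) ≤ 1) {δ : ℝ} (hδ : 0 < δ) :
    ∃ h : M → ℝ, ContMDiff (𝓡 n) 𝓘(ℝ, ℝ) ∞ h ∧ HolderBound g a ((1 + δ) * D) h ∧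
      ∫⁻ x, ENNReal.ofReal (gradNorm g x (differential h x)) ^ p ∂(vol g) ≤ ENNReal.ofReal (1 + δ) ∧
      ∀ x, |h x - f x| ≤ δ := by
  have hp0 : 0 < p := by linarith
  have hf : Continuous f := continuous_of_holder g ha hfD
  obtain ⟨s, χ, hχ, h0, h1, hχe⟩ := exists_finite_chart_partition n M
  -- Lipschitz constants of the partition of unity
  choose Λ' hΛ'0 hΛ'g hΛ'd using fun c => exists_lipschitz_of_contMDiff g (hχ c)
  obtain ⟨Λ, hΛ0, hΛg, hΛd⟩ : ∃ Λ : ℝ, 0 ≤ Λ ∧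
      (∀ c ∈ s, ∀ x, gradNorm g x (differential (χ c) x) ≤ Λ) ∧
      ∀ c ∈ s, ∀ x x', ENNReal.ofReal |χ c x - χ c x'| ≤ ENNReal.ofReal Λ * metricEDist g x x' := by
    have hle : ∀ c ∈ s, Λ' c ≤ ∑ c ∈ s, Λ' c := fun c hc =>
      Finset.single_le_sum (f := Λ') (fun c _ => (hΛ'0 c).le) hc
    refine ⟨∑ c ∈ s, Λ' c, Finset.sum_nonneg fun c _ => (hΛ'0 c).le,
      fun c hc x => (hΛ'g c x).trans (hle c hc), fun c hc x x' => (hΛ'd c x x').trans ?_⟩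
    gcongr
    exact hle c hc
  -- the scale below which two points count as near to each other
  choose r' hr'0 hr' using fun c => exists_eventually_holder_chartMollify g
    (chart_mem_atlas (Eu n) c) ha hD hf hfD (isClosed_tsupport (χ c)).isCompact (hχe c)
    (half_pos hδ)
  obtain ⟨r, hr0, hr1, hrr⟩ : ∃ r : ℝ, 0 < r ∧ r ≤ 1 ∧ ∀ c ∈ s, r ≤ r' c := by
    have h : ∀ᶠ r in 𝓝[>] (0 : ℝ), ∀ c ∈ s, r ≤ r' c :=
      (Filter.eventually_all_finset s).2 fun c _ =>
        ((eventually_lt_nhds (hr'0 c)).filter_mono nhdsWithin_le_nhds).mono fun _ => le_of_lt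
    obtain ⟨r, hr, hr'⟩ := (h.and (Ioc_mem_nhdsGT one_pos)).exists
    exact ⟨r, hr'.1, hr'.2, hr⟩
  have hN : (0 : ℝ) ≤ s.card := by positivity
  obtain ⟨κ, hκ0, hκ⟩ : ∃ κ : ℝ, 0 < κ ∧ (1 + κ) * ((1 + κ) * (1 + s.card * κ)) ≤ 1 + δ / 2 := by
    have hc : ContinuousAt (fun κ : ℝ => (1 + κ) * ((1 + κ) * (1 + s.card * κ))) 0 := by fun_prop
    have h := hc.eventually_lt (continuousAt_const (y := 1 + δ / 2)) (by simpa using hδ)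
    obtain ⟨κ, hκ, hκ0⟩ := ((h.filter_mono (nhdsWithin_le_nhds (s := Set.Ioi 0))).and
      self_mem_nhdsWithin).exists
    exact ⟨κ, hκ0, hκ.le⟩
  obtain ⟨C, hC0, hC⟩ := exists_add_rpow_le hp0 hκ0
  -- the uniform distance between `f` and its mollifications
  obtain ⟨η, hη0, hη1, hη2, hη3, hη4⟩ : ∃ η : ℝ, 0 < η ∧ η ≤ δ ∧ 2 * η ≤ δ * D * r ^ a ∧
      s.card * Λ * η ≤ δ / 2 * D ∧
      C * (η * (s.card * Λ)) ^ p * (vol g).real Set.univ ≤ δ / 2 := by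
    have e1 : ∀ᶠ η in 𝓝 (0 : ℝ), η < δ := eventually_lt_nhds hδ
    have e2 : ∀ᶠ η in 𝓝 (0 : ℝ), 2 * η < δ * D * r ^ a :=
      ContinuousAt.eventually_lt (by fun_prop) continuousAt_const (by simp; positivity)
    have e3 : ∀ᶠ η in 𝓝 (0 : ℝ), s.card * Λ * η < δ / 2 * D :=
      ContinuousAt.eventually_lt (by fun_prop) continuousAt_const (by simp; positivity)
    have e4 : ∀ᶠ η in 𝓝 (0 : ℝ),
        C * (η * (s.card * Λ)) ^ p * (vol g).real Set.univ < δ / 2 := by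
      refine ContinuousAt.eventually_lt ?_ continuousAt_const
        (by simp [Real.zero_rpow hp0.ne']; positivity)
      exact (continuousAt_const.mul (ContinuousAt.rpow_const (by fun_prop)
        (Or.inr hp0.le))).mul continuousAt_const
    obtain ⟨η, ⟨h1, h2, h3, h4⟩, h5⟩ := (((e1.and (e2.and (e3.and e4))).filter_mono
      (nhdsWithin_le_nhds (s := Set.Ioi 0))).and self_mem_nhdsWithin).exists
    exact ⟨η, h5, h1.le, h2.le, h3.le, h4.le⟩
  have hev1 := (Filter.eventually_all_finset s).2 fun c (_ : c ∈ s) => hr' c η hη0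
  have hev2 := (Filter.eventually_all_finset s).2 fun c (_ : c ∈ s) =>
    eventually_energy_chartMollify_le g (chart_mem_atlas (Eu n) c) hp hf hα (hχ c).continuous
      (h0 c) (hχe c) hκ0
  obtain ⟨ε, hloc, hen⟩ := (hev1.and hev2).exists
  have hnear : ∀ c ∈ s, ∀ x ∈ tsupport (χ c), ∀ x', metricEDist g x x' < ENNReal.ofReal r →
      |chartMollify ε (chartAt (Eu n) c) f x' - f x'| ≤ η ∧
      |chartMollify ε (chartAt (Eu n) c) f x - chartMollify ε (chartAt (Eu n) c) f x'| ≤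
        (1 + δ / 2) * D * (metricEDist g x x' ^ a).toReal := fun c hc x hx x' h =>
    hloc c hc x hx x' (h.trans_le (ENNReal.ofReal_le_ofReal (hrr c hc)))
  have hclose : ∀ c ∈ s, ∀ x ∈ tsupport (χ c),
      |chartMollify ε (chartAt (Eu n) c) f x - f x| ≤ η := fun c hc x hx =>
    (hnear c hc x hx x (by rw [metricEDist_self]; simpa using hr0)).1
  have hunif : ∀ x, |glueMollify (n := n) s χ ε f x - f x| ≤ η := fun x =>
    abs_glueMollify_sub_le h0 h1 fun c hc hx => hclose c hc x hx
  refine ⟨glueMollify (n := n) s χ ε f, contMDiff_glueMollify hχ hχe ε hf, fun x x' => ?_, ?_,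
    fun x => (hunif x).trans hη1⟩
  · rcases lt_or_ge (metricEDist g x x') (ENNReal.ofReal r) with hd | hd
    · have hfin : metricEDist g x x' ^ a ≠ ⊤ := ENNReal.rpow_ne_top_of_nonneg ha.le hd.ne_top
      -- at distance at most one, `d ≤ d ^ a`
      have hda : metricEDist g x x' ≤ metricEDist g x x' ^ a := by
        have hd1 : metricEDist g x x' ≤ 1 :=
          hd.le.trans (by rw [← ENNReal.ofReal_one]; exact ENNReal.ofReal_le_ofReal hr1)
        simpa using ENNReal.rpow_le_rpow_of_exponent_ge hd1 ha1
      obtain ⟨d, hd0, hdd⟩ : ∃ d : ℝ, 0 ≤ d ∧ metricEDist g x x' ^ a = ENNReal.ofReal d :=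
        ⟨_, ENNReal.toReal_nonneg, (ENNReal.ofReal_toReal hfin).symm⟩
      rw [hdd, ← ENNReal.ofReal_mul (by positivity)]
      refine ENNReal.ofReal_le_ofReal ?_
      have h2 := abs_glueMollify_sub_glueMollify_le (n := n) (s := s) (χ := χ) (ε := ε) (η := η)
        (A := (1 + δ / 2) * D * d) (B := Λ * d) (f := f) (x := x) (x' := x') h0 h1
        (fun c hc hx => by
          have := (hnear c hc x hx x' hd).2
          rwa [hdd, ENNReal.toReal_ofReal hd0] at this)
        (fun c hc => by
          have h3 := (hΛd c hc x x').trans (mul_le_mul_right hda _)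
          rw [hdd, ← ENNReal.ofReal_mul hΛ0] at h3
          exact (ENNReal.ofReal_le_ofReal_iff (by positivity)).1 h3)
        (fun c hc hx => hx.elim (fun hx => (hnear c hc x hx x' hd).1) (hclose c hc x')) hη0.le
      refine h2.trans ?_
      nlinarith [mul_le_mul_of_nonneg_right hη3 hd0]
    · have h2 : |glueMollify (n := n) s χ ε f x - glueMollify (n := n) s χ ε f x'| ≤
          |f x - f x'| + δ * D * r ^ a := by
        have h3 := hunif x
        have h4 := hunif x'
        rw [abs_le] at h3 h4
        rw [abs_le]
        constructor <;> cases abs_cases (f x - f x') <;> linarith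
      calc _ ≤ ENNReal.ofReal (|f x - f x'| + δ * D * r ^ a) := ENNReal.ofReal_le_ofReal h2
        _ = ENNReal.ofReal |f x - f x'| + ENNReal.ofReal (δ * D) * ENNReal.ofReal r ^ a := by
            rw [ENNReal.ofReal_add (abs_nonneg _) (by positivity),
              ENNReal.ofReal_mul (by positivity), ENNReal.ofReal_rpow_of_pos hr0]
        _ ≤ ENNReal.ofReal D * metricEDist g x x' ^ a +
            ENNReal.ofReal (δ * D) * metricEDist g x x' ^ a := by
            gcongr
            exact hfD x x'
        _ = _ := by
            rw [← add_mul, ← ENNReal.ofReal_add hD.le (by positivity)]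
            congr 2; ring
  · refine (lintegral_energy_glueMollify_le g hp.le hχ h0 h1 hχe (by positivity) hκ0.le hC0.le hC hf
      (fun x => gradNorm_differential_glueMollify_le g hχ h0 h1 hχe hη0.le hf
        (fun c hc => hΛg c hc x) fun c hc hx => hclose c hc x hx) hE hen).trans ?_
    refine ENNReal.ofReal_le_ofReal ?_
    linarith

end Density

/-! ### Lower semicontinuity of the modified distance -/

section Semicontinuity

variable {n : ℕ} {M : Type*} [TopologicalSpace M] [ChartedSpace (Eu n) M] [IsManifold (𝓡 n) ∞ M]
  [MeasurableSpace M] [BorelSpace M]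

/-- A smooth function with almost the right Hölder constant and energy is admissible after division
by a constant close to one. -/
lemma admissible_const_mul (g g₀ : ContMetric n M) {p D δ : ℝ} (hp : 1 < p) (hn : (n : ℝ) < p)
    (hD : 0 < D) (hδ : 0 < δ) {h : M → ℝ} (hh : ContMDiff (𝓡 n) 𝓘(ℝ, ℝ) ∞ h)
    (hH : HolderBound g₀ ((p - n) / p) ((1 + δ) * D) h)
    (hE : ∫⁻ x, ENNReal.ofReal (gradNorm g x (differential h x)) ^ p ∂(vol g) ≤
      ENNReal.ofReal (1 + δ)) :
    Admissible g g₀ p D fun x => (1 + δ)⁻¹ * h x := by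
  have hp0 : 0 < p := by linarith
  have hc0 : 0 < (1 + δ)⁻¹ := by positivity
  have hc1 : (1 + δ)⁻¹ ≤ 1 := inv_le_one_of_one_le₀ (by linarith)
  have hc : (1 + δ)⁻¹ * (1 + δ) = 1 := inv_mul_cancel₀ (by positivity)
  refine ⟨(holderSeminorm_le_iff g₀ hp0 hn hD _).2 fun x y => ?_, _,
    isWeakDifferential_differential (contMDiff_const.mul hh), ?_⟩
  · rw [← mul_sub, abs_mul, abs_of_pos hc0, ENNReal.ofReal_mul hc0.le]
    calc _ ≤ ENNReal.ofReal (1 + δ)⁻¹ *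
          (ENNReal.ofReal ((1 + δ) * D) * metricEDist g₀ x y ^ ((p - n) / p)) := by
          gcongr; exact hH x y
      _ = _ := by rw [← mul_assoc, ← ENNReal.ofReal_mul hc0.le, ← mul_assoc, hc, one_mul]
  · have hd : ∀ x, differential (n := n) (fun x => (1 + δ)⁻¹ * h x) x =
        (1 + δ)⁻¹ • differential h x := fun x =>
      differential_const_mul _ (mdifferentiableAt_of_contMDiff hh x)
    simp only [hd, gradNorm_smul, abs_of_pos hc0, ENNReal.ofReal_mul hc0.le,
      ENNReal.mul_rpow_of_nonneg _ _ hp0.le]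
    rw [lintegral_const_mul' _ _ (ENNReal.rpow_ne_top_of_nonneg hp0.le ENNReal.ofReal_ne_top)]
    calc _ ≤ ENNReal.ofReal (1 + δ)⁻¹ ^ (1 : ℝ) * ENNReal.ofReal (1 + δ) :=
          mul_le_mul' (ENNReal.rpow_le_rpow_of_exponent_ge (ENNReal.ofReal_le_one.2 hc1) hp.le) hE
      _ = 1 := by rw [ENNReal.rpow_one, ← ENNReal.ofReal_mul hc0.le, hc, ENNReal.ofReal_one]

/-- A connected manifold of dimension zero is a point. -/
lemma subsingleton_of_dim_eq_zero (hn : n = 0) [PreconnectedSpace M] : Subsingleton M := by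
  subst hn
  have : DiscreteTopology M := ChartedSpace.discreteTopology (Eu 0) M
  exact PreconnectedSpace.trivial_of_discrete

/-- For a function admissible for `g₀`, the lower limit of the distances of the `g_j` is at least
the difference of the values, up to an arbitrarily small error. -/
lemma le_liminf_modDist_of_admissible [T2Space M] [CompactSpace M] (hn0 : 0 < n)
    (g₀ : ContMetric n M) (g : ℕ → ContMetric n M) {p D : ℝ} (hn : (n : ℝ) < p) (hD : 0 < D)
    (hinv : Tendsto (fun j => ∫⁻ x, ENNReal.ofReal (invMetricDiffNorm g₀ (g j) x) ^
      ((n : ℝ) * (p - 1) / 2) ∂(vol g₀)) atTop (𝓝 0))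
    (hbd : ∃ C : ℝ≥0, ∀ j, ∫⁻ x, ENNReal.ofReal (metricNorm g₀ (g j) x) ^ ((n : ℝ) / 2)
      ∂(vol g₀) ≤ (C : ℝ≥0∞))
    {f : M → ℝ} (hf : Admissible g₀ g₀ p D f) {δ : ℝ} (hδ : 0 < δ) (x₁ x₂ : M) :
    ENNReal.ofReal ((1 + δ)⁻¹ * (|f x₁ - f x₂| - δ)) ≤
      liminf (fun j => modDist (g j) g₀ p D x₁ x₂) atTop := by
  have hn1 : (1 : ℝ) ≤ n := by exact_mod_cast hn0
  have hp : 1 < p := by linarith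
  have hp0 : 0 < p := by linarith
  obtain ⟨hH, α, hα, hE⟩ := hf
  obtain ⟨h, hh, hhH, hhE, hhf⟩ := exists_smooth_approximation g₀ hp
    (div_pos (by linarith : 0 < p - n) hp0) ((div_le_one hp0).2 (by linarith)) hD
    ((holderSeminorm_le_iff g₀ hp0 hn hD f).1 hH) hα hE (half_pos hδ)
  have hc := continuous_gradNorm_differential g₀ hh
  obtain ⟨L, hL⟩ := isCompact_univ.exists_bound_of_continuousOn hc.continuousOn
  refine le_liminf_of_le (by isBoundedDefault) ?_
  filter_upwards [eventually_energy_le hn0 hp g₀ g hinv hbd (differential h) hc.measurable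
    (fun x => (le_abs_self _).trans (hL x trivial))
    (hhE.trans_lt (ENNReal.ofReal_lt_ofReal_iff (by positivity) |>.2
      (by linarith : 1 + δ / 2 < 1 + δ)))] with j hj
  have hadm : Admissible (g j) g₀ p D fun x => (1 + δ)⁻¹ * h x := by
    refine admissible_const_mul (g j) g₀ hp hn hD hδ hh (fun x y => (hhH x y).trans ?_) hj
    gcongr
    linarith
  refine le_trans (ENNReal.ofReal_le_ofReal ?_)
    (le_iSup₂ (f := fun (f : M → ℝ) (_ : Admissible (g j) g₀ p D f) =>
      ENNReal.ofReal |f x₁ - f x₂|) _ hadm)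
  have hc0 : 0 < (1 + δ)⁻¹ := by positivity
  rw [← mul_sub, abs_mul, abs_of_pos hc0]
  refine mul_le_mul_of_nonneg_left ?_ hc0.le
  have h1 := abs_le.1 (hhf x₁)
  have h2 := abs_le.1 (hhf x₂)
  cases abs_cases (f x₁ - f x₂) <;> cases abs_cases (h x₁ - h x₂) <;> linarith

end Semicontinuity

end ModifiedDp

theorem theorem3p1 {n : ℕ} {M : Type*} [TopologicalSpace M] [T2Space M] [CompactSpace M]
    [ConnectedSpace M] [ChartedSpace (ModifiedDp.Eu n) M] [IsManifold (𝓡 n) ∞ M]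
    [MeasurableSpace M] [BorelSpace M]
    (g₀ : ModifiedDp.SmoothMetric n M) (g : ℕ → ModifiedDp.ContMetric n M)
    (p D : ℝ) (hp : (n : ℝ) < p) (hD : 0 < D)
    (hinv : Tendsto
      (fun j => ∫⁻ x, ENNReal.ofReal
          (ModifiedDp.invMetricDiffNorm g₀.toContinuousRiemannianMetric (g j) x)
            ^ ((n : ℝ) * (p - 1) / 2)
        ∂(ModifiedDp.vol g₀.toContinuousRiemannianMetric))
      atTop (𝓝 0))
    (hbd : ∃ C : ℝ≥0, ∀ j,
      ∫⁻ x, ENNReal.ofReal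
          (ModifiedDp.metricNorm g₀.toContinuousRiemannianMetric (g j) x) ^ ((n : ℝ) / 2)
        ∂(ModifiedDp.vol g₀.toContinuousRiemannianMetric) ≤ (C : ℝ≥0∞))
    (x₁ x₂ : M) :
    ModifiedDp.modDist g₀.toContinuousRiemannianMetric g₀.toContinuousRiemannianMetric p D x₁ x₂
      ≤ liminf
          (fun j => ModifiedDp.modDist (g j) g₀.toContinuousRiemannianMetric p D x₁ x₂)
          atTop := by
  refine iSup₂_le fun f hf => ?_
  rcases Nat.eq_zero_or_pos n with hn | hn
  · have := ModifiedDp.subsingleton_of_dim_eq_zero (M := M) hn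
    simp [Subsingleton.elim x₁ x₂]
  · have hlim : Tendsto (fun δ : ℝ => ENNReal.ofReal ((1 + δ)⁻¹ * (|f x₁ - f x₂| - δ))) (𝓝[>] 0)
        (𝓝 (ENNReal.ofReal |f x₁ - f x₂|)) := by
      refine (ENNReal.tendsto_ofReal ?_).mono_left nhdsWithin_le_nhds
      have hc : ContinuousAt (fun δ : ℝ => (1 + δ)⁻¹ * (|f x₁ - f x₂| - δ)) 0 :=
        (ContinuousAt.inv₀ (by fun_prop) (by norm_num)).mul (by fun_prop)
      simpa [ContinuousAt] using hc
    refine le_of_tendsto hlim ?_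
    filter_upwards [self_mem_nhdsWithin] with δ hδ
    exact ModifiedDp.le_liminf_modDist_of_admissible hn _ g hp hD hinv hbd hf hδ x₁ x₂
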